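/- **Setting.** Let $({\mathfrak X},\rho)$ be a locally compact metric space with its Borel $\sigma$-algebra; powers of ${\mathfrak X}$ carry the product $\sigma$-algebra. All processes have time set $\mathbb R^+=[0,\infty)$ and values in ${\mathfrak X}$. A process $Y$ has the *Markov property at time $s$* w.r.t. a filtration $\{\mathcal G_t\}$ if it is adapted and for all $t_1,\dots,t_k>s$ there is a stochastic kernel $P_{st_1\dots t_k}(x,A)$ with $P\big((Y(t_1),\dots,Y(t_k))\in A\mid\mathcal G_s\big)=P_{st_1\dots t_k}(Y(s),A)$ a.s. for every measurable $A\subset{\mathfrak X}^k$. Let $X$ be a (non-terminating) homogeneous Markov process in the sense of Dynkin: $X(t)$, $t\ge 0$, are defined on a sample space with shift operators $\theta_h$ ($X(t)\circ\theta_h=X(t+h)$) and probabilities $P_x$ with $P_x(X(0)=x)=1$, and $P_x(\theta_s^{-1}A\mid\sigma(X(r),r\le s))=P_{X(s)}(A)$ a.s. for $A\in\sigma(X(r), r\ge 0)$. The process $X$ is considered under $P_\nu=\int P_x\,\nu(dx)$ with an arbitrary initial distribution $\nu$. Let $X_n$, $n\ge 1$, be processes having the Markov property at all points $i/n$, $i\in\mathbb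 Z_+$, w.r.t. their own filtrations, and fix a version of their kernels (conditional finite-dimensional distributions given $X_n(i/n)=x$). The sequence $\{X_n\}$ *provides Markov approximation for $X$* if for all $\gamma>0$, $T<\infty$ there exist an integer $K=K(\gamma,T)\ge1$ and two-component processes $\hat Y_n=(\hat X_n,\hat X^n)$ on another probability space such that (i) $\hat X_n$ has the same law (finite-dimensional distributions) as $X_n$, and $\hat X^n$ the same law as $X$; (ii) $\hat Y_n$, $\hat X_n$ and $\hat X^n$ have the Markov property at the points $iK/n$, $i\ge1$, w.r.t. the filtration $\sigma(\hat Y_n(s),s\le t)$; (iii) $\limsup_{n}P\big(\sup_{1\le i\le Tn/K}\rho(\hat X_n(iK/n),\hat X^n(iK/n))>\gamma\big)<\gamma$. A *$W$-functional* $\phi$ of $X$ is a family of $\mathbb R^+$-valued $\phi^{s,t}$, $0\le s\le t$, such that $\phi^{s,t}$ is measurable w.r.t. the completion (under every $P_\nu$) of $\sigma(X(r),s\le r\le t)$; almost surely under every $P_\nu$, $\phi^{s,t}+\phi^{t,r}=\phi^{s,r}$ for all $s\le t\le r$ and $\phi^{s,t}$ is continuous in $t$; $\phi^{s,t}\circ\theta_h=\phi^{s+h,t+h}$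 a.s.; and $\sup_xE_x\phi^{0,t}<\infty$ for all $t$. Its *characteristic* is $f^{s,t}(x)=E[\phi^{s,t}\mid X(s)=x]=E_x\phi^{0,t-s}$. Let $L\ge1$ be fixed, let $F_n:{\mathfrak X}^L\to\mathbb R^+$ be measurable, and put $$\phi_n^{s,t}=\phi_n^{s,t}(X_n)=\sum_{k:\,s\le k/n<t}F_n\Big(X_n\big(\tfrac kn\big),X_n\big(\tfrac{k+1}n\big),\dots,X_n\big(\tfrac{k+L-1}n\big)\Big),$$ $$f_n^{s,t}(x)=E[\phi_n^{s,t}\mid X_n(s)=x],\qquad s=\tfrac in,\ i\in\mathbb Z_+,\ t>s,$$ the latter being the integral over the fixed conditional finite-dimensional distribution of $X_n$ at the points $(i+1)/n,(i+2)/n,\dots$ that enter $\phi_n^{s,t}$. On ${\mathbb T}=\{(s,t):0\le s\le t\}$ let $\psi_n$ be the random broken lines $$\psi_n^{s,t}=\phi_n^{\frac{j-1}n,\frac{k-1}n}-(ns-j+1)\,\phi_n^{\frac{j-1}n,\frac jn}+(nt-k+1)\,\phi_n^{\frac{k-1}n,\frac kn},\qquad s\in\big[\tfrac{j-1}n,\tfrac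 jn\big),\ t\in\big[\tfrac{k-1}n,\tfrac kn\big).$$ **Theorem.** Let $\{X_n\}$ provide Markov approximation for the homogeneous Markov process $X$. Assume: 1. the functions $F_n$ are bounded and $\delta(F_n)=\sup_{x_1,\dots,x_L\in{\mathfrak X}}F_n(x_1,\dots,x_L)\to0$, $n\to\infty$; 2. there is a function $f$ which is the characteristic of some $W$-functional $\phi=\phi(X)$ of $X$, such that for each $T$ $$\sup_{s=i/n,\ t\in(s,T)}\ \sup_{x\in{\mathfrak X}}\big|f_n^{s,t}(x)-f^{s,t}(x)\big|\to0,\qquad n\to\infty;$$ 3. $f$ is uniformly continuous in $x$: for each $T$, $\ \sup_{0\le s\le t<T}|f^{s,t}(x')-f^{s,t}(x'')|\to0$ as $\rho(x',x'')\to0$. Then $\psi_n(X_n)\Rightarrow\phi(X)=\{\phi^{s,t}(X),(s,t)\in{\mathbb T}\}$: the broken lines converge in distribution in the space $C({\mathbb T},\mathbb R^+)$ with the topology of locally uniform convergence. -/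

import Mathlib

open MeasureTheory ProbabilityTheory Filter Topology
open scoped NNReal ENNReal

universe u v v' w

namespace MarkovInvariance

/-! ### Markov property and Markov approximation -/

section Markov

variable {E : Type u} [MeasurableSpace E] {Ω : Type v}

/-- The canonical filtration of a process: `σ(X r, r ≤ s)`. -/
abbrev pastSigma (X : ℝ≥0 → Ω → E) (s : ℝ≥0) : MeasurableSpace Ω :=
  ⨆ r : ℝ≥0, ⨆ _ : r ≤ s, MeasurableSpace.comap (X r) inferInstance

/-- The σ-algebra `σ(X r, s ≤ r ≤ t)`. -/
abbrev windowSigma (X : ℝ≥0 → Ω → E) (s t : ℝ≥0) : MeasurableSpace Ω :=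
  ⨆ r : ℝ≥0, ⨆ _ : s ≤ r ∧ r ≤ t, MeasurableSpace.comap (X r) inferInstance

/-- A family of kernels `P_{s t₁ … t_k}(x, ·)` on `E ^ k`; here `s` is fixed, and the arguments
are `k` and `(t₁, …, t_k)`. -/
abbrev KernelFamily (E : Type u) [MeasurableSpace E] : Type u :=
  (k : ℕ) → (Fin k → ℝ≥0) → Kernel E (Fin k → E)

/-- `κ` is a family of conditional finite-dimensional distributions of `X` after time `s`, given
the σ-algebra `𝒢`: for `t₁, …, t_k > s`, `κ k t` is a stochastic kernel and
`E[1_A(X(t₁), …, X(t_k)) | 𝒢] = κ k t (X(s), A)` a.s. -/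
def IsCondFDD [MeasurableSpace Ω] (μ : Measure Ω) (X : ℝ≥0 → Ω → E)
    (𝒢 : MeasurableSpace Ω) (s : ℝ≥0) (κ : KernelFamily E) : Prop :=
  ∀ (k : ℕ) (t : Fin k → ℝ≥0), (∀ j, s < t j) →
    IsMarkovKernel (κ k t) ∧
    ∀ A : Set (Fin k → E), MeasurableSet A →
      μ[((fun ω j => X (t j) ω) ⁻¹' A).indicator (fun _ => (1 : ℝ)) | 𝒢]
        =ᵐ[μ] fun ω => (κ k t (X s ω)).real A

/-- The Markov property of the process `X` at the time moment `s` w.r.t. the filtration `𝒢`. -/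
def HasMarkovPropertyAt [MeasurableSpace Ω] (μ : Measure Ω) (X : ℝ≥0 → Ω → E)
    (𝒢 : ℝ≥0 → MeasurableSpace Ω) (s : ℝ≥0) : Prop :=
  (∀ t, Measurable[𝒢 t] (X t)) ∧ ∃ κ : KernelFamily E, IsCondFDD μ X (𝒢 s) s κ

end Markov

/-- The sequence `Xn` provides Markov approximation for the process `X`. The pair of processes
`(X1 n, X2 n)` is the coupling `(X̂_n, X̂^n)`. Processes are equal in distribution when their laws
on the product σ-algebra of `ℝ≥0 → E`, i.e. their finite-dimensional distributions, are equal. -/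
def ProvidesMarkovApproximation {E : Type u} [PseudoMetricSpace E] [MeasurableSpace E]
    {Ωn : ℕ → Type v} [∀ n, MeasurableSpace (Ωn n)] (μn : ∀ n, Measure (Ωn n))
    (Xn : ∀ n, ℝ≥0 → Ωn n → E)
    {Ω : Type v'} [MeasurableSpace Ω] (μ : Measure Ω) (X : ℝ≥0 → Ω → E) : Prop :=
  ∀ γ : ℝ, 0 < γ → ∀ T : ℝ≥0, ∃ K : ℕ, 0 < K ∧
    ∃ (Ω' : Type w) (_ : MeasurableSpace Ω') (P : Measure Ω') (X1 X2 : ℕ → ℝ≥0 → Ω' → E),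
      IsProbabilityMeasure P ∧
      (∀ n t, Measurable (X1 n t)) ∧ (∀ n t, Measurable (X2 n t)) ∧
      (∀ n, 0 < n →
        IdentDistrib (fun ω t => X1 n t ω) (fun ω t => Xn n t ω) P (μn n) ∧
        IdentDistrib (fun ω t => X2 n t ω) (fun ω t => X t ω) P μ) ∧
      (∀ n, 0 < n → ∀ i : ℕ, 1 ≤ i →
        HasMarkovPropertyAt P (fun t ω => (X1 n t ω, X2 n t ω))
          (pastSigma fun t ω => (X1 n t ω, X2 n t ω)) ((i * K : ℝ≥0) / n) ∧
        HasMarkovPropertyAt P (X1 n)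
          (pastSigma fun t ω => (X1 n t ω, X2 n t ω)) ((i * K : ℝ≥0) / n) ∧
        HasMarkovPropertyAt P (X2 n)
          (pastSigma fun t ω => (X1 n t ω, X2 n t ω)) ((i * K : ℝ≥0) / n)) ∧
      limsup (fun n : ℕ => P {ω | ∃ i : ℕ, 1 ≤ i ∧ (i : ℝ≥0) ≤ T * n / K ∧
          γ < dist (X1 n ((i * K : ℝ≥0) / n) ω) (X2 n ((i * K : ℝ≥0) / n) ω)}) atTop
        < ENNReal.ofReal γ

/-! ### Homogeneous Markov processes and W-functionals -/

/-- A (non-terminating) homogeneous Markov process in the sense of Dynkin: trajectories `X t ω`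
on a sample space with shift operators `θ`, and probabilities `P x` of the process started
at `x`. -/
structure HomogeneousMarkovProcess (E : Type u) [MeasurableSpace E] (Ω : Type v)
    [mΩ : MeasurableSpace Ω] where
  X : ℝ≥0 → Ω → E
  θ : ℝ≥0 → Ω → Ω
  P : Kernel E Ω
  isMarkovKernel : IsMarkovKernel P
  generated : mΩ = ⨆ t : ℝ≥0, MeasurableSpace.comap (X t) inferInstance
  start : ∀ x, ∀ᵐ ω ∂(P x), X 0 ω = x
  shift : ∀ s t ω, X t (θ s ω) = X (s + t) ω
  markov : ∀ x s (A : Set Ω), MeasurableSet A →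
    (P x)[(θ s ⁻¹' A).indicator (fun _ => (1 : ℝ)) | pastSigma X s]
      =ᵐ[P x] fun ω => (P (X s ω)).real A

attribute [instance] HomogeneousMarkovProcess.isMarkovKernel

namespace HomogeneousMarkovProcess

variable {E : Type u} [MeasurableSpace E] {Ω : Type v} [MeasurableSpace Ω]

/-- The law `P_ν = ∫ P_x ν(dx)` of the process with initial distribution `ν`. -/
noncomputable abbrev law (M : HomogeneousMarkovProcess E Ω) (ν : Measure E) : Measure Ω :=
  ν.bind M.P

/-- `φ` is a W-functional of `M`: a nonnegative continuous homogeneous additive functional with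
`sup_x E_x φ^{0,t} < ∞`. Almost surely means: almost surely for every initial distribution;
and `φ^{s,t}` is measurable w.r.t. the completion of `σ(X r, s ≤ r ≤ t)` for every initial
distribution. -/
structure IsWFunctional (M : HomogeneousMarkovProcess E Ω) (φ : ℝ≥0 → ℝ≥0 → Ω → ℝ≥0) :
    Prop where
  adapted : ∀ (ν : Measure E) [IsProbabilityMeasure ν] (s t : ℝ≥0), s ≤ t →
    AEStronglyMeasurable[windowSigma M.X s t] (φ s t) (M.law ν)
  additive : ∀ (ν : Measure E) [IsProbabilityMeasure ν], ∀ᵐ ω ∂(M.law ν),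
    ∀ s t r : ℝ≥0, s ≤ t → t ≤ r → φ s t ω + φ t r ω = φ s r ω
  continuous : ∀ (ν : Measure E) [IsProbabilityMeasure ν], ∀ᵐ ω ∂(M.law ν),
    ∀ s : ℝ≥0, ContinuousOn (fun t => φ s t ω) (Set.Ici s)
  homogeneous : ∀ (ν : Measure E) [IsProbabilityMeasure ν] (s t h : ℝ≥0), s ≤ t →
    ∀ᵐ ω ∂(M.law ν), φ s t (M.θ h ω) = φ (s + h) (t + h) ω
  bounded : ∀ t : ℝ≥0, (⨆ x : E, ∫⁻ ω, (φ 0 t ω : ℝ≥0∞) ∂(M.P x)) < ∞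

/-- The characteristic `f^{s,t}(x) = E[φ^{s,t} | X(s) = x] = E_x φ^{0,t-s}`, `s ≤ t`, of a
homogeneous additive functional `φ`. -/
noncomputable def characteristic (M : HomogeneousMarkovProcess E Ω)
    (φ : ℝ≥0 → ℝ≥0 → Ω → ℝ≥0) (s t : ℝ≥0) (x : E) : ℝ :=
  ∫ ω, (φ 0 (t - s) ω : ℝ) ∂(M.P x)

end HomogeneousMarkovProcess

/-! ### Additive functionals of discrete-time skeletons, their characteristics, broken lines -/

section Functionals

variable {E : Type u} {L : ℕ}

/-- `∑_{a ≤ k < b} F(y_k, y_{k+1}, …, y_{k+L-1})`. -/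
def windowSum (F : (Fin L → E) → ℝ≥0) (y : ℕ → E) (a b : ℕ) : ℝ≥0 :=
  ∑ k ∈ Finset.Ico a b, F fun l => y (k + l)

/-- `φ_n^{s,t}(Y) = ∑_{k : s ≤ k/n < t} F(Y(k/n), …, Y((k+L-1)/n))`; see `mem_Ico_ceil_iff` for
the range of summation. -/
noncomputable def addFunctional (n : ℕ) (F : (Fin L → E) → ℝ≥0) (Y : ℝ≥0 → E) (s t : ℝ≥0) :
    ℝ≥0 :=
  windowSum F (fun k => Y ((k : ℝ≥0) / n)) ⌈(n : ℝ≥0) * s⌉₊ ⌈(n : ℝ≥0) * t⌉₊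

theorem mem_Ico_ceil_iff {n : ℕ} (hn : 0 < n) (s t : ℝ≥0) (k : ℕ) :
    k ∈ Finset.Ico ⌈(n : ℝ≥0) * s⌉₊ ⌈(n : ℝ≥0) * t⌉₊ ↔
      s ≤ (k : ℝ≥0) / n ∧ (k : ℝ≥0) / n < t := by
  have h : (0 : ℝ≥0) < n := by exact_mod_cast hn
  rw [Finset.mem_Ico, Nat.ceil_le, Nat.lt_ceil, le_div_iff₀ h, div_lt_iff₀ h, mul_comm s,
    mul_comm t]

/-- The sequence with value `x` at `i` and values `z₁, …, z_m` at `i + 1, …, i + m` (the other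
values are irrelevant). -/
def glue (i : ℕ) (x : E) {m : ℕ} (z : Fin m → E) (k : ℕ) : E :=
  if h : i < k ∧ k ≤ i + m then z ⟨k - i - 1, by omega⟩ else x

/-- The number of grid points `j/n > i/n` that enter `φ_n^{i/n,t}`, where `i/n < t` and `1 ≤ L`:
these points are `(i+1)/n, …, (⌈nt⌉ + L - 2)/n`. -/
noncomputable def numSteps (L n i : ℕ) (t : ℝ≥0) : ℕ := ⌈(n : ℝ≥0) * t⌉₊ + L - 2 - i

/-- The characteristic `f_n^{i/n,t}(x) = E[φ_n^{i/n,t}(Y) | Y(i/n) = x]`, `t > i/n`: the integral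
over the conditional distribution of `(Y((i+1)/n), …, Y((i+m)/n))`, `m = numSteps L n i t`, given
`Y(i/n) = x`, where `κ` is the family of conditional finite-dimensional distributions of `Y`
given `Y(i/n)`. -/
noncomputable def chainCharacteristic [MeasurableSpace E] (n : ℕ) (F : (Fin L → E) → ℝ≥0)
    (i : ℕ) (κ : KernelFamily E) (t : ℝ≥0) (x : E) : ℝ :=
  ∫ z, (windowSum F (glue i x z) i ⌈(n : ℝ≥0) * t⌉₊ : ℝ)
    ∂(κ (numSteps L n i t) (fun j => ((i + j + 1 : ℕ) : ℝ≥0) / n) x)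

/-- The sup-norm `sup_x |g(x)|`. -/
noncomputable def supNorm {D : Type*} (g : D → ℝ) : ℝ≥0∞ := ⨆ x, ‖g x‖ₑ

/-- The set of pairs `(s, t)` with `0 ≤ s ≤ t`. -/
abbrev TimePairs : Type := {p : ℝ≥0 × ℝ≥0 // p.1 ≤ p.2}

/-- `C(𝕋, ℝ⁺)` (with its topology of locally uniform convergence) carries the Borel σ-algebra. -/
instance instMeasurableSpacePaths : MeasurableSpace C(TimePairs, ℝ≥0) := borel _

instance instBorelSpacePaths : BorelSpace C(TimePairs, ℝ≥0) := ⟨rfl⟩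

/-- The value at `(s, t)`, `s ≤ t`, of the random broken line related to `φ_n`: for
`s ∈ [j/n, (j+1)/n)`, `t ∈ [k/n, (k+1)/n)` it is
`φ_n^{j/n,k/n} - (ns - j) φ_n^{j/n,(j+1)/n} + (nt - k) φ_n^{k/n,(k+1)/n}`. -/
noncomputable def brokenLineValue (n : ℕ) (F : (Fin L → E) → ℝ≥0) (Y : ℝ≥0 → E)
    (s t : ℝ≥0) : ℝ :=
  let j : ℕ := ⌊(n : ℝ≥0) * s⌋₊
  let k : ℕ := ⌊(n : ℝ≥0) * t⌋₊
  (addFunctional n F Y ((j : ℝ≥0) / n) ((k : ℝ≥0) / n) : ℝ)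
    - (n * s - j) * addFunctional n F Y ((j : ℝ≥0) / n) (((j + 1 : ℕ) : ℝ≥0) / n)
    + (n * t - k) * addFunctional n F Y ((k : ℝ≥0) / n) (((k + 1 : ℕ) : ℝ≥0) / n)

/-- The piecewise linear interpolation of the partial sums of `a`. -/
noncomputable def interp (a : ℕ → ℝ≥0) (r : ℝ≥0) : ℝ≥0 :=
  ∑ k ∈ Finset.range ⌊r⌋₊, a k + (r - ⌊r⌋₊) * a ⌊r⌋₊

theorem interp_eq (a : ℕ → ℝ≥0) (r : ℝ≥0) (N : ℕ) (h : ⌊r⌋₊ < N) :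
    interp a r = ∑ k ∈ Finset.range N, min 1 (r - k) * a k := by
  have h0 : (⌊r⌋₊ : ℝ≥0) ≤ r := Nat.floor_le zero_le
  have h1 : r < (⌊r⌋₊ : ℝ≥0) + 1 := Nat.lt_floor_add_one r
  rw [← Finset.sum_range_add_sum_Ico _ h.le, Finset.sum_eq_sum_Ico_succ_bot h, interp]
  have e1 : ∑ k ∈ Finset.range ⌊r⌋₊, min 1 (r - k) * a k = ∑ k ∈ Finset.range ⌊r⌋₊, a k := by
    refine Finset.sum_congr rfl fun k hk => ?_
    have hk' : (k : ℝ≥0) + 1 ≤ ⌊r⌋₊ := by exact_mod_cast Finset.mem_range.mp hk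
    rw [min_eq_left, one_mul]
    exact le_tsub_of_add_le_left (hk'.trans h0)
  have e2 : ∑ k ∈ Finset.Ico (⌊r⌋₊ + 1) N, min 1 (r - k) * a k = 0 := by
    refine Finset.sum_eq_zero fun k hk => ?_
    have hk' : (⌊r⌋₊ : ℝ≥0) + 1 ≤ k := by exact_mod_cast (Finset.mem_Ico.mp hk).1
    rw [tsub_eq_zero_of_le (h1.le.trans hk')]
    simp
  have e3 : min 1 (r - (⌊r⌋₊ : ℝ≥0)) = r - ⌊r⌋₊ :=
    min_eq_right (tsub_le_iff_left.mpr h1.le)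
  rw [e1, e2, e3, add_zero]

theorem interp_mono (a : ℕ → ℝ≥0) : Monotone (interp a) := by
  intro r r' h
  have hf : ⌊r⌋₊ ≤ ⌊r'⌋₊ := Nat.floor_mono h
  rw [interp_eq a r (⌊r'⌋₊ + 1) (by omega), interp_eq a r' (⌊r'⌋₊ + 1) (by omega)]
  gcongr

theorem interp_continuous (a : ℕ → ℝ≥0) : Continuous (interp a) := by
  rw [continuous_iff_continuousAt]
  intro r
  have hr : r < ((⌊r⌋₊ + 1 : ℕ) : ℝ≥0) := by exact_mod_cast Nat.lt_floor_add_one r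
  have hc : Continuous fun r' : ℝ≥0 =>
      ∑ k ∈ Finset.range (⌊r⌋₊ + 1), min 1 (r' - k) * a k := by fun_prop
  refine hc.continuousAt.congr ?_
  filter_upwards [eventually_lt_nhds hr] with r' h'
  exact (interp_eq a r' _ ((Nat.floor_lt zero_le).mpr h')).symm

theorem brokenLineValue_eq (n : ℕ) (F : (Fin L → E) → ℝ≥0) (Y : ℝ≥0 → E) {s t : ℝ≥0}
    (hst : s ≤ t) :
    brokenLineValue n F Y s t =
      (interp (fun k => F fun l => Y (((k + l : ℕ) : ℝ≥0) / n)) (n * t) : ℝ)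
        - interp (fun k => F fun l => Y (((k + l : ℕ) : ℝ≥0) / n)) (n * s) := by
  rcases Nat.eq_zero_or_pos n with rfl | hn
  · simp [brokenLineValue, addFunctional, windowSum]
  have hn' : (n : ℝ≥0) ≠ 0 := by exact_mod_cast hn.ne'
  have hc : ∀ j : ℕ, ⌈(n : ℝ≥0) * ((j : ℝ≥0) / n)⌉₊ = j := fun j => by
    rw [mul_div_cancel₀ _ hn', Nat.ceil_natCast]
  have hf : ⌊(n : ℝ≥0) * s⌋₊ ≤ ⌊(n : ℝ≥0) * t⌋₊ := Nat.floor_mono (by gcongr)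
  have hs : (⌊(n : ℝ≥0) * s⌋₊ : ℝ≥0) ≤ n * s := Nat.floor_le zero_le
  have ht : (⌊(n : ℝ≥0) * t⌋₊ : ℝ≥0) ≤ n * t := Nat.floor_le zero_le
  simp only [brokenLineValue, addFunctional, hc, windowSum, interp]
  rw [Nat.Ico_succ_singleton, Nat.Ico_succ_singleton, Finset.sum_singleton,
    Finset.sum_singleton]
  push_cast [NNReal.coe_sub hs, NNReal.coe_sub ht]
  rw [Finset.sum_Ico_eq_sub _ hf]
  ring

theorem brokenLineValue_nonneg (n : ℕ) (F : (Fin L → E) → ℝ≥0) (Y : ℝ≥0 → E) {s t : ℝ≥0}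
    (hst : s ≤ t) : 0 ≤ brokenLineValue n F Y s t := by
  rw [brokenLineValue_eq n F Y hst, sub_nonneg, NNReal.coe_le_coe]
  exact interp_mono _ (by gcongr)

theorem brokenLineValue_continuous (n : ℕ) (F : (Fin L → E) → ℝ≥0) (Y : ℝ≥0 → E) :
    Continuous fun p : TimePairs => brokenLineValue n F Y p.1.1 p.1.2 := by
  simp only [fun p : TimePairs => brokenLineValue_eq n F Y p.2]
  have h := interp_continuous fun k => F fun l => Y (((k + l : ℕ) : ℝ≥0) / n)
  fun_prop

/-- The broken line `ψ_n(Y)` as an element of `C(𝕋, ℝ⁺)`. -/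
noncomputable def brokenLine (n : ℕ) (F : (Fin L → E) → ℝ≥0) (Y : ℝ≥0 → E) :
    C(TimePairs, ℝ≥0) where
  toFun p := ⟨brokenLineValue n F Y p.1.1 p.1.2, brokenLineValue_nonneg n F Y p.2⟩
  continuous_toFun := (brokenLineValue_continuous n F Y).subtype_mk _

open Classical in
/-- The trajectory `(s, t) ↦ φ^{s,t}(ω)` as an element of `C(𝕋, ℝ⁺)`. For a W-functional it is
continuous almost surely; on the exceptional null set the value is `0`. -/
noncomputable def functionalPath {Ω : Type v} (φ : ℝ≥0 → ℝ≥0 → Ω → ℝ≥0) (ω : Ω) :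
    C(TimePairs, ℝ≥0) :=
  if h : Continuous fun p : TimePairs => φ p.1.1 p.1.2 ω then ⟨_, h⟩ else 0

end Functionals

end MarkovInvariance

open MarkovInvariance

/-!
The proof compares the broken line with the W-functional on the probability space of a coupling.

Fix a coupling `(X̂_n, X̂^n)` whose components are, with a large probability, within `γ` of each
other at the points `jK/n`. A W-functional is a measurable function `Φ` of the trajectory
(`exists_pathFunctional`), so it makes sense for `X̂^n`. Cut `[0, t]` into blocks of `K` steps, and
let `A_j`, `B_j` be the increments over the `j`-th block of the additive functional of `X̂_n` and of
the W-functional of `X̂^n`. By the Markov property of both components w.r.t. the common filtration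
(`IsCondFDD.setLIntegral_eq`), the conditional means at time `jK/n` of the remainders `∑_{l ≥ j}
A_l` and `∑_{l ≥ j} B_l` are the characteristics `f_n^{jK/n,t}(X̂_n(jK/n))` and
`f^{jK/n,t}(X̂^n(jK/n))`. They are close to each other, since `f_n` is uniformly close to `f`, `f`
is uniformly continuous, and the components are close.

For `D_j = A_j - B_j` one has `(∑ D_j)² ≤ 3 ∑ D_j² + 2 ∑ D_j ∑_{l ≥ j + 2} D_l` (`sq_sum_le`); the
gap of two blocks is there because `A_j` looks `L - 1` steps beyond the end of its block.
Conditioning makes the expectation of the off-diagonal part small. The diagonal part is small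
because `A_j ≤ K δ(F_n)` and because of Khasminskii's bound `E B_j² ≤ 2 sup_x E_x φ^{0,K/n} E B_j`
(`lintegral_sq_le`), where the supremum tends to `0`, being close to that of the characteristic
`f_n^{0,K/n} ≤ K δ(F_n)`. Hence the functionals are close in mean square (`integral_sq_sum_sub_le`,
`integral_sq_windowSum_sub_le`), and so are in mean the broken line and the W-functional at each
time (`integral_abs_brokenLine_sub_le`).

Both paths are increments of increasing functions, and the limit is continuous, so closeness at the
points of a fine partition gives locally uniform closeness (`dist_le_of_partition`). Random elements
that can be coupled so as to be close in probability have close integrals of bounded Lipschitz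
functions, which yields the weak convergence (`tendsto_of_forall_coupling`).
-/

namespace MarkovInvariance

/-! ### The path space `C(𝕋, ℝ⁺)` -/

instance instLocallyCompactSpaceTimePairs : LocallyCompactSpace TimePairs :=
  (isClosed_le continuous_fst continuous_snd).isClosedEmbedding_subtypeVal.locallyCompactSpace

/-- A map into `C(𝕋, ℝ⁺)` is measurable as soon as all its evaluations are. For a compact set `S`
and an open set `U`, a path maps `S` to `U` iff its distance to `Uᶜ` is bounded away from `0` on a
countable dense subset of `S`. -/
theorem measurable_of_eval {Ω : Type*} [MeasurableSpace Ω] {Ψ : Ω → C(TimePairs, ℝ≥0)}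
    (h : ∀ p, Measurable fun ω => Ψ ω p) : Measurable Ψ := by
  have hb : instMeasurableSpacePaths = MeasurableSpace.generateFrom _ :=
    borel_eq_generateFrom_of_subbasis (ContinuousMap.compactOpen_eq (X := TimePairs) (Y := ℝ≥0))
  rw [hb]
  refine measurable_generateFrom ?_
  rintro _ ⟨S, hS, U, hU, rfl⟩
  rw [Set.mem_ofPred_eq] at hS hU
  obtain ⟨D, hDc, hD⟩ := TopologicalSpace.exists_countable_dense S
  have key : Ψ ⁻¹' {f : C(TimePairs, ℝ≥0) | Set.MapsTo f S U} =
      ⋃ n : ℕ, ⋂ x ∈ D, {ω | (n : ℝ≥0∞)⁻¹ ≤ Metric.infEDist (Ψ ω x) Uᶜ} := by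
    ext ω
    simp only [Set.mem_preimage, Set.mem_ofPred_eq, Set.mem_iUnion, Set.mem_iInter]
    have hc : Continuous fun x : TimePairs => Metric.infEDist (Ψ ω x) Uᶜ :=
      Metric.continuous_infEDist.comp (Ψ ω).continuous
    constructor
    · intro hm
      rcases S.eq_empty_or_nonempty with rfl | hne
      · exact ⟨0, fun x => x.2.elim⟩
      obtain ⟨x₀, hx₀, hmin⟩ := hS.exists_isMinOn hne hc.continuousOn
      have hpos : Metric.infEDist (Ψ ω x₀) Uᶜ ≠ 0 := by
        have h1 : Ψ ω x₀ ∉ Uᶜ := fun hn => hn (hm hx₀)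
        rwa [Metric.mem_iff_infEDist_zero_of_closed hU.isClosed_compl] at h1
      obtain ⟨n, hn⟩ := ENNReal.exists_inv_nat_lt hpos
      exact ⟨n, fun x _ => hn.le.trans (hmin x.2)⟩
    · rintro ⟨n, hn⟩ x hx
      have hcl : IsClosed {y : S | (n : ℝ≥0∞)⁻¹ ≤ Metric.infEDist (Ψ ω y) Uᶜ} :=
        isClosed_le continuous_const (hc.comp continuous_subtype_val)
      have h1 : (⟨x, hx⟩ : S) ∈ {y : S | (n : ℝ≥0∞)⁻¹ ≤ Metric.infEDist (Ψ ω y) Uᶜ} :=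
        (hcl.closure_subset_iff.2 fun y hy => hn y hy) (hD _)
      by_contra hxU
      have h2 : Metric.infEDist (Ψ ω x) Uᶜ = 0 := Metric.infEDist_zero_of_mem hxU
      simp [h2] at h1
  rw [key]
  refine MeasurableSet.iUnion fun n => MeasurableSet.biInter hDc fun x _ => ?_
  exact measurableSet_le measurable_const (measurable_infEDist.comp (h x))

theorem aemeasurable_of_eval {Ω : Type*} [MeasurableSpace Ω] {μ : Measure Ω}
    {Ψ : Ω → C(TimePairs, ℝ≥0)} (h : ∀ p, AEMeasurable (fun ω => Ψ ω p) μ) : AEMeasurable Ψ μ := by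
  -- null measurability is measurability w.r.t. the completed σ-algebra
  have : NullMeasurable Ψ μ := by
    have h1 : ∀ p, Measurable fun ω : NullMeasurableSpace Ω μ => Ψ ω p :=
      fun p _ hs => (h p).nullMeasurable hs
    exact measurable_of_eval (Ω := NullMeasurableSpace Ω μ) h1
  exact this.aemeasurable

theorem measurable_interp {Ω : Type*} [MeasurableSpace Ω] {a : ℕ → Ω → ℝ≥0}
    (ha : ∀ k, Measurable (a k)) (r : ℝ≥0) : Measurable fun ω => interp (fun k => a k ω) r := by
  unfold interp
  fun_prop

theorem measurable_brokenLine {E : Type*} [MeasurableSpace E] {L : ℕ} {Ω : Type*}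
    [MeasurableSpace Ω] (n : ℕ) {F : (Fin L → E) → ℝ≥0} (hF : Measurable F) {Y : ℝ≥0 → Ω → E}
    (hY : ∀ t, Measurable (Y t)) : Measurable fun ω => brokenLine n F fun t => Y t ω := by
  refine measurable_of_eval fun p => ?_
  have h1 : Measurable fun ω => brokenLineValue n F (fun t => Y t ω) p.1.1 p.1.2 := by
    simp only [brokenLineValue_eq n F _ p.2]
    have h2 : ∀ k : ℕ, Measurable fun ω => F fun l => Y (((k + l : ℕ) : ℝ≥0) / n) ω :=
      fun k => hF.comp (measurable_pi_lambda _ fun l => hY _)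
    exact (measurable_interp h2 _).coe_nnreal_real.sub (measurable_interp h2 _).coe_nnreal_real
  exact h1.subtype_mk

/-- Two paths that are uniformly close on a large enough bounded set of pairs are close in the
metric of locally uniform convergence. -/
theorem exists_forall_dist_lt {ε : ℝ} (hε : 0 < ε) :
    letI := UniformSpace.pseudoMetricSpace C(TimePairs, ℝ≥0)
    ∃ T : ℝ≥0, ∃ η : ℝ, 0 < η ∧ ∀ c c' : C(TimePairs, ℝ≥0),
      (∀ p : TimePairs, p.1.2 ≤ T → dist (c p) (c' p) ≤ η) → dist c c' < ε := by
  let := UniformSpace.pseudoMetricSpace C(TimePairs, ℝ≥0)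
  have hmem : {q : C(TimePairs, ℝ≥0) × C(TimePairs, ℝ≥0) | dist q.1 q.2 < ε} ∈
      uniformity C(TimePairs, ℝ≥0) := Metric.dist_mem_uniformity hε
  obtain ⟨S, V, hS, hV, hSV⟩ := (ContinuousMap.mem_compactConvergence_entourage_iff _).1 hmem
  obtain ⟨η, hη, hηV⟩ := Metric.mem_uniformity_dist.1 hV
  obtain ⟨T, hT⟩ : ∃ T : ℝ≥0, ∀ p ∈ S, p.1.2 ≤ T := by
    have hc : Continuous fun p : TimePairs => p.1.2 := by fun_prop
    obtain ⟨T, hT⟩ := (hS.image hc).bddAbove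
    exact ⟨T, fun p hp => hT ⟨p, hp, rfl⟩⟩
  refine ⟨T, η / 2, by positivity, fun c c' h => ?_⟩
  refine hSV (a := (c, c')) fun p hp => hηV ((h p (hT p hp)).trans_lt (by linarith))

/-! ### Conditioning on the past -/

section Conditioning

variable {Ω : Type*} {m 𝒢 : MeasurableSpace Ω} [mΩ : MeasurableSpace Ω] {μ : Measure Ω}

/-- A conditional probability, in integrated form. -/
theorem measure_inter_eq_setLIntegral_of_condExp [IsFiniteMeasure μ]
    (hm : m ≤ mΩ) {C : Set Ω} (hC : MeasurableSet C) {ρ : Ω → ℝ≥0∞} (hρ : Measurable ρ)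
    (hρ1 : ∀ ω, ρ ω ≤ 1)
    (h : μ[C.indicator (fun _ => (1 : ℝ)) | m] =ᵐ[μ] fun ω => (ρ ω).toReal)
    {A : Set Ω} (hA : MeasurableSet[m] A) : μ (A ∩ C) = ∫⁻ ω in A, ρ ω ∂μ := by
  have hint : Integrable (fun ω => (ρ ω).toReal) μ :=
    Integrable.of_bound hρ.ennreal_toReal.aestronglyMeasurable 1 (.of_forall fun ω => by
      rw [Real.norm_of_nonneg ENNReal.toReal_nonneg]
      exact ENNReal.toReal_le_of_le_ofReal zero_le_one (by simpa using hρ1 ω))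
  have h1 : ∫ ω in A, (ρ ω).toReal ∂μ = μ.real (A ∩ C) := by
    rw [← setIntegral_congr_ae (hm _ hA) (h.mono fun ω hω _ => hω),
      setIntegral_condExp hm ((integrable_const 1).indicator hC) hA,
      setIntegral_indicator hC]
    simp
  have h2 : ENNReal.ofReal (∫ ω in A, (ρ ω).toReal ∂μ) = ∫⁻ ω in A, ρ ω ∂μ := by
    rw [ofReal_integral_eq_lintegral_ofReal hint.integrableOn
      (.of_forall fun ω => ENNReal.toReal_nonneg)]
    exact lintegral_congr fun ω => ENNReal.ofReal_toReal ((hρ1 ω).trans_lt ENNReal.one_lt_top).ne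
  rw [← h2, h1, ofReal_measureReal]

/-- If the integrals of `Z` over the sets of a σ-algebra are at most those of `H`, then so are the
integrals with any nonnegative weight measurable w.r.t. this σ-algebra. -/
theorem lintegral_mul_le_of_forall_setLIntegral_le (hm : m ≤ mΩ)
    {Z H W : Ω → ℝ≥0∞} (hZ : AEMeasurable Z μ) (hH : AEMeasurable H μ) (hW : Measurable[m] W)
    (h : ∀ A, MeasurableSet[m] A → ∫⁻ ω in A, Z ω ∂μ ≤ ∫⁻ ω in A, H ω ∂μ) :
    ∫⁻ ω, Z ω * W ω ∂μ ≤ ∫⁻ ω, H ω * W ω ∂μ := by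
  have h1 : (μ.withDensity Z).trim hm ≤ (μ.withDensity H).trim hm := by
    refine (@Measure.le_iff _ m _ _).2 fun A hA => ?_
    rw [trim_measurableSet_eq hm hA, trim_measurableSet_eq hm hA, withDensity_apply _ (hm _ hA),
      withDensity_apply _ (hm _ hA)]
    exact h A hA
  have hW' : Measurable W := hW.mono hm le_rfl
  calc ∫⁻ ω, Z ω * W ω ∂μ = ∫⁻ ω, W ω ∂(μ.withDensity Z) :=
        (lintegral_withDensity_eq_lintegral_mul₀ hZ hW'.aemeasurable).symm
    _ ≤ ∫⁻ ω, W ω ∂(μ.withDensity H) := by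
        rw [← lintegral_trim hm hW, ← lintegral_trim hm hW]
        exact lintegral_mono' h1 le_rfl
    _ = ∫⁻ ω, H ω * W ω ∂μ := lintegral_withDensity_eq_lintegral_mul₀ hH hW'.aemeasurable

theorem lintegral_mul_eq_of_forall_setLIntegral_eq (hm : m ≤ mΩ)
    {Z H W : Ω → ℝ≥0∞} (hZ : AEMeasurable Z μ) (hH : AEMeasurable H μ) (hW : Measurable[m] W)
    (h : ∀ A, MeasurableSet[m] A → ∫⁻ ω in A, Z ω ∂μ = ∫⁻ ω in A, H ω ∂μ) :
    ∫⁻ ω, Z ω * W ω ∂μ = ∫⁻ ω, H ω * W ω ∂μ :=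
  le_antisymm (lintegral_mul_le_of_forall_setLIntegral_le hm hZ hH hW fun A hA => (h A hA).le)
    (lintegral_mul_le_of_forall_setLIntegral_le hm hH hZ hW fun A hA => (h A hA).ge)

variable {E : Type*} [MeasurableSpace E]

theorem IsCondFDD.measure_inter_eq [IsFiniteMeasure μ] {X : ℝ≥0 → Ω → E}
    {s : ℝ≥0} {κ : KernelFamily E} (h : IsCondFDD μ X 𝒢 s κ)
    (h𝒢 : 𝒢 ≤ mΩ) (hX : ∀ t, Measurable (X t)) {k : ℕ} {t : Fin k → ℝ≥0} (ht : ∀ j, s < t j)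
    {D : Set (Fin k → E)} (hD : MeasurableSet D) {A : Set Ω} (hA : MeasurableSet[𝒢] A) :
    μ (A ∩ (fun ω j => X (t j) ω) ⁻¹' D) = ∫⁻ ω in A, κ k t (X s ω) D ∂μ := by
  obtain ⟨hκ, hc⟩ := h k t ht
  exact measure_inter_eq_setLIntegral_of_condExp h𝒢
    (measurable_pi_lambda _ (fun j => hX (t j)) hD)
    (((κ k t).measurable_coe hD).comp (hX s)) (fun ω => prob_le_one) (hc D hD) hA

/-- The joint law of `X s` and of `(X t₁, …, X t_k)`, in terms of the conditional
finite-dimensional distributions. -/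
theorem IsCondFDD.map_eq_compProd [IsFiniteMeasure μ] {X : ℝ≥0 → Ω → E}
    {s : ℝ≥0} {κ : KernelFamily E} (h : IsCondFDD μ X 𝒢 s κ)
    (h𝒢 : 𝒢 ≤ mΩ) (hX : ∀ t, Measurable (X t)) (hs : Measurable[𝒢] (X s))
    {k : ℕ} {t : Fin k → ℝ≥0} (ht : ∀ j, s < t j) :
    μ.map (fun ω => (X s ω, fun j => X (t j) ω)) = (μ.map (X s)) ⊗ₘ κ k t := by
  have hκ := (h k t ht).1
  have hV : Measurable fun ω j => X (t j) ω := measurable_pi_lambda _ fun j => hX (t j)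
  refine Measure.ext_prod fun {B D} hB hD => ?_
  rw [Measure.map_apply ((hX s).prodMk hV) (hB.prod hD), Measure.compProd_apply_prod hB hD,
    setLIntegral_map hB ((κ k t).measurable_coe hD) (hX s)]
  exact h.measure_inter_eq h𝒢 hX ht hD (hs hB)

/-- The Markov property at time `s` for functions of the whole trajectory after time `s`: if `h` is
the conditional expectation of such a function `Z` given `X s`, then it is also its conditional
expectation given the past `𝒢`.

For `A ∈ 𝒢`, let `a` be the conditional probability of `A` given `X s`; the Markov property says
that `1_A` and `a (X s)` have the same integrals over the events of the future, first over the
cylindrical ones, then over all of them. -/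
theorem IsCondFDD.setLIntegral_eq [IsFiniteMeasure μ] {X : ℝ≥0 → Ω → E}
    {s : ℝ≥0} {κ : KernelFamily E} (hκ : IsCondFDD μ X 𝒢 s κ)
    (h𝒢 : 𝒢 ≤ mΩ) (hX : ∀ t, Measurable (X t)) (hs : Measurable[𝒢] (X s))
    {Z : Ω → ℝ≥0∞} (hZ : Measurable[MeasurableSpace.comap (fun ω (r : Set.Ici s) => X r ω)
      inferInstance] Z) {h : E → ℝ≥0∞} (hh : Measurable h)
    (heq : ∀ B, MeasurableSet B →
      ∫⁻ ω in X s ⁻¹' B, Z ω ∂μ = ∫⁻ ω in X s ⁻¹' B, h (X s ω) ∂μ)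
    {A : Set Ω} (hA : MeasurableSet[𝒢] A) :
    ∫⁻ ω in A, Z ω ∂μ = ∫⁻ ω in A, h (X s ω) ∂μ := by
  classical
  set V : Ω → (Set.Ici s → E) := fun ω r => X r ω with hVdef
  have hV : Measurable V := measurable_pi_lambda _ fun r => hX r
  have hZm : Measurable Z := hZ.mono hV.comap_le le_rfl
  obtain ⟨G, hG, rfl⟩ := hZ.exists_eq_measurable_comp
  have hle : (μ.restrict A).map (X s) ≪ μ.map (X s) :=
    (Measure.absolutelyContinuous_of_le Measure.restrict_le_self).map (hX s)
  set a : E → ℝ≥0∞ := ((μ.restrict A).map (X s)).rnDeriv (μ.map (X s)) with hadef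
  have ha : Measurable a := Measure.measurable_rnDeriv _ _
  have haX : Measurable fun ω => a (X s ω) := ha.comp (hX s)
  have hawd : (μ.map (X s)).withDensity a = (μ.restrict A).map (X s) :=
    Measure.withDensity_rnDeriv_eq _ _ hle
  -- integrals over `A` of functions of `X s`
  have hA1 : ∀ b : E → ℝ≥0∞, Measurable b →
      ∫⁻ ω in A, b (X s ω) ∂μ = ∫⁻ ω, b (X s ω) * a (X s ω) ∂μ := fun b hb => by
    rw [← lintegral_map hb (hX s), ← hawd, lintegral_withDensity_eq_lintegral_mul _ ha hb,
      lintegral_map (ha.mul hb) (hX s)]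
    simp only [Pi.mul_apply, mul_comm]
  have hwdA : ∀ C, MeasurableSet C →
      (μ.withDensity fun ω => a (X s ω)) C = ∫⁻ ω in C, a (X s ω) ∂μ :=
    fun C hC => withDensity_apply _ hC
  -- the two measures on the future agree
  have hmeas : (μ.restrict A).map V = (μ.withDensity fun ω => a (X s ω)).map V := by
    refine ext_of_generate_finite _ generateFrom_squareCylinders.symm
      (isPiSystem_squareCylinders (fun _ => MeasurableSpace.isPiSystem_measurableSet)
        fun _ => MeasurableSet.univ) ?_ ?_
    · rintro _ ⟨I, S, hS, rfl⟩
      simp only [Set.mem_univ_pi, Set.mem_ofPred_eq] at hS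
      set J : Finset (Set.Ici s) := I.filter fun r => s < r
      set e := J.equivFin
      set τ : Fin J.card → ℝ≥0 := fun j => ((e.symm j : Set.Ici s) : ℝ≥0)
      have hτ : ∀ j, s < τ j := fun j => (Finset.mem_filter.1 (e.symm j).2).2
      set D : Set (Fin J.card → E) := Set.univ.pi fun j => S (e.symm j)
      have hD : MeasurableSet D := MeasurableSet.univ_pi fun j => hS _
      set s' : Set.Ici s := ⟨s, Set.mem_Ici.2 le_rfl⟩
      set B : Set E := if s' ∈ I then S s' else Set.univ with hBdef
      have hB : MeasurableSet B := by
        rw [hBdef]; split_ifs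
        exacts [hS _, MeasurableSet.univ]
      have hκm := (hκ J.card τ hτ).1
      have hpre : V ⁻¹' (I : Set (Set.Ici s)).pi S =
          X s ⁻¹' B ∩ (fun ω j => X (τ j) ω) ⁻¹' D := by
        ext ω
        simp only [Set.mem_preimage, Set.mem_pi, Set.mem_inter_iff, hVdef, D, Finset.mem_coe,
          Set.mem_univ, true_imp_iff]
        constructor
        · refine fun hω => ⟨?_, fun j => hω _ (Finset.mem_filter.1 (e.symm j).2).1⟩
          rw [hBdef]; split_ifs with hsI
          exacts [hω _ hsI, Set.mem_univ _]
        · rintro ⟨h1, h2⟩ r hr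
          rcases eq_or_lt_of_le (Set.mem_Ici.1 r.2) with hrs | hrs
          · have : r = s' := Subtype.ext hrs.symm
            subst this
            rwa [hBdef, if_pos hr] at h1
          · have h3 := h2 (e ⟨r, Finset.mem_filter.2 ⟨hr, hrs⟩⟩)
            have h4 : ((e.symm (e ⟨r, Finset.mem_filter.2 ⟨hr, hrs⟩⟩) : J) : Set.Ici s) = r := by
              rw [Equiv.symm_apply_apply]
            simp only [τ] at h3
            rwa [h4] at h3
      have hD' : MeasurableSet ((fun ω j => X (τ j) ω) ⁻¹' D) :=
        measurable_pi_lambda _ (fun j => hX (τ j)) hD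
      have hBD : MeasurableSet (X s ⁻¹' B ∩ (fun ω j => X (τ j) ω) ⁻¹' D) := (hX s hB).inter hD'
      have hm1 : MeasurableSet ((I : Set (Set.Ici s)).pi S) :=
        MeasurableSet.pi I.countable_toSet fun r _ => hS r
      have hκD : Measurable fun x => κ J.card τ x D := (κ J.card τ).measurable_coe hD
      rw [Measure.map_apply hV hm1, Measure.map_apply hV hm1, hpre, hwdA _ hBD,
        Measure.restrict_apply hBD]
      calc μ (X s ⁻¹' B ∩ (fun ω j => X (τ j) ω) ⁻¹' D ∩ A)
          = μ ((A ∩ X s ⁻¹' B) ∩ (fun ω j => X (τ j) ω) ⁻¹' D) := by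
            congr 1; ext ω; simp only [Set.mem_inter_iff]; tauto
        _ = ∫⁻ ω in A ∩ X s ⁻¹' B, κ J.card τ (X s ω) D ∂μ :=
            hκ.measure_inter_eq h𝒢 hX hτ hD (MeasurableSet.inter hA (hs hB))
        _ = ∫⁻ ω in A, B.indicator (fun x => κ J.card τ x D) (X s ω) ∂μ := by
            rw [Set.inter_comm, ← setLIntegral_indicator (hX s hB)]
            rfl
        _ = ∫⁻ ω, B.indicator (fun x => κ J.card τ x D) (X s ω) * a (X s ω) ∂μ :=
            hA1 _ (hκD.indicator hB)
        _ = ∫⁻ ω, κ J.card τ (X s ω) D * B.indicator a (X s ω) ∂μ := by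
            refine lintegral_congr fun ω => ?_
            by_cases hω : X s ω ∈ B <;> simp [hω]
        _ = ∫⁻ ω, ((fun ω j => X (τ j) ω) ⁻¹' D).indicator 1 ω * B.indicator a (X s ω) ∂μ := by
            refine (lintegral_mul_eq_of_forall_setLIntegral_eq h𝒢
              (measurable_one.indicator hD').aemeasurable (hκD.comp (hX s)).aemeasurable
              ((ha.indicator hB).comp hs) fun A' hA' => ?_).symm
            rw [lintegral_indicator_one hD', Measure.restrict_apply hD', Set.inter_comm]
            exact hκ.measure_inter_eq h𝒢 hX hτ hD hA'
        _ = ∫⁻ ω in X s ⁻¹' B ∩ (fun ω j => X (τ j) ω) ⁻¹' D, a (X s ω) ∂μ := by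
            rw [← lintegral_indicator hBD]
            refine lintegral_congr fun ω => ?_
            by_cases h1 : X s ω ∈ B <;> by_cases h2 : (fun j => X (τ j) ω) ∈ D <;>
              simp [Set.indicator, h1, h2]
    · rw [Measure.map_apply hV .univ, Measure.map_apply hV .univ]
      simpa using hA1 (fun _ => 1) measurable_const
  have hGa : ∫⁻ ω in A, G (V ω) ∂μ = ∫⁻ ω, G (V ω) * a (X s ω) ∂μ := by
    rw [← lintegral_map hG hV, hmeas, lintegral_map hG hV,
      lintegral_withDensity_eq_lintegral_mul (g := fun ω => G (V ω)) _ haX (hG.comp hV)]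
    simp only [Pi.mul_apply, mul_comm]
  simp only [Function.comp_apply] at heq ⊢
  rw [hGa, hA1 h hh]
  have hcm : MeasurableSpace.comap (X s) inferInstance ≤ mΩ := (hX s).comap_le
  refine lintegral_mul_eq_of_forall_setLIntegral_eq hcm (hG.comp hV).aemeasurable
    (hh.comp (hX s)).aemeasurable (ha.comp (comap_measurable _)) ?_
  rintro _ ⟨B, hB, rfl⟩
  exact heq B hB

end Conditioning

/-! ### The σ-algebras of the past -/

theorem pastSigma_le {E Ω : Type*} [MeasurableSpace E] [mΩ : MeasurableSpace Ω] {X : ℝ≥0 → Ω → E}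
    (hX : ∀ t, Measurable (X t)) (s : ℝ≥0) : pastSigma X s ≤ mΩ :=
  iSup₂_le fun r _ => (hX r).comap_le

theorem pastSigma_mono {E Ω : Type*} [MeasurableSpace E] (X : ℝ≥0 → Ω → E) {s t : ℝ≥0}
    (h : s ≤ t) : pastSigma X s ≤ pastSigma X t :=
  iSup₂_le fun r hr => le_iSup₂_of_le r (hr.trans h) le_rfl

theorem windowSigma_le_pastSigma {E Ω : Type*} [MeasurableSpace E] (X : ℝ≥0 → Ω → E) (s t : ℝ≥0) :
    windowSigma X s t ≤ pastSigma X t :=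
  iSup₂_le fun r hr => le_iSup₂_of_le r hr.2 le_rfl

theorem measurable_pastSigma {E Ω : Type*} [MeasurableSpace E] (X : ℝ≥0 → Ω → E) {r s : ℝ≥0}
    (h : r ≤ s) : Measurable[pastSigma X s] (X r) :=
  (comap_measurable (X r)).mono (le_iSup₂_of_le r h le_rfl) le_rfl

/-! ### Homogeneous Markov processes -/

namespace HomogeneousMarkovProcess

variable {E : Type*} [MeasurableSpace E] {Ω : Type*} [mΩ : MeasurableSpace Ω]
  (M : HomogeneousMarkovProcess E Ω)

theorem measurable_X (t : ℝ≥0) : Measurable (M.X t) := by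
  have h : MeasurableSpace.comap (M.X t) inferInstance ≤ mΩ :=
    (le_iSup (fun t => MeasurableSpace.comap (M.X t) inferInstance) t).trans M.generated.ge
  exact (comap_measurable _).mono h le_rfl

/-- The σ-algebra of the sample space is generated by the trajectory. -/
theorem le_comap_path : mΩ ≤ MeasurableSpace.comap (fun ω t => M.X t ω) inferInstance := by
  refine M.generated.le.trans (iSup_le fun t => ?_)
  have h : M.X t = (fun w : ℝ≥0 → E => w t) ∘ fun ω t => M.X t ω := rfl
  rw [h, ← MeasurableSpace.comap_comp]
  exact MeasurableSpace.comap_mono (measurable_pi_apply t).comap_le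

theorem measurable_θ (s : ℝ≥0) : Measurable (M.θ s) := by
  have h : Measurable[MeasurableSpace.comap (fun ω t => M.X t ω) inferInstance] id :=
    measurable_id.mono le_rfl M.le_comap_path
  rw [measurable_iff_comap_le]
  refine (MeasurableSpace.comap_mono M.le_comap_path).trans ?_
  rw [MeasurableSpace.comap_comp, ← measurable_iff_comap_le]
  refine measurable_pi_lambda _ fun t => ?_
  simp only [Function.comp_apply, M.shift]
  exact M.measurable_X _

theorem law_dirac (x : E) : M.law (Measure.dirac x) = M.P x :=
  Measure.dirac_bind M.P.measurable x

variable (ν : Measure E)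

/-- The Markov property under an arbitrary initial distribution. -/
theorem law_inter_preimage_θ {s : ℝ≥0} {A : Set Ω} (hA : MeasurableSet[pastSigma M.X s] A)
    {C : Set Ω} (hC : MeasurableSet C) :
    M.law ν (A ∩ M.θ s ⁻¹' C) = ∫⁻ ω in A, M.P (M.X s ω) C ∂(M.law ν) := by
  have hA' : MeasurableSet A := pastSigma_le M.measurable_X s _ hA
  have hC' : MeasurableSet (M.θ s ⁻¹' C) := M.measurable_θ s hC
  have hP : Measurable fun ω => M.P (M.X s ω) C := (M.P.measurable_coe hC).comp (M.measurable_X s)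
  rw [Measure.bind_apply (hA'.inter hC') M.P.aemeasurable, ← lintegral_indicator hA',
    Measure.lintegral_bind M.P.aemeasurable (hP.indicator hA').aemeasurable]
  refine lintegral_congr fun x => ?_
  rw [lintegral_indicator hA']
  exact measure_inter_eq_setLIntegral_of_condExp (pastSigma_le M.measurable_X s) hC' hP
    (fun ω => prob_le_one) (M.markov x s C hC) hA

theorem map_θ_restrict_law {s : ℝ≥0} {A : Set Ω} (hA : MeasurableSet[pastSigma M.X s] A) :
    ((M.law ν).restrict A).map (M.θ s) = M.law (((M.law ν).restrict A).map (M.X s)) := by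
  refine Measure.ext fun C hC => ?_
  rw [Measure.map_apply (M.measurable_θ s) hC, Measure.restrict_apply (M.measurable_θ s hC),
    Set.inter_comm, M.law_inter_preimage_θ ν hA hC, Measure.bind_apply hC M.P.aemeasurable,
    lintegral_map (M.P.measurable_coe hC) (M.measurable_X s)]

theorem map_θ_law (s : ℝ≥0) :
    (M.law ν).map (M.θ s) = M.law ((M.law ν).map (M.X s)) := by
  simpa using M.map_θ_restrict_law ν (s := s) MeasurableSet.univ

/-- The Markov property for functions of the trajectory, in integrated form. -/
theorem setLIntegral_comp_θ {s : ℝ≥0} {A : Set Ω} (hA : MeasurableSet[pastSigma M.X s] A)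
    {Φ : Ω → ℝ≥0∞} (hΦ : Measurable Φ) :
    ∫⁻ ω in A, Φ (M.θ s ω) ∂(M.law ν)
      = ∫⁻ ω in A, (∫⁻ ω', Φ ω' ∂(M.P (M.X s ω))) ∂(M.law ν) := by
  rw [← lintegral_map hΦ (M.measurable_θ s), M.map_θ_restrict_law ν hA,
    Measure.lintegral_bind M.P.aemeasurable hΦ.aemeasurable,
    lintegral_map hΦ.lintegral_kernel (M.measurable_X s)]

/-! ### W-functionals -/

namespace IsWFunctional

variable {M} {φ : ℝ≥0 → ℝ≥0 → Ω → ℝ≥0}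

theorem aemeasurable (hφ : M.IsWFunctional φ) [IsProbabilityMeasure ν] {s t : ℝ≥0} (hst : s ≤ t) :
    AEMeasurable (φ s t) (M.law ν) :=
  ((hφ.adapted ν s t hst).mono
    ((windowSigma_le_pastSigma M.X s t).trans (pastSigma_le M.measurable_X t))).aemeasurable

theorem aemeasurable_P (hφ : M.IsWFunctional φ) (x : E) (t : ℝ≥0) :
    AEMeasurable (φ 0 t) (M.P x) := by
  rw [← M.law_dirac x]
  exact hφ.aemeasurable _ zero_le

/-- Almost surely, the trajectories of a W-functional are increments of an increasing continuous
function. -/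
theorem ae_exists_increments (hφ : M.IsWFunctional φ) [IsProbabilityMeasure ν] :
    ∀ᵐ ω ∂(M.law ν), Monotone (fun t => φ 0 t ω) ∧ Continuous (fun t => φ 0 t ω) ∧
      ∀ s t, s ≤ t → φ 0 s ω + φ s t ω = φ 0 t ω := by
  filter_upwards [hφ.additive ν, hφ.continuous ν] with ω h1 h2
  refine ⟨fun s t hst => ?_, ?_, fun s t hst => h1 0 s t zero_le hst⟩
  · change φ 0 s ω ≤ φ 0 t ω
    rw [← h1 0 s t zero_le hst]
    exact le_self_add
  · have h3 := h2 0
    rwa [show Set.Ici (0 : ℝ≥0) = Set.univ from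
        Set.eq_univ_of_forall fun _ => Set.mem_Ici.2 zero_le,
      continuousOn_univ] at h3

theorem ae_continuous (hφ : M.IsWFunctional φ) [IsProbabilityMeasure ν] :
    ∀ᵐ ω ∂(M.law ν), Continuous fun p : TimePairs => φ p.1.1 p.1.2 ω := by
  filter_upwards [hφ.ae_exists_increments ν] with ω ⟨_, h1, h2⟩
  have h3 : (fun p : TimePairs => φ p.1.1 p.1.2 ω) =
      fun p : TimePairs => φ 0 p.1.2 ω - φ 0 p.1.1 ω := by
    funext p
    rw [← h2 p.1.1 p.1.2 p.2, add_tsub_cancel_left]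
  rw [h3]
  exact (h1.comp (by fun_prop)).sub (h1.comp (by fun_prop))

theorem ae_functionalPath (hφ : M.IsWFunctional φ) [IsProbabilityMeasure ν] :
    ∀ᵐ ω ∂(M.law ν), ∀ p : TimePairs, functionalPath φ ω p = φ p.1.1 p.1.2 ω := by
  filter_upwards [hφ.ae_continuous ν] with ω h p
  rw [functionalPath, dif_pos h]
  rfl

theorem aemeasurable_functionalPath (hφ : M.IsWFunctional φ) [IsProbabilityMeasure ν] :
    AEMeasurable (functionalPath φ) (M.law ν) :=
  aemeasurable_of_eval fun p => (hφ.aemeasurable ν p.2).congr <| by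
    filter_upwards [hφ.ae_functionalPath ν] with ω h using (h p).symm

/-- The supremum over the starting points of the expectation `E_x φ^{0,t}`. -/
noncomputable def supMean (M : HomogeneousMarkovProcess E Ω) (φ : ℝ≥0 → ℝ≥0 → Ω → ℝ≥0)
    (t : ℝ≥0) : ℝ≥0∞ :=
  ⨆ x : E, ∫⁻ ω, (φ 0 t ω : ℝ≥0∞) ∂(M.P x)

theorem supMean_mono (hφ : M.IsWFunctional φ) : Monotone (supMean M φ) := by
  refine fun s t hst => iSup_mono fun x => lintegral_mono_ae ?_
  have h := hφ.ae_exists_increments (Measure.dirac x)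
  rw [M.law_dirac x] at h
  filter_upwards [h] with ω hω
  exact ENNReal.coe_le_coe.2 (hω.1 hst)

theorem ofReal_characteristic (hφ : M.IsWFunctional φ) (s t : ℝ≥0) (x : E) :
    ENNReal.ofReal (M.characteristic φ s t x) = ∫⁻ ω, (φ 0 (t - s) ω : ℝ≥0∞) ∂(M.P x) := by
  have hm := (hφ.aemeasurable_P x (t - s)).coe_nnreal_ennreal
  have hlt : ∫⁻ ω, (φ 0 (t - s) ω : ℝ≥0∞) ∂(M.P x) < ∞ :=
    (le_iSup (fun x => ∫⁻ ω, (φ 0 (t - s) ω : ℝ≥0∞) ∂(M.P x)) x).trans_lt (hφ.bounded (t - s))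
  have h1 : M.characteristic φ s t x = (∫⁻ ω, (φ 0 (t - s) ω : ℝ≥0∞) ∂(M.P x)).toReal :=
    integral_toReal (f := fun ω => (φ 0 (t - s) ω : ℝ≥0∞)) hm (.of_forall fun _ => by simp)
  rw [h1, ENNReal.ofReal_toReal hlt.ne]

theorem ofReal_characteristic_le_supMean (hφ : M.IsWFunctional φ) (s t : ℝ≥0) (x : E) :
    ENNReal.ofReal (M.characteristic φ s t x) ≤ supMean M φ (t - s) := by
  rw [hφ.ofReal_characteristic]
  exact le_iSup (fun x => ∫⁻ ω, (φ 0 (t - s) ω : ℝ≥0∞) ∂(M.P x)) x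

/-- The characteristic is the conditional expectation of the functional given the past. -/
theorem setLIntegral_eq (hφ : M.IsWFunctional φ) [IsProbabilityMeasure ν] {s t : ℝ≥0} (hst : s ≤ t)
    {A : Set Ω} (hA : MeasurableSet[pastSigma M.X s] A) :
    ∫⁻ ω in A, (φ s t ω : ℝ≥0∞) ∂(M.law ν)
      = ∫⁻ ω in A, ENNReal.ofReal (M.characteristic φ s t (M.X s ω)) ∂(M.law ν) := by
  -- a measurable version of the functional for the process that starts from the law of `X s`
  have : IsProbabilityMeasure ((M.law ν).map (M.X s)) :=
    Measure.isProbabilityMeasure_map (M.measurable_X s).aemeasurable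
  obtain ⟨Φ, hΦ, hΦe⟩ := hφ.aemeasurable ((M.law ν).map (M.X s)) (zero_le (a := t - s))
  have h1 : ∀ᵐ ω ∂(M.law ν), φ s t ω = Φ (M.θ s ω) := by
    have h2 : ∀ᵐ ω ∂(M.law ν), φ 0 (t - s) (M.θ s ω) = Φ (M.θ s ω) := by
      rw [← M.map_θ_law ν s] at hΦe
      exact ae_of_ae_map (M.measurable_θ s).aemeasurable hΦe
    filter_upwards [h2, hφ.homogeneous ν 0 (t - s) s zero_le] with ω h3 h4
    rw [← h3, h4, zero_add, tsub_add_cancel_of_le hst]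
  have h2 : ∀ᵐ ω ∂(M.law ν), ∫⁻ ω', (Φ ω' : ℝ≥0∞) ∂(M.P (M.X s ω)) =
      ENNReal.ofReal (M.characteristic φ s t (M.X s ω)) := by
    have h3 := ae_of_ae_map (M.measurable_X s).aemeasurable
      (Measure.ae_ae_of_ae_bind M.P.aemeasurable hΦe)
    filter_upwards [h3] with ω h4
    rw [hφ.ofReal_characteristic]
    exact lintegral_congr_ae (h4.mono fun ω' h5 => by simp only [h5])
  rw [← setLIntegral_congr_fun_ae (pastSigma_le M.measurable_X s _ hA)
    (h2.mono fun ω h _ => h), ← M.setLIntegral_comp_θ ν hA hΦ.coe_nnreal_ennreal]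
  exact lintegral_congr_ae (ae_restrict_of_ae (h1.mono fun ω h => by simp only [h]))

/-- The bound of the mean of an increment, with a weight that depends on the past. -/
theorem lintegral_mul_le (hφ : M.IsWFunctional φ) [IsProbabilityMeasure ν] {s t : ℝ≥0}
    (hst : s ≤ t) {W : Ω → ℝ≥0∞} (hW : Measurable[pastSigma M.X s] W) :
    ∫⁻ ω, (φ s t ω : ℝ≥0∞) * W ω ∂(M.law ν) ≤ supMean M φ (t - s) * ∫⁻ ω, W ω ∂(M.law ν) := by
  have hp := pastSigma_le M.measurable_X s
  rw [← lintegral_const_mul _ (hW.mono hp le_rfl)]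
  refine lintegral_mul_le_of_forall_setLIntegral_le hp
    (hφ.aemeasurable ν hst).coe_nnreal_ennreal aemeasurable_const hW fun A hA => ?_
  rw [hφ.setLIntegral_eq ν hst hA]
  exact lintegral_mono fun ω => hφ.ofReal_characteristic_le_supMean s t _

theorem lintegral_le (hφ : M.IsWFunctional φ) [IsProbabilityMeasure ν] {s t : ℝ≥0} (hst : s ≤ t) :
    ∫⁻ ω, (φ s t ω : ℝ≥0∞) ∂(M.law ν) ≤ supMean M φ (t - s) := by
  simpa using hφ.lintegral_mul_le ν hst (W := fun _ => 1) measurable_const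

end IsWFunctional

end HomogeneousMarkovProcess

/-- The square of the total increment of a sequence, as its quadratic variation and twice a sum of
products of an increment with the remaining one. -/
theorem sum_range_mul_increments {N : ℕ} (g : ℕ → ℝ) :
    ∑ i ∈ Finset.range N, (g (i + 1) - g i) ^ 2
      + 2 * ∑ i ∈ Finset.range N, (g (i + 1) - g i) * (g N - g (i + 1)) = (g N - g 0) ^ 2 := by
  have h := Finset.sum_range_sub' (fun i => (g N - g i) ^ 2) N
  simp only [sub_self] at h
  rw [Finset.mul_sum, ← Finset.sum_add_distrib, ← sub_zero ((g N - g 0) ^ 2),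
    show (0 : ℝ) = 0 ^ 2 by norm_num, ← h]
  exact Finset.sum_congr rfl fun i _ => by ring

/-- The points of the partition of `[s, t]` into `N` equal intervals. -/
noncomputable def partitionPoint (s t : ℝ≥0) (N i : ℕ) : ℝ≥0 := s + (t - s) * (i / N)

theorem partitionPoint_zero (s t : ℝ≥0) (N : ℕ) : partitionPoint s t N 0 = s := by
  simp [partitionPoint]

theorem partitionPoint_self {s t : ℝ≥0} (hst : s ≤ t) {N : ℕ} (hN : 0 < N) :
    partitionPoint s t N N = t := by
  have h : (N : ℝ≥0) ≠ 0 := by exact_mod_cast hN.ne'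
  rw [partitionPoint, div_self h, mul_one, add_tsub_cancel_of_le hst]

theorem partitionPoint_mono (s t : ℝ≥0) (N : ℕ) : Monotone (partitionPoint s t N) := by
  intro i j hij
  have : (i : ℝ≥0) ≤ j := by exact_mod_cast hij
  unfold partitionPoint
  gcongr

theorem dist_partitionPoint_succ (s t : ℝ≥0) (N i : ℕ) :
    dist (partitionPoint s t N (i + 1)) (partitionPoint s t N i) = ((t - s : ℝ≥0) : ℝ) / N := by
  rw [NNReal.dist_eq, partitionPoint, partitionPoint]
  push_cast
  rw [show ((s : ℝ) + (t - s : ℝ≥0) * (((i : ℝ) + 1) / N) - (s + (t - s : ℝ≥0) * ((i : ℝ) / N)))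
    = (t - s : ℝ≥0) / N by ring]
  exact abs_of_nonneg (by positivity)

/-- Riemann–Stieltjes sums of a continuous increasing function `G` w.r.t. itself converge. -/
theorem tendsto_sum_increments {G : ℝ≥0 → ℝ} (hm : Monotone G) (hc : Continuous G) {s t : ℝ≥0}
    (hst : s ≤ t) :
    Tendsto (fun N : ℕ => 2 * ∑ i ∈ Finset.range N,
      (G (partitionPoint s t N (i + 1)) - G (partitionPoint s t N i)) *
        (G t - G (partitionPoint s t N (i + 1)))) atTop (𝓝 ((G t - G s) ^ 2)) := by
  have hu : UniformContinuousOn G (Set.Icc s t) :=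
    isCompact_Icc.uniformContinuousOn_of_continuous hc.continuousOn
  rw [Metric.tendsto_atTop]
  intro ε hε
  have hd : 0 ≤ G t - G s := sub_nonneg.2 (hm hst)
  set η := ε / (G t - G s + 1) with hη
  have hη0 : 0 < η := by positivity
  obtain ⟨δ, hδ, hδG⟩ := Metric.uniformContinuousOn_iff.1 hu η hη0
  obtain ⟨N₀, hN₀⟩ := exists_nat_gt (((t - s : ℝ≥0) : ℝ) / δ)
  refine ⟨N₀ + 1, fun N hN => ?_⟩
  have hNpos : 0 < N := by omega
  have hNR : (0 : ℝ) < N := by exact_mod_cast hNpos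
  have hstep : ((t - s : ℝ≥0) : ℝ) / N < δ := by
    rw [div_lt_iff₀ hNR]
    rw [div_lt_iff₀ hδ] at hN₀
    have : (N₀ : ℝ) ≤ N := by exact_mod_cast (by omega : N₀ ≤ N)
    nlinarith
  set g : ℕ → ℝ := fun i => G (partitionPoint s t N i) with hg
  have hg0 : g 0 = G s := by simp only [hg, partitionPoint_zero]
  have hgN : g N = G t := by simp only [hg, partitionPoint_self hst hNpos]
  have hgm : ∀ i, 0 ≤ g (i + 1) - g i := fun i =>
    sub_nonneg.2 (hm (partitionPoint_mono s t N (Nat.le_succ i)))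
  have hinc : ∀ i ∈ Finset.range N, (g (i + 1) - g i) ^ 2 ≤ η * (g (i + 1) - g i) := by
    intro i hi
    have hiN : i + 1 ≤ N := Finset.mem_range.1 hi
    have hmem : ∀ j ≤ N, partitionPoint s t N j ∈ Set.Icc s t := fun j hj =>
      ⟨(partitionPoint_zero s t N).symm.le.trans (partitionPoint_mono s t N (Nat.zero_le j)),
        (partitionPoint_mono s t N hj).trans (partitionPoint_self hst hNpos).le⟩
    have h1 := hδG _ (hmem (i + 1) hiN) _ (hmem i (by omega))
      (by rw [dist_partitionPoint_succ]; exact hstep)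
    rw [Real.dist_eq, abs_of_nonneg (hgm i)] at h1
    rw [sq]
    exact mul_le_mul_of_nonneg_right h1.le (hgm i)
  have hid := sum_range_mul_increments (N := N) g
  have hsum : ∑ i ∈ Finset.range N, (g (i + 1) - g i) ^ 2 ≤ η * (G t - G s) := by
    refine (Finset.sum_le_sum hinc).trans ?_
    rw [← Finset.mul_sum, Finset.sum_range_sub, hg0, hgN]
  have hsum0 : 0 ≤ ∑ i ∈ Finset.range N, (g (i + 1) - g i) ^ 2 :=
    Finset.sum_nonneg fun i _ => sq_nonneg _
  rw [hgN, hg0] at hid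
  have hlt : η * (G t - G s) < ε := by
    rw [hη, div_mul_eq_mul_div, div_lt_iff₀ (by positivity)]
    nlinarith
  rw [Real.dist_eq, abs_lt]
  constructor <;> linarith

namespace HomogeneousMarkovProcess.IsWFunctional

variable {E : Type*} [MeasurableSpace E] {Ω : Type*} [mΩ : MeasurableSpace Ω]
  {M : HomogeneousMarkovProcess E Ω} {φ : ℝ≥0 → ℝ≥0 → Ω → ℝ≥0}

/-- Khasminskii's bound for the second moment of a W-functional. The square `(φ^{s,t})²` is the
limit of the sums `2 ∑ φ^{tᵢ,tᵢ₊₁} φ^{tᵢ₊₁,t}` over partitions of `[s, t]`, in which the second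
factor can be replaced by its conditional expectation; Fatou's lemma does the rest. -/
theorem lintegral_sq_le (hφ : M.IsWFunctional φ) (ν : Measure E) [IsProbabilityMeasure ν]
    {s t : ℝ≥0} (hst : s ≤ t) :
    ∫⁻ ω, (φ s t ω : ℝ≥0∞) ^ 2 ∂(M.law ν)
      ≤ 2 * supMean M φ (t - s) * ∫⁻ ω, (φ s t ω : ℝ≥0∞) ∂(M.law ν) := by
  set τ : ℕ → ℕ → ℝ≥0 := partitionPoint s t with hτ
  have hτm : ∀ N i, τ N i ≤ τ N (i + 1) := fun N i => partitionPoint_mono s t N (Nat.le_succ i)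
  have hτs : ∀ N i, s ≤ τ N i := fun N i => le_self_add
  have hτt : ∀ N i, i < N → τ N (i + 1) ≤ t := fun N i hi =>
    (partitionPoint_mono s t N hi).trans (partitionPoint_self hst (by omega)).le
  set f : ℕ → Ω → ℝ≥0∞ := fun N ω => 2 * ∑ i ∈ Finset.range N,
    (φ (τ N (i + 1)) t ω : ℝ≥0∞) * φ (τ N i) (τ N (i + 1)) ω with hf
  have hmeas : ∀ N, ∀ i ∈ Finset.range N, AEMeasurable
      (fun ω => (φ (τ N (i + 1)) t ω : ℝ≥0∞) * φ (τ N i) (τ N (i + 1)) ω) (M.law ν) := fun N i hi =>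
    (hφ.aemeasurable ν (hτt N i (Finset.mem_range.1 hi))).coe_nnreal_ennreal.mul
      (hφ.aemeasurable ν (hτm N i)).coe_nnreal_ennreal
  have hfm : ∀ N, AEMeasurable (f N) (M.law ν) := fun N =>
    (Finset.aemeasurable_fun_sum _ (hmeas N)).const_mul 2
  have hlim : ∀ᵐ ω ∂(M.law ν), Tendsto (fun N => f N ω) atTop (𝓝 ((φ s t ω : ℝ≥0∞) ^ 2)) := by
    filter_upwards [hφ.ae_exists_increments ν] with ω ⟨h1, h2, h3⟩
    have hinc : ∀ a b, a ≤ b → (φ a b ω : ℝ) = φ 0 b ω - φ 0 a ω := fun a b hab => by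
      rw [← h3 a b hab]; push_cast; ring
    have h4 := tendsto_sum_increments (G := fun r => (φ 0 r ω : ℝ))
      (fun a b hab => NNReal.coe_le_coe.2 (h1 hab)) (NNReal.continuous_coe.comp h2) hst
    have h5 : Tendsto (fun N => 2 * ∑ i ∈ Finset.range N,
        φ (τ N (i + 1)) t ω * φ (τ N i) (τ N (i + 1)) ω) atTop (𝓝 (φ s t ω ^ 2)) := by
      rw [← NNReal.tendsto_coe]
      push_cast
      rw [hinc s t hst]
      refine h4.congr fun N => ?_
      congr 1
      refine Finset.sum_congr rfl fun i hi => ?_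
      rw [hinc _ _ (hτm N i), hinc _ _ (hτt N i (Finset.mem_range.1 hi)), mul_comm]
    have h6 := ENNReal.tendsto_coe.2 h5
    push_cast at h6
    exact h6
  have hbound : ∀ᶠ N : ℕ in atTop, ∫⁻ ω, f N ω ∂(M.law ν)
      ≤ 2 * supMean M φ (t - s) * ∫⁻ ω, (φ s t ω : ℝ≥0∞) ∂(M.law ν) := by
    filter_upwards [eventually_gt_atTop 0] with N hN
    have hsum : ∑ i ∈ Finset.range N, ∫⁻ ω, (φ (τ N i) (τ N (i + 1)) ω : ℝ≥0∞) ∂(M.law ν)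
        = ∫⁻ ω, (φ s t ω : ℝ≥0∞) ∂(M.law ν) := by
      rw [← lintegral_finsetSum' _
        fun i _ => (hφ.aemeasurable ν (hτm N i)).coe_nnreal_ennreal]
      refine lintegral_congr_ae ?_
      filter_upwards [hφ.ae_exists_increments ν] with ω ⟨h1, h2, h3⟩
      have hinc : ∀ a b, a ≤ b → (φ a b ω : ℝ) = φ 0 b ω - φ 0 a ω := fun a b hab => by
        rw [← h3 a b hab]; push_cast; ring
      rw [← ENNReal.ofNNReal_finsetSum, ENNReal.coe_inj, ← NNReal.coe_inj, NNReal.coe_sum,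
        Finset.sum_congr rfl fun i _ => hinc _ _ (hτm N i),
        Finset.sum_range_sub (fun i => (φ 0 (τ N i) ω : ℝ)), hinc s t hst, hτ,
        partitionPoint_zero, partitionPoint_self hst hN]
    rw [hf, lintegral_const_mul'' _ (Finset.aemeasurable_fun_sum _ (hmeas N)),
      lintegral_finsetSum' _ (hmeas N), mul_assoc, ← hsum]
    refine mul_le_mul_right ?_ 2
    rw [Finset.mul_sum]
    refine Finset.sum_le_sum fun i hi => ?_
    have hi' := hτt N i (Finset.mem_range.1 hi)
    obtain ⟨W, hWm, hW⟩ := hφ.adapted ν _ _ (hτm N i)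
    have hWm' : Measurable[pastSigma M.X (τ N (i + 1))] W :=
      hWm.measurable.mono (windowSigma_le_pastSigma M.X _ _) le_rfl
    have hWc : ∫⁻ ω, (φ (τ N i) (τ N (i + 1)) ω : ℝ≥0∞) ∂(M.law ν) =
        ∫⁻ ω, (W ω : ℝ≥0∞) ∂(M.law ν) :=
      lintegral_congr_ae (hW.mono fun ω h => by simp only [h])
    rw [hWc, lintegral_congr_ae (g := fun ω => (φ (τ N (i + 1)) t ω : ℝ≥0∞) * W ω)
      (hW.mono fun ω h => by simp only [h])]
    refine (hφ.lintegral_mul_le ν hi' (measurable_coe_nnreal_ennreal.comp hWm')).trans ?_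
    refine mul_le_mul_left ?_ _
    exact supMean_mono hφ (tsub_le_tsub_left (hτs N (i + 1)) t)
  calc ∫⁻ ω, (φ s t ω : ℝ≥0∞) ^ 2 ∂(M.law ν)
      = ∫⁻ ω, liminf (fun N => f N ω) atTop ∂(M.law ν) :=
        lintegral_congr_ae (hlim.mono fun ω h => h.liminf_eq.symm)
    _ ≤ liminf (fun N => ∫⁻ ω, f N ω ∂(M.law ν)) atTop := lintegral_liminf_le' hfm
    _ ≤ 2 * supMean M φ (t - s) * ∫⁻ ω, (φ s t ω : ℝ≥0∞) ∂(M.law ν) :=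
        liminf_le_of_frequently_le' hbound.frequently

end HomogeneousMarkovProcess.IsWFunctional

/-! ### Second moments of sums of weakly dependent increments -/

/-- The term `d M ^ 2` on the left makes the induction work: it absorbs the product of two
neighbouring terms. -/
theorem sq_sum_add_sq_le (d : ℕ → ℝ) (M : ℕ) :
    (∑ j ∈ Finset.range (M + 1), d j) ^ 2 + d M ^ 2 ≤ 3 * ∑ j ∈ Finset.range (M + 1), d j ^ 2
      + 2 * ∑ j ∈ Finset.range (M - 1), d j * ∑ l ∈ Finset.Ico (j + 2) (M + 1), d l := by
  induction M with
  | zero => simp; nlinarith [sq_nonneg (d 0)]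
  | succ M ih =>
    have h1 : ∑ j ∈ Finset.range (M + 1 - 1), d j * ∑ l ∈ Finset.Ico (j + 2) (M + 1 + 1), d l
        = ∑ j ∈ Finset.range (M - 1), d j * ∑ l ∈ Finset.Ico (j + 2) (M + 1), d l
          + (∑ j ∈ Finset.range M, d j) * d (M + 1) := by
      rw [Finset.sum_mul, Nat.add_sub_cancel]
      have h2 : ∀ j ∈ Finset.range M, d j * ∑ l ∈ Finset.Ico (j + 2) (M + 1 + 1), d l
          = d j * ∑ l ∈ Finset.Ico (j + 2) (M + 1), d l + d j * d (M + 1) := fun j hj => by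
        rw [Finset.sum_Ico_succ_top (by have := Finset.mem_range.1 hj; omega), mul_add]
      rw [Finset.sum_congr rfl h2, Finset.sum_add_distrib]
      congr 1
      cases M with
      | zero => simp
      | succ M =>
        rw [Finset.sum_range_succ, Nat.add_sub_cancel, Finset.Ico_self, Finset.sum_empty, mul_zero,
          add_zero]
    rw [h1, Finset.sum_range_succ d (M + 1), Finset.sum_range_succ (fun j => d j ^ 2) (M + 1)]
    rw [Finset.sum_range_succ d M] at ih ⊢
    nlinarith [sq_nonneg (d M - d (M + 1))]

/-- The square of a sum, in terms of its diagonal and of the products of each term with the part of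
the sum that begins two steps later. -/
theorem sq_sum_le (d : ℕ → ℝ) (M : ℕ) :
    (∑ j ∈ Finset.range M, d j) ^ 2 ≤ 3 * ∑ j ∈ Finset.range M, d j ^ 2
      + 2 * ∑ j ∈ Finset.range (M - 2), d j * ∑ l ∈ Finset.Ico (j + 2) M, d l := by
  cases M with
  | zero => simp
  | succ M =>
    have h := sq_sum_add_sq_le d M
    rw [show M + 1 - 2 = M - 1 by omega]
    nlinarith [sq_nonneg (d M)]

section SecondMoment

variable {Ω : Type*} [mΩ : MeasurableSpace Ω] {μ : Measure Ω}

/-- The second moment of a sum of terms `D_j`, each of them known at the time `j + 2`, if the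
conditional means of the remainders are bounded by `g`. -/
theorem integral_sq_sum_le [IsProbabilityMeasure μ] {𝓕 : ℕ → MeasurableSpace Ω}
    (h𝓕 : ∀ j, 𝓕 j ≤ mΩ) (M : ℕ) {D : ℕ → Ω → ℝ} (hD : ∀ j < M, MemLp (D j) 2 μ)
    (hDm : ∀ j < M, AEStronglyMeasurable[𝓕 (j + 2)] (D j) μ) {g : Ω → ℝ}
    (hg : ∀ j < M, Integrable (fun ω => |D j ω| * g ω) μ)
    (hc : ∀ j, 2 ≤ j → j < M →
      ∀ᵐ ω ∂μ, |(μ[fun ω => ∑ l ∈ Finset.Ico j M, D l ω | 𝓕 j]) ω| ≤ g ω) (hg0 : ∀ ω, 0 ≤ g ω) :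
    ∫ ω, (∑ j ∈ Finset.range M, D j ω) ^ 2 ∂μ ≤
      3 * ∑ j ∈ Finset.range M, ∫ ω, D j ω ^ 2 ∂μ
        + 2 * ∑ j ∈ Finset.range M, ∫ ω, |D j ω| * g ω ∂μ := by
  have hR : ∀ j, MemLp (fun ω => ∑ l ∈ Finset.Ico j M, D l ω) 2 μ := fun j =>
    memLp_finsetSum _ fun l hl => hD l (Finset.mem_Ico.1 hl).2
  have hDR : ∀ j < M, Integrable (fun ω => D j ω * ∑ l ∈ Finset.Ico (j + 2) M, D l ω) μ :=
    fun j hj => (hD j hj).integrable_mul (hR (j + 2))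
  have hS : Integrable (fun ω => (∑ j ∈ Finset.range M, D j ω) ^ 2) μ :=
    (memLp_finsetSum _ fun l hl => hD l (Finset.mem_range.1 hl)).integrable_sq
  have hcross : ∀ j, j + 2 < M → ∫ ω, D j ω * ∑ l ∈ Finset.Ico (j + 2) M, D l ω ∂μ
      ≤ ∫ ω, |D j ω| * g ω ∂μ := by
    intro j hj
    have hj' : j < M := by omega
    have h1 : μ[fun ω => D j ω * ∑ l ∈ Finset.Ico (j + 2) M, D l ω | 𝓕 (j + 2)] =ᵐ[μ]
        D j * μ[fun ω => ∑ l ∈ Finset.Ico (j + 2) M, D l ω | 𝓕 (j + 2)] :=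
      condExp_mul_of_aestronglyMeasurable_left (hDm j hj') (hDR j hj')
        ((hR (j + 2)).integrable one_le_two)
    rw [← integral_condExp (h𝓕 (j + 2))]
    refine integral_mono_ae integrable_condExp (hg j hj') ?_
    filter_upwards [h1, hc (j + 2) (by omega) hj] with ω h2 h3
    rw [h2, Pi.mul_apply]
    refine (le_abs_self _).trans ?_
    rw [abs_mul]
    gcongr
  have hj2 : ∀ j ∈ Finset.range (M - 2), j + 2 < M := fun j hj => by
    have := Finset.mem_range.1 hj; omega
  have hint1 : ∀ j ∈ Finset.range M, Integrable (fun ω => D j ω ^ 2) μ := fun j hj =>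
    (hD j (Finset.mem_range.1 hj)).integrable_sq
  have hint2 : ∀ j ∈ Finset.range (M - 2),
      Integrable (fun ω => D j ω * ∑ l ∈ Finset.Ico (j + 2) M, D l ω) μ := fun j hj =>
    hDR j (by have := hj2 j hj; omega)
  calc ∫ ω, (∑ j ∈ Finset.range M, D j ω) ^ 2 ∂μ
      ≤ ∫ ω, (3 * ∑ j ∈ Finset.range M, D j ω ^ 2
        + 2 * ∑ j ∈ Finset.range (M - 2), D j ω * ∑ l ∈ Finset.Ico (j + 2) M, D l ω) ∂μ :=
        integral_mono hS (((integrable_finsetSum _ hint1).const_mul 3).add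
          ((integrable_finsetSum _ hint2).const_mul 2)) fun ω => sq_sum_le (fun j => D j ω) M
    _ = 3 * ∑ j ∈ Finset.range M, ∫ ω, D j ω ^ 2 ∂μ
        + 2 * ∑ j ∈ Finset.range (M - 2),
          ∫ ω, D j ω * ∑ l ∈ Finset.Ico (j + 2) M, D l ω ∂μ := by
        rw [integral_add ((integrable_finsetSum _ hint1).const_mul 3)
          ((integrable_finsetSum _ hint2).const_mul 2), integral_const_mul, integral_const_mul,
          integral_finsetSum _ hint1, integral_finsetSum _ hint2]
    _ ≤ _ := by
        gcongr
        refine (Finset.sum_le_sum fun j hj => hcross j (hj2 j hj)).trans ?_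
        refine Finset.sum_le_sum_of_subset_of_nonneg (Finset.range_mono (Nat.sub_le _ _))
          fun j _ _ => integral_nonneg fun ω => mul_nonneg (abs_nonneg _) (hg0 ω)

/-- The mean square distance between two increasing discrete-time additive functionals
`∑ A_j`, `∑ B_j` with small increments and with conditional means `c^A_j`, `c^B_j` of the remainders
that are close to each other outside of a set `bad` of small probability. -/
theorem integral_sq_sum_sub_le [IsProbabilityMeasure μ] {𝓕 : ℕ → MeasurableSpace Ω}
    (h𝓕 : ∀ j, 𝓕 j ≤ mΩ) (M : ℕ) {A B : ℕ → Ω → ℝ} {a b C η lam : ℝ}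
    (hC : 0 ≤ C) (hη : 0 ≤ η) (hlam : 0 < lam)
    (hA0 : ∀ j < M, ∀ ω, 0 ≤ A j ω) (hB0 : ∀ j < M, ∀ ω, 0 ≤ B j ω)
    (hAm : ∀ j < M, AEStronglyMeasurable[𝓕 (j + 2)] (A j) μ)
    (hBm : ∀ j < M, AEStronglyMeasurable[𝓕 (j + 2)] (B j) μ)
    (hAa : ∀ j < M, ∀ ω, A j ω ≤ a) (hB2 : ∀ j < M, MemLp (B j) 2 μ)
    (hBb : ∀ j < M, ∫ ω, B j ω ^ 2 ∂μ ≤ b * ∫ ω, B j ω ∂μ)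
    (hAC : ∑ j ∈ Finset.range M, ∫ ω, A j ω ∂μ ≤ C)
    (hBC : ∑ j ∈ Finset.range M, ∫ ω, B j ω ∂μ ≤ C) (ha : 0 ≤ a) (hb : 0 ≤ b)
    (hBC2 : ∫ ω, (∑ j ∈ Finset.range M, B j ω) ^ 2 ∂μ ≤ 2 * C ^ 2)
    {cA cB : ℕ → Ω → ℝ}
    (hcA : ∀ j, 2 ≤ j → j < M → μ[fun ω => ∑ l ∈ Finset.Ico j M, A l ω | 𝓕 j] =ᵐ[μ] cA j)
    (hcB : ∀ j, 2 ≤ j → j < M → μ[fun ω => ∑ l ∈ Finset.Ico j M, B l ω | 𝓕 j] =ᵐ[μ] cB j)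
    (hcAC : ∀ j, 2 ≤ j → j < M → ∀ ω, |cA j ω| ≤ C)
    {bad : Set Ω} (hbad : MeasurableSet bad) (hbadlam : μ.real bad ≤ lam ^ 2)
    (hcAB : ∀ j, 2 ≤ j → j < M → ∀ ω, |cA j ω - cB j ω| ≤ η + bad.indicator (fun _ => C) ω) :
    ∫ ω, (∑ j ∈ Finset.range M, A j ω - ∑ j ∈ Finset.range M, B j ω) ^ 2 ∂μ ≤
      3 * (a + b) * C + 4 * η * C + 2 * C * (lam * (6 * a * C + 8 * C ^ 2 + 1)) := by
  have hA2 : ∀ j < M, MemLp (A j) 2 μ := fun j hj =>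
    MemLp.of_bound ((hAm j hj).mono (h𝓕 _)) a (.of_forall fun ω => by
      rw [Real.norm_of_nonneg (hA0 j hj ω)]; exact hAa j hj ω)
  have hAi : ∀ j < M, Integrable (A j) μ := fun j hj => (hA2 j hj).integrable one_le_two
  have hBi : ∀ j < M, Integrable (B j) μ := fun j hj => (hB2 j hj).integrable one_le_two
  have hAsq : ∀ j < M, ∫ ω, A j ω ^ 2 ∂μ ≤ a * ∫ ω, A j ω ∂μ := fun j hj => by
    rw [← integral_const_mul]
    refine integral_mono (hA2 j hj).integrable_sq ((hAi j hj).const_mul a) fun ω => ?_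
    have h1 := hA0 j hj ω
    have h2 := hAa j hj ω
    change A j ω ^ 2 ≤ a * A j ω
    nlinarith
  have hsumA : ∑ j ∈ Finset.range M, ∫ ω, A j ω ^ 2 ∂μ ≤ a * C := by
    refine (Finset.sum_le_sum fun j hj => hAsq j (Finset.mem_range.1 hj)).trans ?_
    rw [← Finset.mul_sum]
    gcongr
  have hsumB : ∑ j ∈ Finset.range M, ∫ ω, B j ω ^ 2 ∂μ ≤ b * C := by
    refine (Finset.sum_le_sum fun j hj => hBb j (Finset.mem_range.1 hj)).trans ?_
    rw [← Finset.mul_sum]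
    gcongr
  -- the second moment of `∑ A_j`
  have hAA : ∫ ω, (∑ j ∈ Finset.range M, A j ω) ^ 2 ∂μ ≤ 3 * (a * C) + 2 * (C * C) := by
    have h1 := integral_sq_sum_le (μ := μ) h𝓕 M (g := fun _ => C) hA2 hAm
      (fun j hj => (hAi j hj).abs.mul_const C)
      (fun j hj hjM => by
        filter_upwards [hcA j hj hjM] with ω hω
        rw [hω]; exact hcAC j hj hjM ω) fun _ => hC
    refine h1.trans ?_
    have h2 : ∑ j ∈ Finset.range M, ∫ ω, |A j ω| * C ∂μ ≤ C * C := by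
      have h3 : ∀ j ∈ Finset.range M, ∫ ω, |A j ω| * C ∂μ = (∫ ω, A j ω ∂μ) * C := fun j hj => by
        rw [integral_mul_const]
        simp only [abs_of_nonneg (hA0 j (Finset.mem_range.1 hj) _)]
      rw [Finset.sum_congr rfl h3, ← Finset.sum_mul]
      gcongr
    linarith
  set Y : Ω → ℝ := fun ω => ∑ j ∈ Finset.range M, A j ω + ∑ j ∈ Finset.range M, B j ω with hY
  have hSA : MemLp (fun ω => ∑ j ∈ Finset.range M, A j ω) 2 μ :=
    memLp_finsetSum _ fun l hl => hA2 l (Finset.mem_range.1 hl)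
  have hSB : MemLp (fun ω => ∑ j ∈ Finset.range M, B j ω) 2 μ :=
    memLp_finsetSum _ fun l hl => hB2 l (Finset.mem_range.1 hl)
  have hY2 : MemLp Y 2 μ := hSA.add hSB
  have hYi : Integrable Y μ := hY2.integrable one_le_two
  have hYsq : ∫ ω, Y ω ^ 2 ∂μ ≤ 6 * a * C + 8 * C ^ 2 := by
    have h1 : ∫ ω, Y ω ^ 2 ∂μ ≤ ∫ ω, (2 * (∑ j ∈ Finset.range M, A j ω) ^ 2
        + 2 * (∑ j ∈ Finset.range M, B j ω) ^ 2) ∂μ :=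
      integral_mono hY2.integrable_sq ((hSA.integrable_sq.const_mul 2).add
        (hSB.integrable_sq.const_mul 2)) fun ω => by
        simp only [hY]
        nlinarith [sq_nonneg (∑ j ∈ Finset.range M, A j ω - ∑ j ∈ Finset.range M, B j ω)]
    rw [integral_add (hSA.integrable_sq.const_mul 2) (hSB.integrable_sq.const_mul 2),
      integral_const_mul, integral_const_mul] at h1
    nlinarith
  have hYm : ∫ ω, Y ω ∂μ ≤ 2 * C := by
    rw [hY, integral_add (hSA.integrable one_le_two) (hSB.integrable one_le_two),
      integral_finsetSum _ fun j hj => hAi j (Finset.mem_range.1 hj),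
      integral_finsetSum _ fun j hj => hBi j (Finset.mem_range.1 hj)]
    linarith
  -- the contribution of the exceptional event
  have hYbad : ∫ ω, bad.indicator Y ω ∂μ ≤ lam * (6 * a * C + 8 * C ^ 2 + 1) := by
    have h1 : ∫ ω, bad.indicator Y ω ∂μ
        ≤ ∫ ω, (lam * Y ω ^ 2 + bad.indicator (fun _ => lam⁻¹) ω) ∂μ := by
      refine integral_mono (hYi.indicator hbad) ((hY2.integrable_sq.const_mul lam).add
        ((integrable_const _).indicator hbad)) fun ω => ?_
      by_cases hω : ω ∈ bad
      · simp only [Set.indicator_of_mem hω]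
        have h2 : lam * lam⁻¹ = 1 := mul_inv_cancel₀ hlam.ne'
        have h3 : 0 < lam⁻¹ := inv_pos.2 hlam
        have h4 : 0 ≤ lam * (Y ω - lam⁻¹) ^ 2 := by positivity
        have h5 : lam * (Y ω - lam⁻¹) ^ 2 = lam * Y ω ^ 2 - 2 * (lam * lam⁻¹) * Y ω
            + (lam * lam⁻¹) * lam⁻¹ := by ring
        rw [h2] at h5
        by_cases hYω : 0 ≤ Y ω
        · nlinarith
        · nlinarith [mul_nonneg hlam.le (sq_nonneg (Y ω))]
      · simp only [Set.indicator_of_notMem hω]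
        positivity
    rw [integral_add (hY2.integrable_sq.const_mul lam) ((integrable_const _).indicator hbad),
      integral_const_mul, integral_indicator_const _ hbad, smul_eq_mul] at h1
    have h2 : μ.real bad * lam⁻¹ ≤ lam := by
      rw [← div_eq_mul_inv, div_le_iff₀ hlam, ← sq]
      exact hbadlam
    nlinarith
  have hD2 : ∀ j < M, MemLp (fun ω => A j ω - B j ω) 2 μ := fun j hj => (hA2 j hj).sub (hB2 j hj)
  have hgi : ∀ Z : Ω → ℝ, Integrable Z μ →
      Integrable (fun ω => Z ω * (η + bad.indicator (fun _ => C) ω)) μ := fun Z hZ => by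
    have h1 : (fun ω => Z ω * (η + bad.indicator (fun _ => C) ω)) =
        fun ω => Z ω * η + bad.indicator (fun ω => Z ω * C) ω := by
      funext ω
      by_cases hω : ω ∈ bad <;> simp [hω, mul_add]
    rw [h1]
    exact (hZ.mul_const η).add ((hZ.mul_const C).indicator hbad)
  have hg0 : ∀ ω, 0 ≤ η + bad.indicator (fun _ => C) ω := fun ω =>
    add_nonneg hη (Set.indicator_nonneg (fun _ _ => hC) _)
  have hmain := integral_sq_sum_le (μ := μ) h𝓕 M (D := fun j ω => A j ω - B j ω)
    (g := fun ω => η + bad.indicator (fun _ => C) ω) hD2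
    (fun j hj => (hAm j hj).sub (hBm j hj))
    (fun j hj => hgi _ ((hD2 j hj).integrable one_le_two).abs)
    (fun j hj hjM => by
      have h1 : μ[fun ω => ∑ l ∈ Finset.Ico j M, (A l ω - B l ω) | 𝓕 j] =ᵐ[μ]
          μ[fun ω => ∑ l ∈ Finset.Ico j M, A l ω | 𝓕 j]
            - μ[fun ω => ∑ l ∈ Finset.Ico j M, B l ω | 𝓕 j] := by
        simp only [Finset.sum_sub_distrib]
        exact condExp_sub (integrable_finsetSum _ fun l hl => hAi l (Finset.mem_Ico.1 hl).2)
          (integrable_finsetSum _ fun l hl => hBi l (Finset.mem_Ico.1 hl).2) _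
      filter_upwards [h1, hcA j hj hjM, hcB j hj hjM] with ω h2 h3 h4
      rw [h2, Pi.sub_apply, h3, h4]
      exact hcAB j hj hjM ω) hg0
  simp only [Finset.sum_sub_distrib] at hmain
  refine hmain.trans ?_
  have hdiag : ∑ j ∈ Finset.range M, ∫ ω, (A j ω - B j ω) ^ 2 ∂μ ≤ a * C + b * C := by
    refine le_trans ?_ (add_le_add hsumA hsumB)
    rw [← Finset.sum_add_distrib]
    refine Finset.sum_le_sum fun j hj => ?_
    have hj' := Finset.mem_range.1 hj
    rw [← integral_add (hA2 j hj').integrable_sq (hB2 j hj').integrable_sq]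
    refine integral_mono (hD2 j hj').integrable_sq
      ((hA2 j hj').integrable_sq.add (hB2 j hj').integrable_sq) fun ω => ?_
    have := mul_nonneg (hA0 j hj' ω) (hB0 j hj' ω)
    simp only
    nlinarith
  have hoff : ∑ j ∈ Finset.range M, ∫ ω, |A j ω - B j ω| * (η + bad.indicator (fun _ => C) ω) ∂μ
      ≤ η * (2 * C) + C * (lam * (6 * a * C + 8 * C ^ 2 + 1)) := by
    rw [← integral_finsetSum _ fun j hj =>
      hgi _ ((hD2 j (Finset.mem_range.1 hj)).integrable one_le_two).abs]
    have h1 : ∫ ω, ∑ j ∈ Finset.range M, |A j ω - B j ω| * (η + bad.indicator (fun _ => C) ω) ∂μ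
        ≤ ∫ ω, (η * Y ω + C * bad.indicator Y ω) ∂μ := by
      refine integral_mono (integrable_finsetSum _ fun j hj =>
        hgi _ ((hD2 j (Finset.mem_range.1 hj)).integrable one_le_two).abs)
        ((hYi.const_mul η).add ((hYi.indicator hbad).const_mul C)) fun ω => ?_
      simp only
      rw [← Finset.sum_mul]
      have h2 : ∑ j ∈ Finset.range M, |A j ω - B j ω| ≤ Y ω := by
        simp only [hY]
        rw [← Finset.sum_add_distrib]
        refine Finset.sum_le_sum fun j hj => ?_
        have h3 := hA0 j (Finset.mem_range.1 hj) ω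
        have h4 := hB0 j (Finset.mem_range.1 hj) ω
        rw [abs_le]; constructor <;> linarith
      refine (mul_le_mul_of_nonneg_right h2 (hg0 ω)).trans_eq ?_
      by_cases hω : ω ∈ bad
      · simp only [Set.indicator_of_mem hω]; ring
      · simp only [Set.indicator_of_notMem hω]; ring
    rw [integral_add (hYi.const_mul η) ((hYi.indicator hbad).const_mul C), integral_const_mul,
      integral_const_mul] at h1
    refine h1.trans ?_
    gcongr
  linarith

end SecondMoment

/-! ### Additive functionals of a chain and their characteristics -/

theorem setLIntegral_comp_eq_of_identDistrib {α β γ : Type*} [MeasurableSpace α]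
    [MeasurableSpace β] [MeasurableSpace γ] {f : α → γ} {g : β → γ} {μ : Measure α} {ν : Measure β}
    (h : IdentDistrib f g μ ν) (hf : Measurable f) (hg : Measurable g) {G : γ → ℝ≥0∞}
    (hG : Measurable G) {S : Set γ} (hS : MeasurableSet S) :
    ∫⁻ x in f ⁻¹' S, G (f x) ∂μ = ∫⁻ x in g ⁻¹' S, G (g x) ∂ν := by
  rw [← setLIntegral_map hS hG hf, h.map_eq, setLIntegral_map hS hG hg]

/-- The conditional expectation of a nonnegative function, from its integrals over the sets of the
σ-algebra. -/
theorem condExp_ae_eq_of_forall_setLIntegral_eq {Ω : Type*} {m : MeasurableSpace Ω}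
    [mΩ : MeasurableSpace Ω] {μ : Measure Ω} [IsFiniteMeasure μ] (hm : m ≤ mΩ) {Z : Ω → ℝ≥0}
    (hZ : Integrable (fun ω => (Z ω : ℝ)) μ) {c : Ω → ℝ} (hc : Measurable[m] c)
    {C : ℝ} (hc0 : ∀ ω, 0 ≤ c ω) (hcC : ∀ ω, c ω ≤ C)
    (h : ∀ A, MeasurableSet[m] A →
      ∫⁻ ω in A, (Z ω : ℝ≥0∞) ∂μ = ∫⁻ ω in A, ENNReal.ofReal (c ω) ∂μ) :
    μ[fun ω => (Z ω : ℝ) | m] =ᵐ[μ] c := by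
  have hci : Integrable c μ := Integrable.of_bound (hc.mono hm le_rfl).aestronglyMeasurable C
    (.of_forall fun ω => by rw [Real.norm_of_nonneg (hc0 ω)]; exact hcC ω)
  refine (ae_eq_condExp_of_forall_setIntegral_eq hm hZ (fun A _ _ => hci.integrableOn)
    (fun A hA _ => ?_) (hc.stronglyMeasurable.aestronglyMeasurable)).symm
  rw [integral_eq_lintegral_of_nonneg_ae (.of_forall hc0) hci.integrableOn.aestronglyMeasurable,
    integral_eq_lintegral_of_nonneg_ae (f := fun ω => (Z ω : ℝ)) (.of_forall fun ω => (Z ω).2)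
      hZ.integrableOn.aestronglyMeasurable, ← h A hA]
  simp only [ENNReal.ofReal_coe_nnreal]

section Chain

variable {E : Type*} {L : ℕ}

theorem windowSum_add (F : (Fin L → E) → ℝ≥0) (y : ℕ → E) {a b c : ℕ} (hab : a ≤ b) (hbc : b ≤ c) :
    windowSum F y a b + windowSum F y b c = windowSum F y a c :=
  Finset.sum_Ico_consecutive _ hab hbc

theorem windowSum_le {F : (Fin L → E) → ℝ≥0} {δ : ℝ≥0} (hF : ∀ x, F x ≤ δ) (y : ℕ → E) (a b : ℕ) :
    windowSum F y a b ≤ (b - a : ℕ) * δ := by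
  refine (Finset.sum_le_card_nsmul _ _ δ fun k _ => hF _).trans_eq ?_
  rw [Nat.card_Ico, nsmul_eq_mul]

theorem sum_windowSum_blocks (F : (Fin L → E) → ℝ≥0) (y : ℕ → E) (K : ℕ) {j M : ℕ} (h : j ≤ M) :
    ∑ l ∈ Finset.Ico j M, windowSum F y (l * K) ((l + 1) * K) = windowSum F y (j * K) (M * K) := by
  induction M, h using Nat.le_induction with
  | base => simp [windowSum]
  | succ M hM ih =>
    rw [Finset.sum_Ico_succ_top hM, ih, windowSum_add F y (Nat.mul_le_mul_right K hM)
      (Nat.mul_le_mul_right K (Nat.le_succ M))]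

theorem windowSum_congr (F : (Fin L → E) → ℝ≥0) {y y' : ℕ → E} {a b : ℕ}
    (h : ∀ k, a ≤ k → k + 1 < b + L → y k = y' k) : windowSum F y a b = windowSum F y' a b := by
  refine Finset.sum_congr rfl fun k hk => ?_
  have hk' := Finset.mem_Ico.1 hk
  congr 1
  funext l
  have hl := l.2
  exact h _ (by omega) (by omega)

theorem windowSum_glue (F : (Fin L → E) → ℝ≥0) (y : ℕ → E) (i b : ℕ) :
    windowSum F (glue i (y i) fun j : Fin (b + L - 2 - i) => y (i + j + 1)) i b
      = windowSum F y i b := by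
  refine windowSum_congr F fun k hk hkb => ?_
  unfold glue
  split_ifs with h
  · exact congrArg y (by change i + (k - i - 1) + 1 = k; omega)
  · exact congrArg y (by omega)

variable [MeasurableSpace E]

theorem measurable_windowSum {Ω : Type*} [MeasurableSpace Ω] {F : (Fin L → E) → ℝ≥0}
    (hF : Measurable F) {Y : ℕ → Ω → E} {a b : ℕ}
    (hY : ∀ k, a ≤ k → k + 1 < b + L → Measurable (Y k)) :
    Measurable fun ω => windowSum F (fun k => Y k ω) a b := by
  refine Finset.measurable_sum _ fun k hk => hF.comp (measurable_pi_lambda _ fun l => ?_)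
  have hk' := Finset.mem_Ico.1 hk
  have hl := l.2
  exact hY _ (by omega) (by omega)

theorem measurable_windowSum_glue {F : (Fin L → E) → ℝ≥0} (hF : Measurable F) (i b m : ℕ) :
    Measurable fun p : E × (Fin m → E) => windowSum F (glue i p.1 p.2) i b := by
  refine measurable_windowSum (Y := fun k (p : E × (Fin m → E)) => glue i p.1 p.2 k) hF
    fun k _ _ => ?_
  unfold glue
  split_ifs with h
  · fun_prop
  · exact measurable_fst

theorem ceil_mul_div {n : ℕ} (hn : 0 < n) (b : ℕ) : ⌈(n : ℝ≥0) * ((b : ℝ≥0) / n)⌉₊ = b := by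
  have hn' : (n : ℝ≥0) ≠ 0 := by exact_mod_cast hn.ne'
  rw [mul_div_cancel₀ _ hn', Nat.ceil_natCast]

variable {n : ℕ} {F : (Fin L → E) → ℝ≥0} {δ : ℝ≥0} {i b : ℕ} {κ : KernelFamily E}

theorem chainCharacteristic_grid (hn : 0 < n) (x : E) :
    chainCharacteristic n F i κ ((b : ℝ≥0) / n) x =
      ∫ z, (windowSum F (glue i x z) i b : ℝ)
        ∂(κ (b + L - 2 - i) (fun j => ((i + j + 1 : ℕ) : ℝ≥0) / n) x) := by
  unfold chainCharacteristic numSteps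
  rw [ceil_mul_div hn]

theorem ofReal_chainCharacteristic (hn : 0 < n) (hF : Measurable F) (hFδ : ∀ x, F x ≤ δ)
    (hκ : IsMarkovKernel (κ (b + L - 2 - i) fun j => ((i + j + 1 : ℕ) : ℝ≥0) / n)) (x : E) :
    ENNReal.ofReal (chainCharacteristic n F i κ ((b : ℝ≥0) / n) x) =
      ∫⁻ z, (windowSum F (glue i x z) i b : ℝ≥0∞)
        ∂(κ (b + L - 2 - i) (fun j => ((i + j + 1 : ℕ) : ℝ≥0) / n) x) := by
  have hm : Measurable fun z : Fin (b + L - 2 - i) → E => windowSum F (glue i x z) i b :=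
    (measurable_windowSum_glue hF i b _).comp measurable_prodMk_left
  rw [chainCharacteristic_grid hn, ofReal_integral_eq_lintegral_ofReal]
  · simp only [ENNReal.ofReal_coe_nnreal]
  · refine Integrable.of_bound hm.coe_nnreal_real.aestronglyMeasurable ((b - i : ℕ) * δ : ℝ≥0)
      (.of_forall fun z => ?_)
    rw [Real.norm_of_nonneg (NNReal.coe_nonneg _)]
    exact_mod_cast windowSum_le hFδ _ i b
  · exact .of_forall fun z => NNReal.coe_nonneg _

theorem measurable_chainCharacteristic (hn : 0 < n) (hF : Measurable F)
    (hκ : IsMarkovKernel (κ (b + L - 2 - i) fun j => ((i + j + 1 : ℕ) : ℝ≥0) / n)) :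
    Measurable fun x => chainCharacteristic n F i κ ((b : ℝ≥0) / n) x := by
  simp only [chainCharacteristic_grid hn]
  have h := (measurable_windowSum_glue hF i b (b + L - 2 - i)).coe_nnreal_real.stronglyMeasurable
  exact (h.integral_kernel_prod_right' (κ := κ (b + L - 2 - i) _)).measurable

theorem chainCharacteristic_nonneg (hn : 0 < n) (x : E) :
    0 ≤ chainCharacteristic n F i κ ((b : ℝ≥0) / n) x := by
  rw [chainCharacteristic_grid hn]
  exact integral_nonneg fun z => NNReal.coe_nonneg _

theorem chainCharacteristic_le (hn : 0 < n) (hF : Measurable F) (hFδ : ∀ x, F x ≤ δ)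
    (hκ : IsMarkovKernel (κ (b + L - 2 - i) fun j => ((i + j + 1 : ℕ) : ℝ≥0) / n)) (x : E) :
    chainCharacteristic n F i κ ((b : ℝ≥0) / n) x ≤ (b - i : ℕ) * δ := by
  have h : ENNReal.ofReal (chainCharacteristic n F i κ ((b : ℝ≥0) / n) x) ≤
      ENNReal.ofReal ((b - i : ℕ) * δ) := by
    rw [ofReal_chainCharacteristic hn hF hFδ hκ]
    refine (lintegral_mono fun z => ENNReal.coe_le_coe.2 (windowSum_le hFδ _ i b)).trans ?_
    rw [lintegral_const, measure_univ, mul_one, ← ENNReal.ofReal_coe_nnreal]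
    simp
  exact (ENNReal.ofReal_le_ofReal_iff (by positivity)).1 h

variable {Ω : Type*} [mΩ : MeasurableSpace Ω] {μ : Measure Ω} [IsFiniteMeasure μ]
  {X : ℝ≥0 → Ω → E}

theorem lt_grid (hn : 0 < n) (i : ℕ) {m : ℕ} (j : Fin m) :
    (i : ℝ≥0) / n < ((i + j + 1 : ℕ) : ℝ≥0) / n := by
  have h : (0 : ℝ≥0) < n := by exact_mod_cast hn
  rw [div_lt_div_iff_of_pos_right h]
  exact_mod_cast (by omega : i < i + j + 1)

/-- The characteristic of a chain is the conditional expectation given the state of the chain. -/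
theorem setLIntegral_windowSum_eq (hX : ∀ t, Measurable (X t)) (hn : 0 < n) (hF : Measurable F)
    (hFδ : ∀ x, F x ≤ δ)
    (hκ : IsCondFDD μ X (pastSigma X ((i : ℝ≥0) / n)) ((i : ℝ≥0) / n) κ)
    {B : Set E} (hB : MeasurableSet B) :
    ∫⁻ ω in X ((i : ℝ≥0) / n) ⁻¹' B, (windowSum F (fun k => X ((k : ℝ≥0) / n) ω) i b : ℝ≥0∞) ∂μ =
      ∫⁻ ω in X ((i : ℝ≥0) / n) ⁻¹' B,
        ENNReal.ofReal (chainCharacteristic n F i κ ((b : ℝ≥0) / n) (X ((i : ℝ≥0) / n) ω)) ∂μ := by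
  set τ : Fin (b + L - 2 - i) → ℝ≥0 := fun j => ((i + j + 1 : ℕ) : ℝ≥0) / n
  have hτ : ∀ j, (i : ℝ≥0) / n < τ j := lt_grid hn i
  have hκm : IsMarkovKernel (κ (b + L - 2 - i) τ) := (hκ _ τ hτ).1
  set s : ℝ≥0 := (i : ℝ≥0) / n
  have hV : Measurable fun ω => (X s ω, fun j => X (τ j) ω) :=
    (hX s).prodMk (measurable_pi_lambda _ fun j => hX (τ j))
  have hG := (measurable_windowSum_glue hF i b (b + L - 2 - i)).coe_nnreal_ennreal
  have hlaw := hκ.map_eq_compProd (pastSigma_le hX _) hX (measurable_pastSigma X le_rfl) hτ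
  have h1 : ∀ ω, (windowSum F (fun k => X ((k : ℝ≥0) / n) ω) i b : ℝ≥0∞) =
      windowSum F (glue i (X s ω) fun j => X (τ j) ω) i b := fun ω => by
    rw [← windowSum_glue F (fun k => X ((k : ℝ≥0) / n) ω) i b]
  simp only [h1]
  have h2 := setLIntegral_map (μ := μ) (hB.prod MeasurableSet.univ) hG hV
  have h3 : (fun ω => (X s ω, fun j => X (τ j) ω)) ⁻¹' (B ×ˢ Set.univ) = X s ⁻¹' B := by
    ext ω; simp
  rw [h3] at h2
  rw [← h2, hlaw, Measure.setLIntegral_compProd hG hB MeasurableSet.univ]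
  simp only [Measure.restrict_univ]
  rw [setLIntegral_map hB hG.lintegral_kernel_prod_right' (hX s)]
  exact lintegral_congr fun ω => (ofReal_chainCharacteristic hn hF hFδ hκm _).symm

/-- If a process `X'` has the same law as `X` and has the Markov property at the time `i/n` w.r.t. a
larger filtration, then the characteristic of `X` is the conditional expectation of the functional
of `X'` given this filtration. -/
theorem setLIntegral_windowSum_eq_of_identDistrib {Ω' : Type*} [mΩ' : MeasurableSpace Ω']
    {P : Measure Ω'} [IsFiniteMeasure P] {X' : ℝ≥0 → Ω' → E}
    (hX : ∀ t, Measurable (X t)) (hX' : ∀ t, Measurable (X' t)) (hn : 0 < n) (hF : Measurable F)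
    (hFδ : ∀ x, F x ≤ δ)
    (hκ : IsCondFDD μ X (pastSigma X ((i : ℝ≥0) / n)) ((i : ℝ≥0) / n) κ)
    (hlaw : IdentDistrib (fun ω t => X' t ω) (fun ω t => X t ω) P μ)
    {𝒢 : ℝ≥0 → MeasurableSpace Ω'} (h𝒢 : ∀ t, 𝒢 t ≤ mΩ')
    (hM : HasMarkovPropertyAt P X' 𝒢 ((i : ℝ≥0) / n))
    {A : Set Ω'} (hA : MeasurableSet[𝒢 ((i : ℝ≥0) / n)] A) :
    ∫⁻ ω in A, (windowSum F (fun k => X' ((k : ℝ≥0) / n) ω) i b : ℝ≥0∞) ∂P =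
      ∫⁻ ω in A, ENNReal.ofReal
        (chainCharacteristic n F i κ ((b : ℝ≥0) / n) (X' ((i : ℝ≥0) / n) ω)) ∂P := by
  obtain ⟨hadapt, κ', hκ'⟩ := hM
  have hκm := (hκ (b + L - 2 - i) _ (lt_grid hn i)).1
  have hcm := (measurable_chainCharacteristic (b := b) hn hF hκm).ennreal_ofReal
  refine hκ'.setLIntegral_eq (h𝒢 _) hX' (hadapt _)
    (h := fun x => ENNReal.ofReal (chainCharacteristic n F i κ ((b : ℝ≥0) / n) x)) ?_ hcm
    (fun B hB => ?_) hA
  · have h : Measurable fun w : Set.Ici ((i : ℝ≥0) / n) → E =>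
        windowSum F (fun k => if h : (i : ℝ≥0) / n ≤ (k : ℝ≥0) / n then w ⟨_, h⟩
          else w ⟨_, Set.mem_Ici.2 le_rfl⟩) i b := by
      refine measurable_windowSum (Y := fun k (w : Set.Ici ((i : ℝ≥0) / n) → E) =>
        if h : (i : ℝ≥0) / n ≤ (k : ℝ≥0) / n then w ⟨_, h⟩
          else w ⟨_, Set.mem_Ici.2 le_rfl⟩) hF fun k _ _ => ?_
      split_ifs
      · exact measurable_pi_apply _
      · exact measurable_pi_apply _
    have h2 := (h.coe_nnreal_ennreal).comp
      (comap_measurable fun ω (r : Set.Ici ((i : ℝ≥0) / n)) => X' r ω)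
    convert h2 using 2 with ω
    simp only [Function.comp_apply]
    congr 1
    refine windowSum_congr F fun k hk _ => ?_
    rw [dif_pos]
    gcongr
  · have hp : Measurable fun (w : ℝ≥0 → E) =>
        (windowSum F (fun k => w ((k : ℝ≥0) / n)) i b : ℝ≥0∞) :=
      (measurable_windowSum (Y := fun k (w : ℝ≥0 → E) => w ((k : ℝ≥0) / n)) hF
        fun k _ _ => measurable_pi_apply _).coe_nnreal_ennreal
    have hS : MeasurableSet ((fun w : ℝ≥0 → E => w ((i : ℝ≥0) / n)) ⁻¹' B) :=
      measurable_pi_apply _ hB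
    have h1 := setLIntegral_comp_eq_of_identDistrib hlaw (measurable_pi_lambda _ hX')
      (measurable_pi_lambda _ hX) hp hS
    have h2 := setLIntegral_comp_eq_of_identDistrib hlaw (measurable_pi_lambda _ hX')
      (measurable_pi_lambda _ hX) (hcm.comp (measurable_pi_apply ((i : ℝ≥0) / n))) hS
    exact h1.trans ((setLIntegral_windowSum_eq hX hn hF hFδ hκ hB).trans h2.symm)

end Chain

/-! ### The W-functional on another probability space -/

/-- The element `(s, t)` of `𝕋`. -/
abbrev timePair {s t : ℝ≥0} (h : s ≤ t) : TimePairs := ⟨(s, t), h⟩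

theorem HomogeneousMarkovProcess.measurable_path {E Ω : Type*} [MeasurableSpace E]
    [MeasurableSpace Ω] (M : HomogeneousMarkovProcess E Ω) : Measurable fun ω t => M.X t ω :=
  measurable_pi_lambda _ M.measurable_X

theorem comap_path_windowSigma {E Ω : Type*} [MeasurableSpace E] (X : ℝ≥0 → Ω → E) (s t : ℝ≥0) :
    MeasurableSpace.comap (fun ω r => X r ω) (windowSigma (fun r (w : ℝ≥0 → E) => w r) s t)
      = windowSigma X s t := by
  simp only [windowSigma, MeasurableSpace.comap_iSup, MeasurableSpace.comap_comp]
  rfl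

namespace HomogeneousMarkovProcess.IsWFunctional

variable {E : Type*} [MeasurableSpace E] {Ω : Type*} [mΩ : MeasurableSpace Ω]
  {M : HomogeneousMarkovProcess E Ω} {φ : ℝ≥0 → ℝ≥0 → Ω → ℝ≥0}

/-- A W-functional is, almost surely, a measurable function of the trajectory, so it can be carried
over to any process with the same law. -/
theorem exists_pathFunctional (hφ : M.IsWFunctional φ) (ν : Measure E) [IsProbabilityMeasure ν] :
    ∃ Φ : (ℝ≥0 → E) → C(TimePairs, ℝ≥0), Measurable Φ ∧
      functionalPath φ =ᵐ[M.law ν] fun ω => Φ fun t => M.X t ω := by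
  obtain ⟨Ψ, hΨ, he⟩ := hφ.aemeasurable_functionalPath ν
  have h1 : Measurable[MeasurableSpace.comap (fun ω t => M.X t ω) inferInstance] Ψ :=
    hΨ.mono M.le_comap_path le_rfl
  obtain ⟨Φ, hΦ, rfl⟩ := h1.exists_eq_measurable_comp
  exact ⟨Φ, hΦ, he⟩

/-- The value `φ^{s,t}` depends on the trajectory between `s` and `t` only. -/
theorem exists_windowFunction (hφ : M.IsWFunctional φ) (ν : Measure E) [IsProbabilityMeasure ν]
    {s t : ℝ≥0} (hst : s ≤ t) :
    ∃ G : (ℝ≥0 → E) → ℝ≥0, Measurable[windowSigma (fun r (w : ℝ≥0 → E) => w r) s t] G ∧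
      ∀ᵐ ω ∂(M.law ν), φ s t ω = G fun r => M.X r ω := by
  obtain ⟨g, hg, he⟩ := hφ.adapted ν s t hst
  have h1 : Measurable[MeasurableSpace.comap (fun ω r => M.X r ω)
      (windowSigma (fun r (w : ℝ≥0 → E) => w r) s t)] g := by
    rw [comap_path_windowSigma]
    exact hg.measurable
  obtain ⟨G, hG, rfl⟩ := Measurable.exists_eq_measurable_comp
    (mY := windowSigma (fun r (w : ℝ≥0 → E) => w r) s t) h1
  exact ⟨G, hG, he⟩

theorem measurableSet_additive :
    MeasurableSet {c : C(TimePairs, ℝ≥0) | ∀ (s t : ℝ≥0) (h : s ≤ t),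
      c (timePair (zero_le (a := s))) + c (timePair h) = c (timePair (zero_le (a := t)))} := by
  refine IsClosed.measurableSet ?_
  simp only [Set.ofPred_forall]
  refine isClosed_iInter fun s => isClosed_iInter fun t => isClosed_iInter fun h => ?_
  exact isClosed_eq ((continuous_eval_const _).add
    (continuous_eval_const _)) (continuous_eval_const _)

variable {ν : Measure E} [IsProbabilityMeasure ν] {Φ : (ℝ≥0 → E) → C(TimePairs, ℝ≥0)}
  {Ω' : Type*} [mΩ' : MeasurableSpace Ω'] {P : Measure Ω'} {X' : ℝ≥0 → Ω' → E}

theorem ae_eval_eq (hφ : M.IsWFunctional φ)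
    (hΦφ : functionalPath φ =ᵐ[M.law ν] fun ω => Φ fun t => M.X t ω) {s t : ℝ≥0} (hst : s ≤ t) :
    ∀ᵐ ω ∂(M.law ν), Φ (fun t => M.X t ω) (timePair hst) = φ s t ω := by
  filter_upwards [hΦφ, hφ.ae_functionalPath ν] with ω h1 h2
  rw [← h1, h2]

theorem measurable_eval (hΦ : Measurable Φ) (p : TimePairs) : Measurable fun w => Φ w p :=
  (continuous_eval_const p).measurable.comp hΦ

theorem ae_additive_of_identDistrib (hφ : M.IsWFunctional φ) (hΦ : Measurable Φ)
    (hΦφ : functionalPath φ =ᵐ[M.law ν] fun ω => Φ fun t => M.X t ω)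
    (hlaw : IdentDistrib (fun ω t => X' t ω) (fun ω t => M.X t ω) P (M.law ν)) :
    ∀ᵐ ω ∂P, ∀ (s t : ℝ≥0) (h : s ≤ t),
      Φ (fun r => X' r ω) (timePair (zero_le (a := s))) + Φ (fun r => X' r ω) (timePair h)
        = Φ (fun r => X' r ω) (timePair (zero_le (a := t))) := by
  refine hlaw.symm.ae_snd (p := fun w => ∀ (s t : ℝ≥0) (h : s ≤ t),
      Φ w (timePair (zero_le (a := s))) + Φ w (timePair h)
        = Φ w (timePair (zero_le (a := t)))) (hΦ measurableSet_additive) ?_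
  filter_upwards [hΦφ, hφ.ae_functionalPath ν, hφ.additive ν] with ω h1 h2 h3 s t h
  rw [← h1, h2, h2, h2]
  exact h3 0 s t zero_le h

theorem exists_windowFunction_of_identDistrib (hφ : M.IsWFunctional φ) (hΦ : Measurable Φ)
    (hΦφ : functionalPath φ =ᵐ[M.law ν] fun ω => Φ fun t => M.X t ω)
    (hlaw : IdentDistrib (fun ω t => X' t ω) (fun ω t => M.X t ω) P (M.law ν))
    {s t : ℝ≥0} (hst : s ≤ t) :
    ∃ G : (ℝ≥0 → E) → ℝ≥0, Measurable[windowSigma (fun r (w : ℝ≥0 → E) => w r) s t] G ∧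
      ∀ᵐ ω ∂P, Φ (fun r => X' r ω) (timePair hst) = G fun r => X' r ω := by
  obtain ⟨G, hG, he⟩ := hφ.exists_windowFunction ν hst
  have hG' : Measurable G :=
    hG.mono (iSup₂_le fun r _ => (measurable_pi_apply r).comap_le) le_rfl
  refine ⟨G, hG, hlaw.symm.ae_snd (p := fun w => Φ w (timePair hst) = G w)
    (measurableSet_eq_fun (measurable_eval hΦ _) hG') ?_⟩
  filter_upwards [hφ.ae_eval_eq hΦφ hst, he] with ω h1 h2
  rw [h1, h2]

theorem aestronglyMeasurable_of_identDistrib (hφ : M.IsWFunctional φ) (hΦ : Measurable Φ)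
    (hΦφ : functionalPath φ =ᵐ[M.law ν] fun ω => Φ fun t => M.X t ω)
    (hlaw : IdentDistrib (fun ω t => X' t ω) (fun ω t => M.X t ω) P (M.law ν))
    {s t : ℝ≥0} (hst : s ≤ t) :
    AEStronglyMeasurable[pastSigma X' t]
      (fun ω => (Φ (fun r => X' r ω) (timePair hst) : ℝ)) P := by
  obtain ⟨G, hG, he⟩ := hφ.exists_windowFunction_of_identDistrib hΦ hΦφ hlaw hst
  have h1 : Measurable[windowSigma X' s t] fun ω => G fun r => X' r ω := by
    rw [← comap_path_windowSigma]
    exact hG.comp (comap_measurable _)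
  have h2 : Measurable[pastSigma X' t] fun ω => (G fun r => X' r ω : ℝ) :=
    measurable_coe_nnreal_real.comp (h1.mono (windowSigma_le_pastSigma X' s t) le_rfl)
  exact ⟨_, h2.stronglyMeasurable, he.mono fun ω h => by simp only [h]⟩

theorem lintegral_comp_of_identDistrib (hφ : M.IsWFunctional φ) (hΦ : Measurable Φ)
    (hΦφ : functionalPath φ =ᵐ[M.law ν] fun ω => Φ fun t => M.X t ω)
    (hX' : ∀ t, Measurable (X' t))
    (hlaw : IdentDistrib (fun ω t => X' t ω) (fun ω t => M.X t ω) P (M.law ν))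
    {s t : ℝ≥0} (hst : s ≤ t) {S : Set (ℝ≥0 → E)} (hS : MeasurableSet S)
    {u : ℝ≥0 → ℝ≥0∞} (hu : Measurable u) :
    ∫⁻ ω in (fun ω r => X' r ω) ⁻¹' S, u (Φ (fun r => X' r ω) (timePair hst)) ∂P =
      ∫⁻ ω in (fun ω r => M.X r ω) ⁻¹' S, u (φ s t ω) ∂(M.law ν) := by
  refine (setLIntegral_comp_eq_of_identDistrib hlaw (measurable_pi_lambda _ hX') M.measurable_path
    (hu.comp (measurable_eval hΦ (timePair hst))) hS).trans ?_
  refine lintegral_congr_ae (ae_restrict_of_ae ?_)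
  filter_upwards [hφ.ae_eval_eq hΦφ hst] with ω h
  simp only [Function.comp_apply, h]

theorem lintegral_le_of_identDistrib (hφ : M.IsWFunctional φ) (hΦ : Measurable Φ)
    (hΦφ : functionalPath φ =ᵐ[M.law ν] fun ω => Φ fun t => M.X t ω)
    (hX' : ∀ t, Measurable (X' t))
    (hlaw : IdentDistrib (fun ω t => X' t ω) (fun ω t => M.X t ω) P (M.law ν))
    {s t : ℝ≥0} (hst : s ≤ t) :
    ∫⁻ ω, (Φ (fun r => X' r ω) (timePair hst) : ℝ≥0∞) ∂P ≤ supMean M φ (t - s) := by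
  have h := hφ.lintegral_comp_of_identDistrib hΦ hΦφ hX' hlaw hst MeasurableSet.univ
    measurable_coe_nnreal_ennreal
  simp only [Set.preimage_univ, Measure.restrict_univ] at h
  rw [h]
  exact hφ.lintegral_le ν hst

theorem lintegral_sq_le_of_identDistrib (hφ : M.IsWFunctional φ) (hΦ : Measurable Φ)
    (hΦφ : functionalPath φ =ᵐ[M.law ν] fun ω => Φ fun t => M.X t ω)
    (hX' : ∀ t, Measurable (X' t))
    (hlaw : IdentDistrib (fun ω t => X' t ω) (fun ω t => M.X t ω) P (M.law ν))
    {s t : ℝ≥0} (hst : s ≤ t) :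
    ∫⁻ ω, (Φ (fun r => X' r ω) (timePair hst) : ℝ≥0∞) ^ 2 ∂P ≤
      2 * supMean M φ (t - s) * ∫⁻ ω, (Φ (fun r => X' r ω) (timePair hst) : ℝ≥0∞) ∂P := by
  have h1 := hφ.lintegral_comp_of_identDistrib hΦ hΦφ hX' hlaw hst MeasurableSet.univ
    measurable_coe_nnreal_ennreal
  have h2 := hφ.lintegral_comp_of_identDistrib hΦ hΦφ hX' hlaw hst MeasurableSet.univ
    (measurable_coe_nnreal_ennreal.pow_const 2)
  simp only [Set.preimage_univ, Measure.restrict_univ] at h1 h2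
  rw [h1, h2]
  exact hφ.lintegral_sq_le ν hst

/-- If a process `X'` has the same law as the limit process and has the Markov property at the time
`s` w.r.t. a larger filtration, then the characteristic is the conditional expectation of the
functional of `X'` given this filtration. -/
theorem setLIntegral_eq_of_identDistrib [IsFiniteMeasure P] (hφ : M.IsWFunctional φ)
    (hΦ : Measurable Φ)
    (hΦφ : functionalPath φ =ᵐ[M.law ν] fun ω => Φ fun t => M.X t ω)
    (hX' : ∀ t, Measurable (X' t))
    (hlaw : IdentDistrib (fun ω t => X' t ω) (fun ω t => M.X t ω) P (M.law ν))
    {s t : ℝ≥0} (hst : s ≤ t) (hchar : Measurable (M.characteristic φ s t))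
    {𝒢 : ℝ≥0 → MeasurableSpace Ω'} (h𝒢 : ∀ t, 𝒢 t ≤ mΩ')
    (hM : HasMarkovPropertyAt P X' 𝒢 s) {A : Set Ω'} (hA : MeasurableSet[𝒢 s] A) :
    ∫⁻ ω in A, (Φ (fun r => X' r ω) (timePair hst) : ℝ≥0∞) ∂P =
      ∫⁻ ω in A, ENNReal.ofReal (M.characteristic φ s t (X' s ω)) ∂P := by
  obtain ⟨hadapt, κ', hκ'⟩ := hM
  obtain ⟨G, hG, he⟩ := hφ.exists_windowFunction_of_identDistrib hΦ hΦφ hlaw hst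
  have hcm : Measurable fun x => ENNReal.ofReal (M.characteristic φ s t x) := hchar.ennreal_ofReal
  have he' : ∀ᵐ ω ∂P, (Φ (fun r => X' r ω) (timePair hst) : ℝ≥0∞) = G fun r => X' r ω :=
    he.mono fun ω h => by rw [h]
  rw [lintegral_congr_ae (ae_restrict_of_ae he')]
  have hwin : windowSigma X' s t ≤
      MeasurableSpace.comap (fun ω (r : Set.Ici s) => X' r ω) inferInstance := by
    refine iSup₂_le fun r hr => ?_
    have h : X' r = (fun w : Set.Ici s → E => w ⟨r, hr.1⟩) ∘ fun ω (r : Set.Ici s) => X' r ω := rfl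
    rw [h, ← MeasurableSpace.comap_comp]
    exact MeasurableSpace.comap_mono (measurable_pi_apply _).comap_le
  have h1 : Measurable[windowSigma X' s t] fun ω => (G fun r => X' r ω : ℝ≥0∞) := by
    rw [← comap_path_windowSigma]
    exact (measurable_coe_nnreal_ennreal.comp hG).comp (comap_measurable _)
  refine hκ'.setLIntegral_eq (h𝒢 _) hX' (hadapt _)
    (h := fun x => ENNReal.ofReal (M.characteristic φ s t x)) (h1.mono hwin le_rfl) hcm
    (fun B hB => ?_) hA
  rw [← lintegral_congr_ae (ae_restrict_of_ae he')]
  have hS : MeasurableSet ((fun w : ℝ≥0 → E => w s) ⁻¹' B) := measurable_pi_apply _ hB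
  have h2 := hφ.lintegral_comp_of_identDistrib hΦ hΦφ hX' hlaw hst hS measurable_coe_nnreal_ennreal
  have h3 := setLIntegral_comp_eq_of_identDistrib hlaw (measurable_pi_lambda _ hX')
    M.measurable_path (hcm.comp (measurable_pi_apply s)) hS
  exact h2.trans ((hφ.setLIntegral_eq ν hst (measurable_pastSigma M.X le_rfl hB)).trans h3.symm)

end HomogeneousMarkovProcess.IsWFunctional

/-! ### The mean square estimate for a coupling -/

section NNRealIntegrals

variable {Ω : Type*} [mΩ : MeasurableSpace Ω] {μ : Measure Ω} {Z : Ω → ℝ≥0}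

theorem integral_coe_eq_toReal (hZ : AEMeasurable Z μ) :
    ∫ ω, (Z ω : ℝ) ∂μ = (∫⁻ ω, (Z ω : ℝ≥0∞) ∂μ).toReal := by
  rw [integral_eq_lintegral_of_nonneg_ae (f := fun ω => (Z ω : ℝ)) (.of_forall fun ω => (Z ω).2)
    hZ.coe_nnreal_real.aestronglyMeasurable]
  simp only [ENNReal.ofReal_coe_nnreal]

theorem integral_coe_sq_eq_toReal (hZ : AEMeasurable Z μ) :
    ∫ ω, (Z ω : ℝ) ^ 2 ∂μ = (∫⁻ ω, (Z ω : ℝ≥0∞) ^ 2 ∂μ).toReal := by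
  have h := integral_coe_eq_toReal (hZ.pow_const 2)
  push_cast at h
  exact h

theorem integrable_coe (hZ : AEMeasurable Z μ) (h : ∫⁻ ω, (Z ω : ℝ≥0∞) ∂μ ≠ ∞) :
    Integrable (fun ω => (Z ω : ℝ)) μ := by
  have h1 := integrable_toReal_of_lintegral_ne_top hZ.coe_nnreal_ennreal h
  simpa using h1

theorem memLp_two_coe (hZ : AEMeasurable Z μ) (h : ∫⁻ ω, (Z ω : ℝ≥0∞) ^ 2 ∂μ ≠ ∞) :
    MemLp (fun ω => (Z ω : ℝ)) 2 μ := by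
  rw [memLp_two_iff_integrable_sq hZ.coe_nnreal_real.aestronglyMeasurable]
  have h1 := integrable_coe (hZ.pow_const 2) (by push_cast; exact h)
  push_cast at h1
  exact h1

end NNRealIntegrals

theorem pastSigma_snd_le {E E' Ω : Type*} [MeasurableSpace E] [MeasurableSpace E']
    (X1 : ℝ≥0 → Ω → E) (X2 : ℝ≥0 → Ω → E') (t : ℝ≥0) :
    pastSigma X2 t ≤ pastSigma (fun t ω => (X1 t ω, X2 t ω)) t := by
  refine iSup₂_le fun r hr => ?_
  have h : Measurable[pastSigma (fun t ω => (X1 t ω, X2 t ω)) t] (X2 r) :=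
    measurable_snd.comp (measurable_pastSigma (fun t ω => (X1 t ω, X2 t ω)) hr)
  exact h.comap_le

section Coupling

variable {E : Type*} [MeasurableSpace E] {Ω : Type*} [mΩ : MeasurableSpace Ω]
  {M : HomogeneousMarkovProcess E Ω} {φ : ℝ≥0 → ℝ≥0 → Ω → ℝ≥0} {L n : ℕ}
  {F : (Fin L → E) → ℝ≥0} {δ : ℝ≥0} {T : ℝ≥0} {ε C₀ : ℝ} {κ : ℕ → KernelFamily E}

theorem characteristic_nonneg (s t : ℝ≥0) (x : E) : 0 ≤ M.characteristic φ s t x :=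
  integral_nonneg fun _ => NNReal.coe_nonneg _

open HomogeneousMarkovProcess.IsWFunctional in
theorem characteristic_le (hφ : M.IsWFunctional φ) (hC₀ : 0 ≤ C₀)
    (hC : supMean M φ T ≤ ENNReal.ofReal C₀) {s t : ℝ≥0} (ht : t ≤ T) (x : E) :
    M.characteristic φ s t x ≤ C₀ :=
  (ENNReal.ofReal_le_ofReal_iff hC₀).1 ((hφ.ofReal_characteristic_le_supMean s t x).trans
    ((supMean_mono hφ (tsub_le_self.trans ht)).trans hC))

open HomogeneousMarkovProcess.IsWFunctional in
/-- Over a time interval of `K` steps, the W-functional has a small mean, since the functional of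
the chain is bounded by `K δ`. -/
theorem supMean_step_le (hφ : M.IsWFunctional φ) (hn : 0 < n) {K : ℕ} (hK : 0 < K)
    (hF : Measurable F) (hFδ : ∀ x, F x ≤ δ)
    (hκ : IsMarkovKernel (κ 0 (K + L - 2 - 0) fun j => ((0 + j + 1 : ℕ) : ℝ≥0) / n))
    (hKT : (K : ℝ≥0) / n < T)
    (hconv : ∀ (i : ℕ) (t : ℝ≥0), (i : ℝ≥0) / n < t → t < T → ∀ x,
      |chainCharacteristic n F i (κ i) t x - M.characteristic φ ((i : ℝ≥0) / n) t x| ≤ ε) :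
    supMean M φ ((K : ℝ≥0) / n) ≤ ENNReal.ofReal (K * δ + ε) := by
  refine iSup_le fun x => ?_
  have h1 := hφ.ofReal_characteristic ((0 : ℕ) / n) ((K : ℝ≥0) / n) x
  simp only [Nat.cast_zero, zero_div, tsub_zero] at h1
  rw [← h1]
  refine ENNReal.ofReal_le_ofReal ?_
  have h2 := hconv 0 ((K : ℝ≥0) / n) (by
    rw [Nat.cast_zero, zero_div]
    have h3 : (0 : ℝ≥0) < n := by exact_mod_cast hn
    have h4 : (0 : ℝ≥0) < K := by exact_mod_cast hK
    positivity) hKT x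
  have h5 := chainCharacteristic_le (i := 0) (b := K) hn hF hFδ hκ x
  rw [Nat.cast_zero, zero_div] at h2
  rw [Nat.sub_zero] at h5
  linarith [(abs_le.1 h2).1]

variable {ν : Measure E} [IsProbabilityMeasure ν] {Φ : (ℝ≥0 → E) → C(TimePairs, ℝ≥0)}
  {Ωn : Type*} [mΩn : MeasurableSpace Ωn] {μ : Measure Ωn} [IsProbabilityMeasure μ]
  {X : ℝ≥0 → Ωn → E}
  {Ω' : Type*} [mΩ' : MeasurableSpace Ω'] {P : Measure Ω'} [IsProbabilityMeasure P]
  {X1 X2 : ℝ≥0 → Ω' → E}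

/-- The mean of the functional of the chain over a time interval starting from `0`. -/
theorem lintegral_windowSum_le (hφ : M.IsWFunctional φ) (hn : 0 < n)
    (hF : Measurable F) (hFδ : ∀ x, F x ≤ δ) (hX : ∀ t, Measurable (X t))
    (hκ : ∀ i : ℕ, IsCondFDD μ X (pastSigma X ((i : ℝ≥0) / n)) ((i : ℝ≥0) / n) (κ i))
    (hX1 : ∀ t, Measurable (X1 t))
    (hlaw1 : IdentDistrib (fun ω t => X1 t ω) (fun ω t => X t ω) P μ)
    (hC₀ : 0 ≤ C₀) (hC : HomogeneousMarkovProcess.IsWFunctional.supMean M φ T ≤ ENNReal.ofReal C₀)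
    (hconv : ∀ (i : ℕ) (t : ℝ≥0), (i : ℝ≥0) / n < t → t < T → ∀ x,
      |chainCharacteristic n F i (κ i) t x - M.characteristic φ ((i : ℝ≥0) / n) t x| ≤ ε)
    {b : ℕ} (hb : (b : ℝ≥0) / n < T) :
    ∫⁻ ω, (windowSum F (fun k => X1 ((k : ℝ≥0) / n) ω) 0 b : ℝ≥0∞) ∂P
      ≤ ENNReal.ofReal (C₀ + ε) := by
  rcases Nat.eq_zero_or_pos b with rfl | hb0
  · simp [windowSum]
  have hp : Measurable fun (w : ℝ≥0 → E) =>
      (windowSum F (fun k => w ((k : ℝ≥0) / n)) 0 b : ℝ≥0∞) :=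
    (measurable_windowSum (Y := fun k (w : ℝ≥0 → E) => w ((k : ℝ≥0) / n)) hF
      fun k _ _ => measurable_pi_apply _).coe_nnreal_ennreal
  have h1 := setLIntegral_comp_eq_of_identDistrib hlaw1 (measurable_pi_lambda _ hX1)
      (measurable_pi_lambda _ hX) hp MeasurableSet.univ
  have h2 := setLIntegral_windowSum_eq (i := 0) (b := b) hX hn hF hFδ (hκ 0) MeasurableSet.univ
  simp only [Set.preimage_univ, Measure.restrict_univ] at h1 h2
  rw [h1, h2]
  have h3 : ∀ x, chainCharacteristic n F 0 (κ 0) ((b : ℝ≥0) / n) x ≤ C₀ + ε := fun x => by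
    have h4 := hconv 0 ((b : ℝ≥0) / n) (by
      rw [Nat.cast_zero, zero_div]
      have h3 : (0 : ℝ≥0) < n := by exact_mod_cast hn
      have h4 : (0 : ℝ≥0) < b := by exact_mod_cast hb0
      positivity) hb x
    have h5 := characteristic_le hφ hC₀ hC (s := ((0 : ℕ) : ℝ≥0) / n) hb.le x
    linarith [(abs_le.1 h4).2]
  refine (lintegral_mono fun ω => ENNReal.ofReal_le_ofReal (h3 _)).trans ?_
  rw [lintegral_const, measure_univ, mul_one]

open HomogeneousMarkovProcess.IsWFunctional in
/-- The mean square estimate for the functionals of the two components of a coupling at the time `N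
K / n`: `integral_sq_sum_sub_le` for the increments over blocks of `K` steps, where the conditional
means are the characteristics of the two functionals. Since `L ≤ K + 1`, the increment of the
functional of the chain over a block is known at the end of the next block. -/
theorem integral_sq_windowSum_sub_le (hφ : M.IsWFunctional φ) (hΦ : Measurable Φ)
    (hΦφ : functionalPath φ =ᵐ[M.law ν] fun ω => Φ fun t => M.X t ω)
    (hchar : ∀ s t, s ≤ t → t < T → Measurable (M.characteristic φ s t))
    (hn : 0 < n) {K : ℕ} (hK : 0 < K) (hLK : L ≤ K + 1)
    (hF : Measurable F) (hFδ : ∀ x, F x ≤ δ) (hX : ∀ t, Measurable (X t))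
    (hκ : ∀ i : ℕ, IsCondFDD μ X (pastSigma X ((i : ℝ≥0) / n)) ((i : ℝ≥0) / n) (κ i))
    (hX1 : ∀ t, Measurable (X1 t)) (hX2 : ∀ t, Measurable (X2 t))
    (hlaw1 : IdentDistrib (fun ω t => X1 t ω) (fun ω t => X t ω) P μ)
    (hlaw2 : IdentDistrib (fun ω t => X2 t ω) (fun ω t => M.X t ω) P (M.law ν))
    (hM1 : ∀ j : ℕ, 1 ≤ j → HasMarkovPropertyAt P X1
      (pastSigma fun t ω => (X1 t ω, X2 t ω)) (((j * K : ℕ) : ℝ≥0) / n))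
    (hM2 : ∀ j : ℕ, 1 ≤ j → HasMarkovPropertyAt P X2
      (pastSigma fun t ω => (X1 t ω, X2 t ω)) (((j * K : ℕ) : ℝ≥0) / n))
    (hC₀ : 0 ≤ C₀) (hC : supMean M φ T ≤ ENNReal.ofReal C₀) (hε : 0 ≤ ε)
    (hconv : ∀ (i : ℕ) (t : ℝ≥0), (i : ℝ≥0) / n < t → t < T → ∀ x,
      |chainCharacteristic n F i (κ i) t x - M.characteristic φ ((i : ℝ≥0) / n) t x| ≤ ε)
    (hKT : (K : ℝ≥0) / n < T) {N : ℕ} (hNT : ((N * K : ℕ) : ℝ≥0) / n < T)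
    {η lam : ℝ} (hη : 0 ≤ η) (hlam : 0 < lam) {bad : Set Ω'} (hbad : MeasurableSet bad)
    (hbadlam : P.real bad ≤ lam ^ 2)
    (hgood : ∀ ω, ω ∉ bad → ∀ j : ℕ, 1 ≤ j → j < N →
      |M.characteristic φ (((j * K : ℕ) : ℝ≥0) / n) (((N * K : ℕ) : ℝ≥0) / n)
          (X1 (((j * K : ℕ) : ℝ≥0) / n) ω)
        - M.characteristic φ (((j * K : ℕ) : ℝ≥0) / n) (((N * K : ℕ) : ℝ≥0) / n)
          (X2 (((j * K : ℕ) : ℝ≥0) / n) ω)| ≤ η) :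
    ∫ ω, ((windowSum F (fun k => X1 ((k : ℝ≥0) / n) ω) 0 (N * K) : ℝ)
        - Φ (fun r => X2 r ω) (timePair (zero_le (a := ((N * K : ℕ) : ℝ≥0) / n)))) ^ 2 ∂P ≤
      3 * (K * δ + 2 * (K * δ + ε)) * (C₀ + ε) + 4 * (η + ε) * (C₀ + ε)
        + 2 * (C₀ + ε) * (lam * (6 * (K * δ) * (C₀ + ε) + 8 * (C₀ + ε) ^ 2 + 1)) := by
  have hnpos : (0 : ℝ≥0) < n := by exact_mod_cast hn
  set g : ℕ → ℝ≥0 := fun j => ((j * K : ℕ) : ℝ≥0) / n with hgdef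
  have hgm : Monotone g := fun i j hij => by
    have : ((i * K : ℕ) : ℝ≥0) ≤ ((j * K : ℕ) : ℝ≥0) := by
      exact_mod_cast Nat.mul_le_mul_right K hij
    simp only [hgdef]
    gcongr
  have hglt : ∀ {i j}, i < j → g i < g j := fun {i j} hij => by
    have : ((i * K : ℕ) : ℝ≥0) < ((j * K : ℕ) : ℝ≥0) := by
      exact_mod_cast Nat.mul_lt_mul_of_pos_right hij hK
    simp only [hgdef]
    gcongr
  have hg0 : g 0 = 0 := by simp [hgdef]
  have hgT : ∀ j ≤ N, g j < T := fun j hj => (hgm hj).trans_lt hNT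
  have hgsub : ∀ j, g (j + 1) - g j = (K : ℝ≥0) / n := fun j => by
    have : g (j + 1) = g j + (K : ℝ≥0) / n := by
      simp only [hgdef]; push_cast; ring
    rw [this, add_tsub_cancel_left]
  set 𝒢 : ℝ≥0 → MeasurableSpace Ω' := pastSigma fun t ω => (X1 t ω, X2 t ω) 
  have h𝒢 : ∀ t, 𝒢 t ≤ mΩ' := pastSigma_le fun t => (hX1 t).prodMk (hX2 t)
  have hXad : ∀ {r t}, r ≤ t → Measurable[𝒢 t] (X1 r) := fun hr =>
    measurable_fst.comp (measurable_pastSigma (fun t ω => (X1 t ω, X2 t ω)) hr)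
  -- the W-functional of the second component
  set p : TimePairs → Ω' → ℝ≥0 := fun q ω => Φ (fun r => X2 r ω) q with hpdef
  have hpm : ∀ q, Measurable (p q) := fun q =>
    (measurable_eval hΦ _).comp (measurable_pi_lambda _ hX2)
  have hpadd := hφ.ae_additive_of_identDistrib hΦ hΦφ hlaw2
  have hp1 : ∀ {s t} (h : s ≤ t), ∫⁻ ω, (p (timePair h) ω : ℝ≥0∞) ∂P ≤
      supMean M φ (t - s) := fun h => hφ.lintegral_le_of_identDistrib hΦ hΦφ hX2 hlaw2 h
  have hp2 : ∀ {s t} (h : s ≤ t), ∫⁻ ω, (p (timePair h) ω : ℝ≥0∞) ^ 2 ∂P ≤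
      2 * supMean M φ (t - s) * ∫⁻ ω, (p (timePair h) ω : ℝ≥0∞) ∂P := fun h =>
    hφ.lintegral_sq_le_of_identDistrib hΦ hΦφ hX2 hlaw2 h
  have hsupfin : ∀ t, supMean M φ t ≠ ∞ := fun t => (hφ.bounded t).ne
  have hpfin : ∀ {s t} (h : s ≤ t), ∫⁻ ω, (p (timePair h) ω : ℝ≥0∞) ∂P ≠ ∞ := fun h =>
    ne_top_of_le_ne_top (hsupfin _) (hp1 h)
  have hp2fin : ∀ {s t} (h : s ≤ t), ∫⁻ ω, (p (timePair h) ω : ℝ≥0∞) ^ 2 ∂P ≠ ∞ := fun h =>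
    ne_top_of_le_ne_top
      (ENNReal.mul_ne_top (ENNReal.mul_ne_top ENNReal.ofNat_ne_top (hsupfin _)) (hpfin h)) (hp2 h)
  set A : ℕ → Ω' → ℝ := fun j ω =>
    (windowSum F (fun k => X1 ((k : ℝ≥0) / n) ω) (j * K) ((j + 1) * K) : ℝ) with hAdef
  set B : ℕ → Ω' → ℝ := fun j ω => (p (timePair (hgm (Nat.le_succ j))) ω : ℝ) with hBdef
  have hwm : ∀ a b, Measurable fun ω => windowSum F (fun k => X1 ((k : ℝ≥0) / n) ω) a b :=
    fun a b => measurable_windowSum (Y := fun k ω => X1 ((k : ℝ≥0) / n) ω) hF fun k _ _ => hX1 _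
  have hwfin : ∀ a b, Integrable
      (fun ω => (windowSum F (fun k => X1 ((k : ℝ≥0) / n) ω) a b : ℝ)) P := fun a b =>
    Integrable.of_bound (hwm a b).coe_nnreal_real.aestronglyMeasurable
      ((b - a : ℕ) * δ : ℝ≥0) (.of_forall fun ω => by
        rw [Real.norm_of_nonneg (NNReal.coe_nonneg _)]
        exact_mod_cast windowSum_le hFδ _ a b)
  have hsumA : ∀ j ≤ N, ∀ ω, ∑ l ∈ Finset.Ico j N, A l ω =
      windowSum F (fun k => X1 ((k : ℝ≥0) / n) ω) (j * K) (N * K) := fun j hj ω => by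
    simp only [hAdef]
    rw [← sum_windowSum_blocks F _ K hj]
    push_cast
    rfl
  have hsumB : ∀ j (hj : j ≤ N), ∀ᵐ ω ∂P,
      ∑ l ∈ Finset.Ico j N, B l ω = p (timePair (hgm hj)) ω := by
    intro j hj
    filter_upwards [hpadd] with ω hω
    have hinc : ∀ {s t} (h : s ≤ t),
        (p (timePair h) ω : ℝ) =
          p (timePair (zero_le (a := t))) ω - p (timePair (zero_le (a := s))) ω := fun {s t} h => by
      simp only [hpdef]
      rw [← hω s t h]; push_cast; ring
    simp only [hBdef]
    rw [Finset.sum_congr rfl fun l _ => hinc (hgm (Nat.le_succ l)), hinc (hgm hj)]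
    exact Finset.sum_Ico_sub (fun l => (p (timePair (zero_le (a := g l))) ω : ℝ)) hj
  have hstep := supMean_step_le hφ hn hK hF hFδ ((hκ 0 _ _ (lt_grid hn 0)).1) hKT hconv
  have hKδ : (0 : ℝ) ≤ K * δ := by positivity
  have hsumB0 : ∀ᵐ ω ∂P, ∑ l ∈ Finset.range N, B l ω = p (timePair (hgm (Nat.zero_le N))) ω := by
    rw [Finset.range_eq_Ico]
    exact hsumB 0 (Nat.zero_le N)
  have hsumA0 : ∀ ω, ∑ l ∈ Finset.range N, A l ω =
      windowSum F (fun k => X1 ((k : ℝ≥0) / n) ω) 0 (N * K) := fun ω => by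
    have := hsumA 0 (Nat.zero_le N) ω
    rwa [zero_mul, ← Finset.range_eq_Ico] at this
  have hpN1 : ∫⁻ ω, (p (timePair (hgm (Nat.zero_le N))) ω : ℝ≥0∞) ∂P ≤ ENNReal.ofReal C₀ :=
    (hp1 _).trans ((supMean_mono hφ (tsub_le_self.trans (hgT N le_rfl).le)).trans hC)
  have hpN1' : ∫ ω, (p (timePair (hgm (Nat.zero_le N))) ω : ℝ) ∂P ≤ C₀ := by
    rw [integral_coe_eq_toReal (hpm _).aemeasurable]
    exact ENNReal.toReal_le_of_le_ofReal hC₀ hpN1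
  have hBint : ∀ j, Integrable (B j) P := fun j => integrable_coe (hpm _).aemeasurable (hpfin _)
  have hfinal := integral_sq_sum_sub_le (μ := P) (𝓕 := fun j => 𝒢 (g j)) (fun j => h𝒢 _) N
    (A := A) (B := B) (a := K * δ) (b := 2 * (K * δ + ε)) (C := C₀ + ε) (η := η + ε) (lam := lam)
    (by positivity) (by positivity) hlam
    (fun j _ ω => NNReal.coe_nonneg _) (fun j _ ω => NNReal.coe_nonneg _)
    (fun j _ => ?_) (fun j _ => ?_) (fun j _ ω => ?_) (fun j _ => ?_) (fun j _ => ?_) ?_ ?_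
    hKδ (by positivity) ?_
    (cA := fun j ω => chainCharacteristic n F (j * K) (κ (j * K)) (g N) (X1 (g j) ω))
    (cB := fun j ω => M.characteristic φ (g j) (g N) (X2 (g j) ω))
    (fun j hj hjN => ?_) (fun j hj hjN => ?_) (fun j hj hjN ω => ?_) hbad hbadlam
    (fun j hj hjN ω => ?_)
  · refine le_trans (le_of_eq (integral_congr_ae ?_)) hfinal
    filter_upwards [hsumB0] with ω hω
    have h1 : timePair (zero_le (a := g N)) = timePair (hgm (Nat.zero_le N)) := by
      simp only [hg0]
    simp only [hsumA0, hω, hpdef]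
    rw [h1]
  · -- adaptedness of the chain blocks
    have h1 : Measurable[𝒢 (g (j + 2))] fun ω =>
        windowSum F (fun k => X1 ((k : ℝ≥0) / n) ω) (j * K) ((j + 1) * K) := by
      refine @measurable_windowSum E L _ Ω' (𝒢 (g (j + 2))) F hF
        (fun k ω => X1 ((k : ℝ≥0) / n) ω) _ _ fun k _ hk => hXad ?_
      have h2 : k ≤ (j + 2) * K := by
        have : (j + 2) * K = (j + 1) * K + K := by ring
        omega
      have h3 : (k : ℝ≥0) ≤ (((j + 2) * K : ℕ) : ℝ≥0) := by exact_mod_cast h2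
      simp only [hgdef]
      gcongr
    exact (measurable_coe_nnreal_real.comp h1).stronglyMeasurable.aestronglyMeasurable
  · exact (hφ.aestronglyMeasurable_of_identDistrib hΦ hΦφ hlaw2 (hgm (Nat.le_succ j))).mono
      ((pastSigma_mono X2 (hgm (Nat.le_succ (j + 1)))).trans (pastSigma_snd_le X1 X2 _))
  · have h1 := windowSum_le hFδ (fun k => X1 ((k : ℝ≥0) / n) ω) (j * K) ((j + 1) * K)
    rw [show (j + 1) * K - j * K = K by rw [Nat.succ_mul]; omega] at h1
    exact_mod_cast h1
  · exact memLp_two_coe (hpm _).aemeasurable (hp2fin _)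
  · simp only [hBdef]
    rw [integral_coe_eq_toReal (hpm _).aemeasurable, integral_coe_sq_eq_toReal (hpm _).aemeasurable]
    have h1 : ∫⁻ ω, (p (timePair (hgm (Nat.le_succ j))) ω : ℝ≥0∞) ^ 2 ∂P ≤
        2 * supMean M φ ((K : ℝ≥0) / n) *
          ∫⁻ ω, (p (timePair (hgm (Nat.le_succ j))) ω : ℝ≥0∞) ∂P := by
      rw [← hgsub j]
      exact hp2 (hgm (Nat.le_succ j))
    have h2 : 2 * supMean M φ ((K : ℝ≥0) / n) ≤ ENNReal.ofReal (2 * (K * δ + ε)) := by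
      rw [ENNReal.ofReal_mul zero_le_two, ENNReal.ofReal_ofNat]
      gcongr
    have h3 := h1.trans (mul_le_mul_left h2 _)
    have h4 := ENNReal.toReal_mono
      (ENNReal.mul_ne_top ENNReal.ofReal_ne_top (hpfin (hgm (Nat.le_succ j)))) h3
    rwa [ENNReal.toReal_mul, ENNReal.toReal_ofReal (by positivity)] at h4
  · rw [← integral_finsetSum _ fun j _ => hwfin _ _]
    have h1 := lintegral_windowSum_le hφ hn hF hFδ hX hκ hX1 hlaw1 hC₀ hC hconv hNT
    change ∫ ω, ∑ j ∈ Finset.range N, A j ω ∂P ≤ _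
    simp only [hsumA0]
    rw [integral_coe_eq_toReal (hwm _ _).aemeasurable]
    exact ENNReal.toReal_le_of_le_ofReal (by positivity) h1
  · rw [← integral_finsetSum _ fun j _ => hBint j, integral_congr_ae hsumB0]
    linarith
  · rw [integral_congr_ae (hsumB0.mono fun ω h => by rw [h]),
      integral_coe_sq_eq_toReal (hpm _).aemeasurable]
    refine ENNReal.toReal_le_of_le_ofReal (by positivity) ((hp2 _).trans ?_)
    have h1 : supMean M φ (g N - g 0) ≤ ENNReal.ofReal (C₀ + ε) :=
      (supMean_mono hφ (tsub_le_self.trans (hgT N le_rfl).le)).trans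
        (hC.trans (ENNReal.ofReal_le_ofReal (by linarith)))
    have h2 : ∫⁻ ω, (p (timePair (hgm (Nat.zero_le N))) ω : ℝ≥0∞) ∂P ≤ ENNReal.ofReal (C₀ + ε) :=
      hpN1.trans (ENNReal.ofReal_le_ofReal (by linarith))
    calc 2 * supMean M φ (g N - g 0) * ∫⁻ ω, (p (timePair (hgm (Nat.zero_le N))) ω : ℝ≥0∞) ∂P
        ≤ 2 * ENNReal.ofReal (C₀ + ε) * ENNReal.ofReal (C₀ + ε) := by gcongr
      _ = ENNReal.ofReal (2 * (C₀ + ε) ^ 2) := by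
          rw [ENNReal.ofReal_mul zero_le_two, ENNReal.ofReal_ofNat, sq,
            ENNReal.ofReal_mul (by positivity), mul_assoc]
  · -- the conditional means of the remainders of the chain
    have h1 : (fun ω => ∑ l ∈ Finset.Ico j N, A l ω) =
        fun ω => (windowSum F (fun k => X1 ((k : ℝ≥0) / n) ω) (j * K) (N * K) : ℝ) := by
      funext ω
      exact hsumA j hjN.le ω
    rw [h1]
    have hκm := ((hκ (j * K)) (N * K + L - 2 - j * K) _ (lt_grid hn (j * K))).1
    refine condExp_ae_eq_of_forall_setLIntegral_eq (h𝒢 _) (hwfin _ _)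
      ((measurable_chainCharacteristic hn hF hκm).comp (hXad le_rfl))
      (fun ω => chainCharacteristic_nonneg hn _)
      (fun ω => chainCharacteristic_le hn hF hFδ hκm _) fun S hS => ?_
    exact setLIntegral_windowSum_eq_of_identDistrib hX hX1 hn hF hFδ (hκ (j * K)) hlaw1 h𝒢
      (hM1 j (by omega)) hS
  · -- the conditional means of the remainders of the W-functional
    refine (condExp_congr_ae (hsumB j hjN.le)).trans ?_
    have hm := hchar (g j) (g N) (hgm hjN.le) hNT
    refine condExp_ae_eq_of_forall_setLIntegral_eq (h𝒢 _)
      (integrable_coe (hpm _).aemeasurable (hpfin _)) (hm.comp ((hM2 j (by omega)).1 _))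
      (fun ω => characteristic_nonneg _ _ _)
      (fun ω => characteristic_le hφ hC₀ hC (hgT N le_rfl).le _) fun S hS => ?_
    exact hφ.setLIntegral_eq_of_identDistrib hΦ hΦφ hX2 hlaw2 (hgm hjN.le) hm h𝒢
      (hM2 j (by omega)) hS
  · have h1 := hconv (j * K) (g N) (hglt hjN) hNT (X1 (g j) ω)
    have h2 := characteristic_le hφ hC₀ hC (s := g j) (hgT N le_rfl).le (X1 (g j) ω)
    rw [abs_of_nonneg (chainCharacteristic_nonneg hn _)]
    linarith [(abs_le.1 h1).2]
  · have h1 := hconv (j * K) (g N) (hglt hjN) hNT (X1 (g j) ω)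
    have h2 := characteristic_le hφ hC₀ hC (s := g j) (hgT N le_rfl).le (X1 (g j) ω)
    have h3 := characteristic_le hφ hC₀ hC (s := g j) (hgT N le_rfl).le (X2 (g j) ω)
    have h4 := characteristic_nonneg (M := M) (φ := φ) (g j) (g N) (X1 (g j) ω)
    have h5 := characteristic_nonneg (M := M) (φ := φ) (g j) (g N) (X2 (g j) ω)
    have h6 := abs_le.1 h1
    by_cases hω : ω ∈ bad
    · rw [Set.indicator_of_mem hω, abs_le]
      constructor <;> linarith [h6.1, h6.2]
    · rw [Set.indicator_of_notMem hω, abs_le]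
      have h7 := abs_le.1 (hgood ω hω j (by omega) hjN)
      constructor <;> linarith [h6.1, h6.2, h7.1, h7.2]

end Coupling

/-! ### Broken lines -/

theorem interp_natCast (a : ℕ → ℝ≥0) (m : ℕ) : interp a m = ∑ k ∈ Finset.range m, a k := by
  simp [interp]

theorem interp_add_le {a : ℕ → ℝ≥0} {δ : ℝ≥0} (ha : ∀ k, a k ≤ δ) (m K : ℕ) :
    interp a ((m + K : ℕ) : ℝ≥0) ≤ interp a m + K * δ := by
  rw [interp_natCast, interp_natCast, Finset.sum_range_add]
  gcongr
  refine (Finset.sum_le_card_nsmul _ _ δ fun k _ => ha _).trans_eq ?_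
  rw [Finset.card_range, nsmul_eq_mul]

section BrokenLine

variable {E : Type*} {L n : ℕ} {F : (Fin L → E) → ℝ≥0} {Y : ℝ≥0 → E}

theorem coe_brokenLine (p : TimePairs) :
    (brokenLine n F Y p : ℝ) =
      (interp (fun k => F fun l => Y (((k + l : ℕ) : ℝ≥0) / n)) (n * p.1.2) : ℝ)
        - interp (fun k => F fun l => Y (((k + l : ℕ) : ℝ≥0) / n)) (n * p.1.1) :=
  brokenLineValue_eq n F Y p.2

theorem coe_brokenLine_zero (t : ℝ≥0) :
    brokenLine n F Y (timePair (zero_le (a := t))) =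
      interp (fun k => F fun l => Y (((k + l : ℕ) : ℝ≥0) / n)) (n * t) := by
  rw [← NNReal.coe_inj, coe_brokenLine]
  simp [interp]

theorem brokenLine_add {s t : ℝ≥0} (h : s ≤ t) :
    brokenLine n F Y (timePair (zero_le (a := s))) + brokenLine n F Y (timePair h)
      = brokenLine n F Y (timePair (zero_le (a := t))) := by
  rw [← NNReal.coe_inj]
  push_cast
  simp only [coe_brokenLine]
  ring

/-- The broken line at the time `t` is close to the additive functional at the last point `N K / n`
before `t`. -/
theorem abs_brokenLine_sub_windowSum_le {δ : ℝ≥0} (hn : 0 < n) (hFδ : ∀ x, F x ≤ δ) {K N : ℕ}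
    {t : ℝ≥0} (h1 : ((N * K : ℕ) : ℝ≥0) / n ≤ t) (h2 : t ≤ (((N + 1) * K : ℕ) : ℝ≥0) / n) :
    |(brokenLine n F Y (timePair (zero_le (a := t))) : ℝ)
      - windowSum F (fun k => Y ((k : ℝ≥0) / n)) 0 (N * K)| ≤ K * δ := by
  have hn' : (0 : ℝ≥0) < n := by exact_mod_cast hn
  rw [div_le_iff₀ hn', mul_comm t] at h1
  rw [le_div_iff₀ hn', mul_comm t, Nat.succ_mul] at h2
  set a : ℕ → ℝ≥0 := fun k => F fun l => Y (((k + l : ℕ) : ℝ≥0) / n) with ha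
  have h3 : windowSum F (fun k => Y ((k : ℝ≥0) / n)) 0 (N * K) = interp a ((N * K : ℕ) : ℝ≥0) := by
    rw [interp_natCast, windowSum, Finset.range_eq_Ico]
  have h4 := interp_mono a h1
  have h5 := (interp_mono a h2).trans (interp_add_le (fun k => hFδ _) (N * K) K)
  have h4' : (interp a ((N * K : ℕ) : ℝ≥0) : ℝ) ≤ interp a (n * t) := NNReal.coe_le_coe.2 h4
  have h5' : (interp a (n * t) : ℝ) ≤ interp a ((N * K : ℕ) : ℝ≥0) + K * δ := by
    have h6 := NNReal.coe_le_coe.2 h5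
    rwa [NNReal.coe_add, NNReal.coe_mul, NNReal.coe_natCast] at h6
  rw [coe_brokenLine_zero, h3, abs_of_nonneg (by linarith)]
  linarith

end BrokenLine

/-! ### Couplings of the functionals -/

section Coupling

variable {E : Type*} [MeasurableSpace E] {Ω : Type*} [mΩ : MeasurableSpace Ω]
  {M : HomogeneousMarkovProcess E Ω} {φ : ℝ≥0 → ℝ≥0 → Ω → ℝ≥0} {L n : ℕ}
  {F : (Fin L → E) → ℝ≥0} {δ : ℝ≥0} {T : ℝ≥0} {ε C₀ : ℝ} {κ : ℕ → KernelFamily E}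
  {ν : Measure E} [IsProbabilityMeasure ν] {Φ : (ℝ≥0 → E) → C(TimePairs, ℝ≥0)}
  {Ωn : Type*} [mΩn : MeasurableSpace Ωn] {μ : Measure Ωn} [IsProbabilityMeasure μ]
  {X : ℝ≥0 → Ωn → E}
  {Ω' : Type*} [mΩ' : MeasurableSpace Ω'] {P : Measure Ω'} [IsProbabilityMeasure P]
  {X1 X2 : ℝ≥0 → Ω' → E}

open HomogeneousMarkovProcess.IsWFunctional in
/-- The mean distance between the broken line and the W-functional at a fixed time, for the
components of a coupling. -/
theorem integral_abs_brokenLine_sub_le (hφ : M.IsWFunctional φ) (hΦ : Measurable Φ)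
    (hΦφ : functionalPath φ =ᵐ[M.law ν] fun ω => Φ fun t => M.X t ω)
    (hchar : ∀ s t, s ≤ t → t < T → Measurable (M.characteristic φ s t))
    (hn : 0 < n) {K : ℕ} (hK : 0 < K) (hLK : L ≤ K + 1)
    (hF : Measurable F) (hFδ : ∀ x, F x ≤ δ) (hX : ∀ t, Measurable (X t))
    (hκ : ∀ i : ℕ, IsCondFDD μ X (pastSigma X ((i : ℝ≥0) / n)) ((i : ℝ≥0) / n) (κ i))
    (hX1 : ∀ t, Measurable (X1 t)) (hX2 : ∀ t, Measurable (X2 t))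
    (hlaw1 : IdentDistrib (fun ω t => X1 t ω) (fun ω t => X t ω) P μ)
    (hlaw2 : IdentDistrib (fun ω t => X2 t ω) (fun ω t => M.X t ω) P (M.law ν))
    (hM1 : ∀ j : ℕ, 1 ≤ j → HasMarkovPropertyAt P X1
      (pastSigma fun t ω => (X1 t ω, X2 t ω)) (((j * K : ℕ) : ℝ≥0) / n))
    (hM2 : ∀ j : ℕ, 1 ≤ j → HasMarkovPropertyAt P X2
      (pastSigma fun t ω => (X1 t ω, X2 t ω)) (((j * K : ℕ) : ℝ≥0) / n))
    (hC₀ : 0 ≤ C₀) (hC : supMean M φ T ≤ ENNReal.ofReal C₀) (hε : 0 ≤ ε)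
    (hconv : ∀ (i : ℕ) (t : ℝ≥0), (i : ℝ≥0) / n < t → t < T → ∀ x,
      |chainCharacteristic n F i (κ i) t x - M.characteristic φ ((i : ℝ≥0) / n) t x| ≤ ε)
    (hKT : (K : ℝ≥0) / n < T)
    {η lam : ℝ} (hη : 0 ≤ η) (hlam : 0 < lam) {bad : Set Ω'} (hbad : MeasurableSet bad)
    (hbadlam : P.real bad ≤ lam ^ 2)
    (hgood : ∀ ω, ω ∉ bad → ∀ j : ℕ, 1 ≤ j → ((j * K : ℕ) : ℝ≥0) / n < T → ∀ t < T,
      ((j * K : ℕ) : ℝ≥0) / n ≤ t →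
      |M.characteristic φ (((j * K : ℕ) : ℝ≥0) / n) t (X1 (((j * K : ℕ) : ℝ≥0) / n) ω)
        - M.characteristic φ (((j * K : ℕ) : ℝ≥0) / n) t (X2 (((j * K : ℕ) : ℝ≥0) / n) ω)| ≤ η)
    {t : ℝ≥0} (ht : t < T) :
    ∫ ω, |(brokenLine n F (fun r => X1 r ω) (timePair (zero_le (a := t))) : ℝ)
        - Φ (fun r => X2 r ω) (timePair (zero_le (a := t)))| ∂P ≤
      √(3 * (K * δ + 2 * (K * δ + ε)) * (C₀ + ε) + 4 * (η + ε) * (C₀ + ε)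
        + 2 * (C₀ + ε) * (lam * (6 * (K * δ) * (C₀ + ε) + 8 * (C₀ + ε) ^ 2 + 1)))
        + K * δ + (K * δ + ε) := by
  have hn' : (0 : ℝ≥0) < n := by exact_mod_cast hn
  have hK' : (0 : ℝ≥0) < K := by exact_mod_cast hK
  set N : ℕ := ⌊(n : ℝ≥0) * t / K⌋₊ with hN
  have h1 : ((N * K : ℕ) : ℝ≥0) / n ≤ t := by
    have := Nat.floor_le (zero_le (a := (n : ℝ≥0) * t / K))
    rw [le_div_iff₀ hK'] at this
    rw [div_le_iff₀ hn', mul_comm t]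
    push_cast
    exact this
  have h2 : t ≤ (((N + 1) * K : ℕ) : ℝ≥0) / n := by
    have := (Nat.lt_floor_add_one ((n : ℝ≥0) * t / K)).le
    rw [div_le_iff₀ hK'] at this
    rw [le_div_iff₀ hn', mul_comm t]
    push_cast
    exact this
  have hNT : ((N * K : ℕ) : ℝ≥0) / n < T := h1.trans_lt ht
  have hsub : t - ((N * K : ℕ) : ℝ≥0) / n ≤ (K : ℝ≥0) / n := by
    rw [tsub_le_iff_left, ← add_div]
    refine h2.trans_eq ?_
    push_cast
    ring
  set g : ℝ≥0 := ((N * K : ℕ) : ℝ≥0) / n with hg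
  have hpm : ∀ q, Measurable fun ω => Φ (fun r => X2 r ω) q := fun q =>
    (measurable_eval hΦ _).comp (measurable_pi_lambda _ hX2)
  have hpint : ∀ {a b} (h : a ≤ b), Integrable
      (fun ω => (Φ (fun r => X2 r ω) (timePair h) : ℝ)) P := fun h =>
    integrable_coe (hpm _).aemeasurable (ne_top_of_le_ne_top (hφ.bounded _).ne
      (hφ.lintegral_le_of_identDistrib hΦ hΦφ hX2 hlaw2 h))
  have hp2 : MemLp (fun ω => (Φ (fun r => X2 r ω) (timePair (zero_le (a := g))) : ℝ)) 2 P := by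
    refine memLp_two_coe (hpm _).aemeasurable (ne_top_of_le_ne_top ?_
      (hφ.lintegral_sq_le_of_identDistrib hΦ hΦφ hX2 hlaw2 _))
    exact ENNReal.mul_ne_top (ENNReal.mul_ne_top ENNReal.ofNat_ne_top (hφ.bounded _).ne)
      (ne_top_of_le_ne_top (hφ.bounded _).ne
        (hφ.lintegral_le_of_identDistrib hΦ hΦφ hX2 hlaw2 _))
  have hwm : Measurable fun ω => windowSum F (fun k => X1 ((k : ℝ≥0) / n) ω) 0 (N * K) :=
    measurable_windowSum (Y := fun k ω => X1 ((k : ℝ≥0) / n) ω) hF fun k _ _ => hX1 _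
  have hw2 : MemLp (fun ω => (windowSum F (fun k => X1 ((k : ℝ≥0) / n) ω) 0 (N * K) : ℝ)) 2 P :=
    MemLp.of_bound hwm.coe_nnreal_real.aestronglyMeasurable
      ((N * K - 0 : ℕ) * δ : ℝ≥0) (.of_forall fun ω => by
        rw [Real.norm_of_nonneg (NNReal.coe_nonneg _)]
        exact_mod_cast windowSum_le hFδ _ 0 (N * K))
  have hD2 := hw2.sub hp2
  have hsq := integral_sq_windowSum_sub_le hφ hΦ hΦφ hchar hn hK hLK hF hFδ hX hκ hX1 hX2 hlaw1
    hlaw2 hM1 hM2 hC₀ hC hε hconv hKT hNT hη hlam hbad hbadlam fun ω hω j hj hjN => by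
      have h3 : ((j * K : ℕ) : ℝ≥0) / n ≤ g := by
        have h4 : ((j * K : ℕ) : ℝ≥0) ≤ ((N * K : ℕ) : ℝ≥0) := by
          exact_mod_cast Nat.mul_le_mul_right K hjN.le
        simp only [hg]
        gcongr
      exact hgood ω hω j hj (h3.trans_lt hNT) g hNT h3
  set R := 3 * (K * δ + 2 * (K * δ + ε)) * (C₀ + ε) + 4 * (η + ε) * (C₀ + ε)
    + 2 * (C₀ + ε) * (lam * (6 * (K * δ) * (C₀ + ε) + 8 * (C₀ + ε) ^ 2 + 1)) with hR
  set D : Ω' → ℝ := fun ω => (windowSum F (fun k => X1 ((k : ℝ≥0) / n) ω) 0 (N * K) : ℝ)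
    - Φ (fun r => X2 r ω) (timePair (zero_le (a := g))) with hD
  have hD2' : MemLp D 2 P := hD2
  have hL1 : ∫ ω, |D ω| ∂P ≤ √R := by
    -- the Cauchy–Schwarz inequality, as nonnegativity of the variance of `|D|`
    have h3 := variance_nonneg |D| P
    rw [variance_eq_sub hD2'.abs] at h3
    refine Real.le_sqrt_of_sq_le ?_
    have h4 : ∫ ω, (|D| ^ 2) ω ∂P = ∫ ω, D ω ^ 2 ∂P :=
      integral_congr_ae (.of_forall fun ω => by simp)
    have h5 : ∫ ω, |D| ω ∂P = ∫ ω, |D ω| ∂P := rfl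
    rw [h4, h5] at h3
    linarith
  -- the remaining time interval is shorter than `K / n`
  have hrem : ∫ ω, (Φ (fun r => X2 r ω) (timePair h1) : ℝ) ∂P ≤ K * δ + ε := by
    rw [integral_coe_eq_toReal (hpm _).aemeasurable]
    refine ENNReal.toReal_le_of_le_ofReal (by positivity) ?_
    refine (hφ.lintegral_le_of_identDistrib hΦ hΦφ hX2 hlaw2 h1).trans ?_
    exact (supMean_mono hφ hsub).trans
      (supMean_step_le hφ hn hK hF hFδ ((hκ 0 _ _ (lt_grid hn 0)).1) hKT hconv)
  have hDi : Integrable D P := hD2'.integrable one_le_two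
  calc ∫ ω, |(brokenLine n F (fun r => X1 r ω) (timePair (zero_le (a := t))) : ℝ)
        - Φ (fun r => X2 r ω) (timePair (zero_le (a := t)))| ∂P
      ≤ ∫ ω, (|D ω| + (K * δ + Φ (fun r => X2 r ω) (timePair h1) : ℝ)) ∂P := by
        refine integral_mono_of_nonneg (.of_forall fun ω => abs_nonneg _)
          (hDi.abs.add ((integrable_const _).add (hpint h1))) ?_
        filter_upwards [hφ.ae_additive_of_identDistrib hΦ hΦφ hlaw2] with ω hω
        have h3 := abs_le.1
          (abs_brokenLine_sub_windowSum_le (Y := fun r => X1 r ω) hn hFδ h1 h2)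
        have h4 := hω g t h1
        rw [← NNReal.coe_inj] at h4
        push_cast at h4
        have h5 := NNReal.coe_nonneg (Φ (fun r => X2 r ω) (timePair h1))
        have h6 := neg_abs_le (D ω)
        have h7 := le_abs_self (D ω)
        simp only [hD] at h6 h7 ⊢
        rw [abs_le]
        constructor <;> linarith [h3.1, h3.2]
    _ ≤ √R + K * δ + (K * δ + ε) := by
        have hi : Integrable (fun ω => (K * δ + Φ (fun r => X2 r ω) (timePair h1) : ℝ)) P :=
          (integrable_const _).add (hpint h1)
        rw [integral_add hDi.abs hi, integral_add (integrable_const _) (hpint h1)]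
        simp only [integral_const, probReal_univ, one_smul]
        linarith

end Coupling

/-! ### Weak convergence from couplings -/

/-- Weak convergence, if the random elements can be coupled so that they are close in
probability. -/
theorem tendsto_of_forall_coupling {S : Type*} [PseudoMetricSpace S] [MeasurableSpace S]
    [BorelSpace S] {μs : ℕ → ProbabilityMeasure S} {μ : ProbabilityMeasure S}
    (h : ∀ e : ℝ, 0 < e → ∀ᶠ n in atTop, ∃ (Ω' : Type w) (_ : MeasurableSpace Ω')
      (P : Measure Ω') (c' c : Ω' → S), IsProbabilityMeasure P ∧ Measurable c' ∧ Measurable c ∧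
      P.map c' = μs n ∧ P.map c = μ ∧
      ∃ bad : Set Ω', P bad ≤ ENNReal.ofReal e ∧ ∀ ω, ω ∉ bad → dist (c' ω) (c ω) < e) :
    Tendsto μs atTop (𝓝 μ) := by
  rw [tendsto_iff_forall_lipschitz_integral_tendsto]
  rintro f ⟨B, hB⟩ ⟨l, hl⟩
  have hfm : Measurable f := hl.continuous.measurable
  rw [Metric.tendsto_atTop']
  intro ε hε
  obtain ⟨x₀⟩ : Nonempty S := μ.nonempty
  have hB0 : 0 ≤ B := dist_nonneg.trans (hB x₀ x₀)
  obtain ⟨N, hN⟩ := eventually_atTop.1 (h (ε / (2 * (l + B + 1))) (by positivity))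
  refine ⟨N, fun n hn => ?_⟩
  obtain ⟨Ω', _, P, c', c, hP, hc', hc, hm', hm, bad, hbad, hgood⟩ := hN n hn.le
  set e := ε / (2 * (l + B + 1)) with he
  have he0 : 0 < e := by positivity
  have hfb : ∀ b : Ω' → S, Measurable b → Integrable (fun ω => f (b ω)) P := fun b hb =>
    Integrable.of_bound (hfm.comp hb).aestronglyMeasurable (|f x₀| + B) (.of_forall fun ω => by
      have h1 := hB (b ω) x₀
      rw [Real.dist_eq] at h1
      rw [Real.norm_eq_abs]
      have h2 := abs_sub_abs_le_abs_sub (f (b ω)) (f x₀)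
      linarith)
  rw [← hm', ← hm, integral_map hc'.aemeasurable hfm.aestronglyMeasurable,
    integral_map hc.aemeasurable hfm.aestronglyMeasurable, Real.dist_eq,
    ← integral_sub (hfb c' hc') (hfb c hc)]
  have hbm : MeasurableSet (toMeasurable P bad) := measurableSet_toMeasurable P bad
  have hbr : P.real (toMeasurable P bad) ≤ e := by
    rw [measureReal_def, measure_toMeasurable]
    exact ENNReal.toReal_le_of_le_ofReal he0.le hbad
  have h1 : |∫ ω, (f (c' ω) - f (c ω)) ∂P|
      ≤ ∫ ω, (l * e + (toMeasurable P bad).indicator (fun _ => B) ω) ∂P := by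
    refine (abs_integral_le_integral_abs).trans (integral_mono_of_nonneg
      (.of_forall fun ω => abs_nonneg _)
      ((integrable_const _).add ((integrable_const _).indicator hbm)) (.of_forall fun ω => ?_))
    simp only
    rw [← Real.dist_eq]
    by_cases hω : ω ∈ bad
    · rw [Set.indicator_of_mem (subset_toMeasurable P bad hω)]
      have := hB (c' ω) (c ω)
      have : 0 ≤ l * e := by positivity
      linarith
    · have h2 := hl.dist_le_mul (c' ω) (c ω)
      have h3 : (l : ℝ) * dist (c' ω) (c ω) ≤ l * e :=
        mul_le_mul_of_nonneg_left (hgood ω hω).le l.2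
      have h4 : 0 ≤ (toMeasurable P bad).indicator (fun _ => B) ω :=
        Set.indicator_nonneg (fun _ _ => hB0) ω
      linarith
  rw [integral_add (integrable_const _) ((integrable_const _).indicator hbm), integral_const,
    integral_indicator_const _ hbm, probReal_univ, one_smul, smul_eq_mul] at h1
  have h2 : P.real (toMeasurable P bad) * B ≤ e * B := mul_le_mul_of_nonneg_right hbr hB0
  have h3 : e * (2 * (l + B + 1)) = ε := div_mul_cancel₀ _ (by positivity)
  nlinarith [l.2]

/-- Two increasing additive paths are uniformly close on `[0, T]` if they are close at the points of
a partition of `[0, T]` and one of them has small increments over the intervals of the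
partition. -/
theorem dist_le_of_partition {c c' : C(TimePairs, ℝ≥0)}
    (hc : ∀ (s t : ℝ≥0) (h : s ≤ t),
      c (timePair (zero_le (a := s))) + c (timePair h) = c (timePair (zero_le (a := t))))
    (hc' : ∀ (s t : ℝ≥0) (h : s ≤ t),
      c' (timePair (zero_le (a := s))) + c' (timePair h) = c' (timePair (zero_le (a := t))))
    {T : ℝ≥0} {m : ℕ} (hm : 0 < m) {η : ℝ}
    (hclose : ∀ i ≤ m, |(c' (timePair (zero_le (a := partitionPoint 0 T m i))) : ℝ)
      - c (timePair (zero_le (a := partitionPoint 0 T m i)))| ≤ η)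
    (hinc : ∀ i < m, (c (timePair (partitionPoint_mono 0 T m (Nat.le_succ i))) : ℝ) ≤ η)
    (p : TimePairs) (hp : p.1.2 ≤ T) : dist (c' p) (c p) ≤ 4 * η := by
  set u : ℝ≥0 → ℝ := fun t => c (timePair (zero_le (a := t))) with hu
  set u' : ℝ≥0 → ℝ := fun t => c' (timePair (zero_le (a := t))) with hu'
  have hadd : ∀ {s t} (h : s ≤ t), (c (timePair h) : ℝ) = u t - u s := fun {s t} h => by
    simp only [hu]; rw [← hc s t h]; push_cast; ring
  have hadd' : ∀ {s t} (h : s ≤ t), (c' (timePair h) : ℝ) = u' t - u' s := fun {s t} h => by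
    simp only [hu']; rw [← hc' s t h]; push_cast; ring
  have hmono : ∀ {s t}, s ≤ t → u s ≤ u t := fun {s t} h => by
    have := NNReal.coe_nonneg (c (timePair h)); rw [hadd h] at this; linarith
  have hmono' : ∀ {s t}, s ≤ t → u' s ≤ u' t := fun {s t} h => by
    have := NNReal.coe_nonneg (c' (timePair h)); rw [hadd' h] at this; linarith
  have hpt : ∀ t ≤ T, |u' t - u t| ≤ 2 * η := by
    intro t ht
    -- the interval of the partition that contains `t`
    have hex : ∃ i < m, partitionPoint 0 T m i ≤ t ∧ t ≤ partitionPoint 0 T m (i + 1) := by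
      classical
      have h0 : ∃ j, t ≤ partitionPoint 0 T m j :=
        ⟨m, ht.trans (partitionPoint_self zero_le hm).ge⟩
      rcases Nat.eq_zero_or_pos (Nat.find h0) with h1 | h1
      · have h2 := Nat.find_spec h0
        rw [h1, partitionPoint_zero] at h2
        have h3 : t = 0 := le_antisymm h2 zero_le
        exact ⟨0, hm, by rw [partitionPoint_zero]; exact zero_le, by rw [h3]; exact zero_le⟩
      · have h2 : Nat.find h0 ≤ m := Nat.find_min' h0 (ht.trans (partitionPoint_self zero_le hm).ge)
        refine ⟨Nat.find h0 - 1, by omega, ?_, ?_⟩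
        · exact (not_le.1 (Nat.find_min h0 (m := Nat.find h0 - 1) (by omega))).le
        · rw [Nat.sub_add_cancel h1]
          exact Nat.find_spec h0
    obtain ⟨i, hi, hi1, hi2⟩ := hex
    have h1 := abs_le.1 (hclose i hi.le)
    have h2 := abs_le.1 (hclose (i + 1) hi)
    have h3 := hinc i hi
    rw [hadd] at h3
    have h4 := hmono hi1
    have h5 := hmono hi2
    have h6 := hmono' hi1
    have h7 := hmono' hi2
    simp only [Nat.succ_eq_add_one] at h3
    rw [abs_le]
    constructor <;> linarith [h1.1, h1.2, h2.1, h2.2]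
  have h1 := abs_le.1 (hpt p.1.2 hp)
  have h2 := abs_le.1 (hpt p.1.1 (p.2.trans hp))
  have h3 : (c p : ℝ) = u p.1.2 - u p.1.1 := hadd p.2
  have h4 : (c' p : ℝ) = u' p.1.2 - u' p.1.1 := hadd' p.2
  rw [NNReal.dist_eq, h3, h4, abs_le]
  constructor <;> linarith [h1.1, h1.2, h2.1, h2.2]

/-! ### Asymptotics of the couplings -/

/-- The bound of the mean distance is small when all its parameters are. -/
theorem exists_forall_sqrt_add_le (C₀ : ℝ) (hC₀ : 0 ≤ C₀) {ρ : ℝ} (hρ : 0 < ρ) :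
    ∃ ε : ℝ, 0 < ε ∧ ∀ a : ℝ, 0 ≤ a → a ≤ ε →
      √(3 * (a + 2 * (a + ε)) * (C₀ + ε) + 4 * (ε + ε) * (C₀ + ε)
        + 2 * (C₀ + ε) * (ε * (6 * a * (C₀ + ε) + 8 * (C₀ + ε) ^ 2 + 1)))
        + a + (a + ε) ≤ ρ := by
  set g : ℝ → ℝ := fun ε => √(3 * (ε + 2 * (ε + ε)) * (C₀ + ε) + 4 * (ε + ε) * (C₀ + ε)
    + 2 * (C₀ + ε) * (ε * (6 * ε * (C₀ + ε) + 8 * (C₀ + ε) ^ 2 + 1))) + ε + (ε + ε) with hg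
  have hgc : Continuous g := by fun_prop
  have hg0 : g 0 = 0 := by simp [hg]
  have h1 : ∀ᶠ ε in 𝓝 (0 : ℝ), g ε < ρ :=
    hgc.continuousAt.eventually_lt continuousAt_const (by rw [hg0]; exact hρ)
  obtain ⟨ε, h2, h3⟩ := ((h1.filter_mono nhdsWithin_le_nhds).and
    (self_mem_nhdsWithin (a := (0 : ℝ)) (s := Set.Ioi 0))).exists
  refine ⟨ε, h3, fun a ha haε => le_trans ?_ h2.le⟩
  have h4 : 0 < ε := h3
  simp only [hg]
  gcongr

theorem measurableSet_exists_increment (T : ℝ≥0) (m : ℕ) (η : ℝ) :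
    MeasurableSet {c : C(TimePairs, ℝ≥0) | ∃ i < m,
      η < (c (timePair (partitionPoint_mono 0 T m (Nat.le_succ i))) : ℝ)} := by
  have h : {c : C(TimePairs, ℝ≥0) | ∃ i < m,
      η < (c (timePair (partitionPoint_mono 0 T m (Nat.le_succ i))) : ℝ)} =
      ⋃ i ∈ Finset.range m, {c | η <
        (c (timePair (partitionPoint_mono 0 T m (Nat.le_succ i))) : ℝ)} := by
    ext c
    simp
  rw [h]
  exact Finset.measurableSet_biUnion _ fun i _ => measurableSet_lt measurable_const
    (continuous_eval_const _).measurable.coe_nnreal_real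

/-- Almost surely, a continuous additive path has small increments over the intervals of a fine
partition, so this holds with a probability close to `1` for a fixed partition. -/
theorem exists_partition_measure_le {Ω : Type*} [MeasurableSpace Ω] {μ : Measure Ω}
    [IsProbabilityMeasure μ] {c : Ω → C(TimePairs, ℝ≥0)} (hc : Measurable c)
    (hadd : ∀ᵐ ω ∂μ, ∀ (s t : ℝ≥0) (h : s ≤ t),
      c ω (timePair (zero_le (a := s))) + c ω (timePair h) = c ω (timePair (zero_le (a := t))))
    (T : ℝ≥0) {η e : ℝ} (hη : 0 < η) (he : 0 < e) :
    ∃ m : ℕ, 0 < m ∧ μ {ω | ∃ i < m,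
      η < (c ω (timePair (partitionPoint_mono 0 T m (Nat.le_succ i))) : ℝ)} ≤ ENNReal.ofReal e := by
  set S : ℕ → Set Ω := fun m => {ω | ∃ i < m,
      η < (c ω (timePair (partitionPoint_mono 0 T m (Nat.le_succ i))) : ℝ)} with hS
  have hSm : ∀ m, MeasurableSet (S m) := fun m => hc (measurableSet_exists_increment T m η)
  have hlim : Tendsto (fun m => μ (S m)) atTop (𝓝 (μ ∅)) := by
    refine tendsto_measure_of_ae_tendsto_indicator_of_isFiniteMeasure atTop MeasurableSet.empty
      hSm ?_
    filter_upwards [hadd] with ω hω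
    have hG : Continuous fun t : ℝ≥0 => (c ω (timePair (zero_le (a := t))) : ℝ) := by
      unfold timePair
      fun_prop
    have huc := isCompact_Icc.uniformContinuousOn_of_continuous (hG.continuousOn (s := Set.Icc 0 T))
    obtain ⟨δ, hδ, hd⟩ := Metric.uniformContinuousOn_iff.1 huc η hη
    have h1 : ∀ᶠ m : ℕ in atTop, ((T - 0 : ℝ≥0) : ℝ) / m < δ :=
      (tendsto_const_div_atTop_nhds_zero_nat _).eventually_lt_const hδ
    filter_upwards [h1, eventually_gt_atTop 0] with m hm hm0
    simp only [Set.mem_empty_iff_false, iff_false, hS, Set.mem_ofPred_eq, not_exists, not_and,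
      not_lt]
    intro i hi
    have hle : ∀ j ≤ m, partitionPoint 0 T m j ∈ Set.Icc 0 T := fun j hj =>
      ⟨zero_le, (partitionPoint_mono 0 T m hj).trans_eq (partitionPoint_self zero_le hm0)⟩
    have h2 := hd _ (hle (i + 1) hi) _ (hle i hi.le) (by rw [dist_partitionPoint_succ]; exact hm)
    have h3 := hω _ _ (partitionPoint_mono 0 T m (Nat.le_succ i))
    rw [← NNReal.coe_inj] at h3
    push_cast at h3
    rw [Real.dist_eq] at h2
    have h4 := (abs_lt.1 h2).2
    simp only [Nat.succ_eq_add_one] at h3 ⊢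
    linarith
  rw [measure_empty] at hlim
  have h1 : ∀ᶠ m in atTop, μ (S m) < ENNReal.ofReal e :=
    hlim.eventually_lt_const (ENNReal.ofReal_pos.2 he)
  obtain ⟨m, hm, hm0⟩ := (h1.and (eventually_gt_atTop 0)).exists
  exact ⟨m, hm0, hm.le⟩

theorem integrable_brokenLine_zero {E Ω : Type*} [MeasurableSpace E] [MeasurableSpace Ω]
    {P : Measure Ω} [IsFiniteMeasure P] {L n : ℕ} {F : (Fin L → E) → ℝ≥0} {δ : ℝ≥0}
    (hF : Measurable F) (hFδ : ∀ x, F x ≤ δ) {Y : ℝ≥0 → Ω → E} (hY : ∀ t, Measurable (Y t))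
    (t : ℝ≥0) :
    Integrable
      (fun ω => (brokenLine n F (fun r => Y r ω) (timePair (zero_le (a := t))) : ℝ)) P := by
  refine Integrable.of_bound (((continuous_eval_const _).measurable.comp
    (measurable_brokenLine n hF hY)).coe_nnreal_real.aestronglyMeasurable)
    ((⌈(n : ℝ≥0) * t⌉₊ * δ : ℝ≥0) : ℝ) (.of_forall fun ω => ?_)
  rw [Real.norm_of_nonneg (NNReal.coe_nonneg _), NNReal.coe_le_coe, coe_brokenLine_zero]
  refine (interp_mono _ (Nat.le_ceil _)).trans ?_
  have h := interp_add_le (a := fun k => F fun l => Y (((k + l : ℕ) : ℝ≥0) / n) ω)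
    (fun k => hFδ _) 0 ⌈(n : ℝ≥0) * t⌉₊
  simpa [interp] using h

section Asymptotics

variable {E : Type u} [MetricSpace E] [MeasurableSpace E] [BorelSpace E]
  {Ω : Type v'} [MeasurableSpace Ω] {M : HomogeneousMarkovProcess E Ω}
  {ν : Measure E} [IsProbabilityMeasure ν]
  {Ωn : ℕ → Type v} [∀ n, MeasurableSpace (Ωn n)]
  {μ : ∀ n, Measure (Ωn n)} [∀ n, IsProbabilityMeasure (μ n)]
  {X : ∀ n, ℝ≥0 → Ωn n → E} {κ : ℕ → ℕ → KernelFamily E}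
  {L : ℕ} {F : ℕ → (Fin L → E) → ℝ≥0} {φ : ℝ≥0 → ℝ≥0 → Ω → ℝ≥0}
  {Φ : (ℝ≥0 → E) → C(TimePairs, ℝ≥0)}

open HomogeneousMarkovProcess.IsWFunctional in
/-- The processes can be coupled so that, at each fixed time, the broken line is close in
probability to the W-functional. -/
theorem exists_coupling_measure_le (hX : ∀ n t, Measurable (X n t))
    (hκ : ∀ n, 0 < n → ∀ i : ℕ, IsCondFDD (μ n) (X n)
      (pastSigma (X n) ((i : ℝ≥0) / n)) ((i : ℝ≥0) / n) (κ n i))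
    (happrox : ProvidesMarkovApproximation.{u, v, v', w} μ X (M.law ν) M.X)
    (hL : 1 ≤ L) (hF : ∀ n, Measurable (F n))
    (hFbdd : ∀ n, 0 < n → (⨆ x, (F n x : ℝ≥0∞)) < ∞)
    (hFzero : Tendsto (fun n => ⨆ x, (F n x : ℝ≥0∞)) atTop (𝓝 0))
    (hφ : M.IsWFunctional φ)
    (hconv : ∀ T : ℝ≥0, Tendsto
      (fun n : ℕ => ⨆ (i : ℕ) (t : ℝ≥0) (_ : (i : ℝ≥0) / n < t ∧ t < T),
        supNorm fun x => chainCharacteristic n (F n) i (κ n i) t x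
          - M.characteristic φ ((i : ℝ≥0) / n) t x)
      atTop (𝓝 0))
    (hunif : ∀ T : ℝ≥0, ∀ ε : ℝ, 0 < ε → ∃ δ : ℝ, 0 < δ ∧ ∀ x x' : E, dist x x' < δ →
      ∀ s t : ℝ≥0, s ≤ t → t < T →
        |M.characteristic φ s t x - M.characteristic φ s t x'| < ε)
    (hΦ : Measurable Φ) (hΦφ : functionalPath φ =ᵐ[M.law ν] fun ω => Φ fun t => M.X t ω)
    (T : ℝ≥0) {η ρ : ℝ} (hη : 0 < η) (hρ : 0 < ρ) :
    ∃ (Ω' : Type w) (_ : MeasurableSpace Ω') (P : Measure Ω') (X1 X2 : ℕ → ℝ≥0 → Ω' → E),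
      IsProbabilityMeasure P ∧
      (∀ n t, Measurable (X1 n t)) ∧ (∀ n t, Measurable (X2 n t)) ∧
      (∀ n, 0 < n →
        IdentDistrib (fun ω t => X1 n t ω) (fun ω t => X n t ω) P (μ n) ∧
        IdentDistrib (fun ω t => X2 n t ω) (fun ω t => M.X t ω) P (M.law ν)) ∧
      ∀ᶠ n in atTop, ∀ t ≤ T,
        P {ω | η ≤ |(brokenLine n (F n) (fun r => X1 n r ω) (timePair (zero_le (a := t))) : ℝ)
          - Φ (fun r => X2 n r ω) (timePair (zero_le (a := t)))|} ≤ ENNReal.ofReal ρ := by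
  -- the assumptions control the times strictly before a horizon
  set Th : ℝ≥0 := T + 1 with hTh
  have hsup : supMean M φ Th ≠ ∞ := (hφ.bounded _).ne
  set C₀ : ℝ := (supMean M φ Th).toReal with hC₀def
  have hC : supMean M φ Th ≤ ENNReal.ofReal C₀ := (ENNReal.ofReal_toReal hsup).ge
  have hC₀ : 0 ≤ C₀ := ENNReal.toReal_nonneg
  obtain ⟨ε, hε, hbound⟩ := exists_forall_sqrt_add_le C₀ hC₀ (mul_pos hη hρ)
  obtain ⟨d, hd, hdu⟩ := hunif Th ε hε
  have hchar : ∀ s t, s ≤ t → t < Th → Measurable (M.characteristic φ s t) := by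
    intro s t hst ht
    refine Continuous.measurable (Metric.continuous_iff.2 fun x e he => ?_)
    obtain ⟨d', hd', h⟩ := hunif Th e he
    exact ⟨d', hd', fun y hy => by rw [Real.dist_eq]; exact h y x hy s t hst ht⟩
  -- `d / 2` for the continuity of the characteristic, `ε ^ 2` for the probability of the bad event
  set γ : ℝ := min (d / 2) (ε ^ 2) with hγdef
  have hγ : 0 < γ := lt_min (by positivity) (by positivity)
  obtain ⟨K₀, hK₀, Ω', _, P, X1, X2, hP, hX1, hX2, hlaw, hMarkov, hlimsup⟩ := happrox γ hγ Th
  refine ⟨Ω', _, P, X1, X2, hP, hX1, hX2, hlaw, ?_⟩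
  -- a multiple of `K₀`, large enough for `L ≤ K + 1`
  set K : ℕ := K₀ * L with hKdef
  have hK : 0 < K := Nat.mul_pos hK₀ hL
  have hLK : L ≤ K + 1 := (Nat.le_mul_of_pos_left L hK₀).trans (Nat.le_succ _)
  have hcast : ∀ n j : ℕ, ((j * K : ℕ) : ℝ≥0) / n = (((j * L : ℕ) : ℝ≥0) * K₀) / n := fun n j => by
    rw [hKdef]; push_cast; ring
  have hev1 := eventually_lt_of_limsup_lt hlimsup
  have hev2 : ∀ᶠ n in atTop, (⨆ x, (F n x : ℝ≥0∞)) ≤ ENNReal.ofReal (ε / K) :=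
    (hFzero.eventually_lt_const (ENNReal.ofReal_pos.2 (by positivity))).mono fun _ h => h.le
  have hev3 := (hconv Th).eventually_lt_const (ENNReal.ofReal_pos.2 hε)
  filter_upwards [hev1, hev2, hev3, eventually_gt_atTop K] with n h1 h2 h3 hnK t ht
  have hn : 0 < n := hK.trans hnK
  have hn' : (0 : ℝ≥0) < n := by exact_mod_cast hn
  have hK₀' : (0 : ℝ≥0) < K₀ := by exact_mod_cast hK₀
  have htTh : t < Th := ht.trans_lt (lt_add_one T)
  set δ : ℝ≥0 := (⨆ x, (F n x : ℝ≥0∞)).toNNReal with hδdef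
  have hFδ : ∀ x, F n x ≤ δ := fun x => by
    rw [← ENNReal.coe_le_coe, hδdef, ENNReal.coe_toNNReal (hFbdd n hn).ne]
    exact le_iSup (fun x => (F n x : ℝ≥0∞)) x
  have hKδ : (K * δ : ℝ) ≤ ε := by
    have h4 : (δ : ℝ) ≤ ε / K := ENNReal.toReal_le_of_le_ofReal (by positivity) h2
    rw [le_div_iff₀ (by exact_mod_cast hK)] at h4
    linarith
  have hKT : (K : ℝ≥0) / n < Th := by
    have h4 : (K : ℝ≥0) / n < 1 := by
      rw [div_lt_one hn']
      exact_mod_cast hnK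
    exact h4.trans_le le_add_self
  have hconv' : ∀ (i : ℕ) (t : ℝ≥0), (i : ℝ≥0) / n < t → t < Th → ∀ x,
      |chainCharacteristic n (F n) i (κ n i) t x - M.characteristic φ ((i : ℝ≥0) / n) t x| ≤ ε := by
    intro i t hit htT x
    have h4 := ((le_iSup₂_of_le i t (le_iSup_of_le ⟨hit, htT⟩ (le_iSup (fun x =>
      ‖chainCharacteristic n (F n) i (κ n i) t x - M.characteristic φ ((i : ℝ≥0) / n) t x‖ₑ) x))
        ).trans_lt h3).le
    rwa [Real.enorm_eq_ofReal_abs, ENNReal.ofReal_le_ofReal_iff hε.le] at h4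
  set bad : Set Ω' := {ω | ∃ i : ℕ, 1 ≤ i ∧ (i : ℝ≥0) ≤ Th * n / K₀ ∧
    γ < dist (X1 n ((i * K₀ : ℝ≥0) / n) ω) (X2 n ((i * K₀ : ℝ≥0) / n) ω)} with hbaddef
  have hbadlam : P.real (toMeasurable P bad) ≤ ε ^ 2 := by
    rw [measureReal_def, measure_toMeasurable]
    exact (ENNReal.toReal_le_of_le_ofReal hγ.le h1.le).trans (min_le_right _ _)
  have hL1 := integral_abs_brokenLine_sub_le hφ hΦ hΦφ hchar hn hK hLK (hF n) hFδ (hX n) (hκ n hn)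
    (hX1 n) (hX2 n) (hlaw n hn).1 (hlaw n hn).2
    (fun j hj => by rw [hcast]; exact (hMarkov n hn (j * L) (Nat.mul_pos hj hL)).2.1)
    (fun j hj => by rw [hcast]; exact (hMarkov n hn (j * L) (Nat.mul_pos hj hL)).2.2)
    hC₀ hC hε.le hconv' hKT hε.le hε (measurableSet_toMeasurable P bad) hbadlam
    (fun ω hω j hj hjT s hs hjs => by
      have h4 : ω ∉ bad := fun h => hω (subset_toMeasurable P bad h)
      have h5 : ((j * L : ℕ) : ℝ≥0) ≤ Th * n / K₀ := by
        rw [hcast, div_lt_iff₀ hn'] at hjT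
        rw [le_div_iff₀ hK₀']
        exact hjT.le
      refine (hdu _ _ ?_ _ s hjs hs).le
      rw [hcast]
      by_contra h6
      refine h4 ⟨j * L, Nat.mul_pos hj hL, h5, ?_⟩
      have h7 : γ ≤ d / 2 := min_le_left _ _
      linarith [not_lt.1 h6])
    htTh
  have h4 := hL1.trans (hbound _ (by positivity) hKδ)
  have hint : Integrable (fun ω =>
      |(brokenLine n (F n) (fun r => X1 n r ω) (timePair (zero_le (a := t))) : ℝ)
        - Φ (fun r => X2 n r ω) (timePair (zero_le (a := t)))|) P :=
    ((integrable_brokenLine_zero (hF n) hFδ (hX1 n) t).sub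
      (integrable_coe ((measurable_eval hΦ _).comp (measurable_pi_lambda _ (hX2 n))).aemeasurable
        (ne_top_of_le_ne_top (hφ.bounded _).ne
          (hφ.lintegral_le_of_identDistrib hΦ hΦφ (hX2 n) (hlaw n hn).2 _)))).abs
  have h5 := mul_meas_ge_le_integral_of_nonneg (.of_forall fun ω => abs_nonneg _) hint η
  have h6 := (mul_le_mul_iff_right₀ hη).1 (h5.trans h4)
  rw [measureReal_def] at h6
  exact (ENNReal.le_ofReal_iff_toReal_le (measure_ne_top _ _) hρ.le).2 h6

end Asymptotics

end MarkovInvariance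

theorem mainTheorem1
    {E : Type u} [MetricSpace E] [LocallyCompactSpace E] [MeasurableSpace E] [BorelSpace E]
    -- the limit process, with arbitrary initial distribution
    {Ω : Type v'} [MeasurableSpace Ω] (M : HomogeneousMarkovProcess E Ω)
    (ν : Measure E) [IsProbabilityMeasure ν]
    -- the prelimit processes, with their conditional finite-dimensional distributions
    {Ωn : ℕ → Type v} [∀ n, MeasurableSpace (Ωn n)]
    (μ : ∀ n, Measure (Ωn n)) [∀ n, IsProbabilityMeasure (μ n)]
    (X : ∀ n, ℝ≥0 → Ωn n → E) (hX : ∀ n t, Measurable (X n t))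
    (κ : ℕ → ℕ → KernelFamily E)
    (hκ : ∀ n, 0 < n → ∀ i : ℕ, IsCondFDD (μ n) (X n)
      (pastSigma (X n) ((i : ℝ≥0) / n)) ((i : ℝ≥0) / n) (κ n i))
    (happrox : ProvidesMarkovApproximation.{u, v, v', w} μ X (M.law ν) M.X)
    -- the additive functionals of the prelimit processes
    {L : ℕ} (hL : 1 ≤ L) (F : ℕ → (Fin L → E) → ℝ≥0) (hF : ∀ n, Measurable (F n))
    (hFbdd : ∀ n, 0 < n → (⨆ x, (F n x : ℝ≥0∞)) < ∞)
    (hFzero : Tendsto (fun n => ⨆ x, (F n x : ℝ≥0∞)) atTop (𝓝 0))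
    -- the W-functional of the limit process
    (φ : ℝ≥0 → ℝ≥0 → Ω → ℝ≥0) (hφ : M.IsWFunctional φ)
    (hconv : ∀ T : ℝ≥0, Tendsto
      (fun n : ℕ => ⨆ (i : ℕ) (t : ℝ≥0) (_ : (i : ℝ≥0) / n < t ∧ t < T),
        supNorm fun x => chainCharacteristic n (F n) i (κ n i) t x
          - M.characteristic φ ((i : ℝ≥0) / n) t x)
      atTop (𝓝 0))
    (hunif : ∀ T : ℝ≥0, ∀ ε : ℝ, 0 < ε → ∃ δ : ℝ, 0 < δ ∧ ∀ x x' : E, dist x x' < δ →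
      ∀ s t : ℝ≥0, s ≤ t → t < T →
        |M.characteristic φ s t x - M.characteristic φ s t x'| < ε) :
    TendstoInDistribution (fun n ω => brokenLine n (F n) fun t => X n t ω) atTop
      (functionalPath φ) μ (M.law ν) := by
  have hbm : ∀ n, Measurable fun ω => brokenLine n (F n) fun t => X n t ω := fun n =>
    measurable_brokenLine n (hF n) (hX n)
  refine ⟨fun n => (hbm n).aemeasurable, hφ.aemeasurable_functionalPath ν, ?_⟩
  obtain ⟨Φ, hΦ, hΦφ⟩ := hφ.exists_pathFunctional ν
  -- the compact-open topology on `C(𝕋, ℝ⁺)` is metrizable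
  let := UniformSpace.pseudoMetricSpace C(TimePairs, ℝ≥0)
  refine tendsto_of_forall_coupling.{w} fun e he => ?_
  obtain ⟨T, η, hη, hdist⟩ := exists_forall_dist_lt he
  have hlawid : IdentDistrib (fun ω t => M.X t ω) (fun ω t => M.X t ω) (M.law ν) (M.law ν) :=
    .refl M.measurable_path.aemeasurable
  obtain ⟨m, hm, hmS⟩ := exists_partition_measure_le (hΦ.comp M.measurable_path)
    (hφ.ae_additive_of_identDistrib hΦ hΦφ hlawid) T (η := η / 4) (e := e / 2)
    (by positivity) (by positivity)
  obtain ⟨Ω', _, P, X1, X2, hP, hX1, hX2, hlaw, hev⟩ := exists_coupling_measure_le hX hκ happrox hL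
    hF hFbdd hFzero hφ hconv hunif hΦ hΦφ T (η := η / 4) (ρ := e / 2 / (m + 1))
    (by positivity) (by positivity)
  filter_upwards [hev, eventually_gt_atTop 0] with n hn hn0
  obtain ⟨hlaw1, hlaw2⟩ := hlaw n hn0
  have hpath2 : Measurable fun ω t => X2 n t ω := measurable_pi_lambda _ (hX2 n)
  set c' : Ω' → C(TimePairs, ℝ≥0) := fun ω => brokenLine n (F n) fun t => X1 n t ω with hc'
  set c : Ω' → C(TimePairs, ℝ≥0) := fun ω => Φ fun t => X2 n t ω with hc
  have hblm : Measurable fun Y : ℝ≥0 → E => brokenLine n (F n) fun t => Y t :=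
    measurable_brokenLine n (hF n) fun t => measurable_pi_apply t
  refine ⟨Ω', _, P, c', c, hP, measurable_brokenLine n (hF n) (hX1 n), hΦ.comp hpath2,
    (hlaw1.comp hblm).map_eq, ((hlaw2.comp hΦ).map_eq).trans (Measure.map_congr hΦφ).symm, ?_⟩
  -- a large increment of the limit, a large deviation at a partition point, a failure of additivity
  set S : Set (ℝ≥0 → E) := {w | ∃ i < m,
    η / 4 < (Φ w (timePair (partitionPoint_mono 0 T m (Nat.le_succ i))) : ℝ)} with hS
  have hSm : MeasurableSet S := hΦ (measurableSet_exists_increment T m (η / 4))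
  set B : Set Ω' := ⋃ i ∈ Finset.range (m + 1), {ω | η / 4 ≤
    |(c' ω (timePair (zero_le (a := partitionPoint 0 T m i))) : ℝ)
      - c ω (timePair (zero_le (a := partitionPoint 0 T m i)))|} with hB
  set Z : Set Ω' := {ω | ¬ ∀ (s t : ℝ≥0) (h : s ≤ t),
    c ω (timePair (zero_le (a := s))) + c ω (timePair h)
      = c ω (timePair (zero_le (a := t)))} with hZ
  refine ⟨B ∪ (fun ω t => X2 n t ω) ⁻¹' S ∪ Z, ?_, fun ω hω => ?_⟩
  · have h1 : P Z = 0 := hφ.ae_additive_of_identDistrib hΦ hΦφ hlaw2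
    have h2 : P ((fun ω t => X2 n t ω) ⁻¹' S) ≤ ENNReal.ofReal (e / 2) := by
      rw [hlaw2.measure_preimage_eq hSm]
      exact hmS
    have h3 : P B ≤ ENNReal.ofReal (e / 2) := by
      refine (measure_biUnion_finset_le _ _).trans ?_
      refine (Finset.sum_le_card_nsmul _ _ (ENNReal.ofReal (e / 2 / (m + 1))) fun i hi =>
        hn _ ?_).trans ?_
      · exact (partitionPoint_mono 0 T m (Nat.lt_succ_iff.1 (Finset.mem_range.1 hi))).trans_eq
          (partitionPoint_self zero_le hm)
      · rw [Finset.card_range, ← ENNReal.ofReal_nsmul, nsmul_eq_mul]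
        refine ENNReal.ofReal_le_ofReal (le_of_eq ?_)
        push_cast
        field_simp
    calc P (B ∪ (fun ω t => X2 n t ω) ⁻¹' S ∪ Z)
        ≤ P B + P ((fun ω t => X2 n t ω) ⁻¹' S) + P Z :=
          (measure_union_le _ _).trans (add_le_add_left (measure_union_le _ _) _)
      _ ≤ ENNReal.ofReal (e / 2) + ENNReal.ofReal (e / 2) + 0 := by
          rw [h1]
          gcongr
      _ = ENNReal.ofReal e := by
          rw [add_zero, ← ENNReal.ofReal_add (by positivity) (by positivity), add_halves]
  · simp only [Set.mem_union, not_or] at hω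
    obtain ⟨⟨hωB, hωS⟩, hωZ⟩ := hω
    refine hdist _ _ fun p hp => ?_
    have h1 := dist_le_of_partition (c := c ω) (c' := c' ω) (not_not.1 hωZ)
      (fun s t h => brokenLine_add h) hm (η := η / 4) (fun i hi => ?_) (fun i hi => ?_) p hp
    · linarith
    · by_contra h2
      exact hωB (Set.mem_biUnion (Finset.mem_coe.2 (Finset.mem_range.2 (Nat.lt_succ_of_le hi)))
        (not_le.1 h2).le)
    · by_contra h2
      exact hωS ⟨i, hi, not_le.1 h2⟩
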